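/- Let $q\ge 2$ and $d\ge 1$ be integers, let $A_0,\dots,A_{q-1}\in\mathbb{C}^{d\times d}$, and let $(v(n))_{n\ge 0}$ be a sequence in $\mathbb{C}^d$ with $v(qn+r)=A_r v(n)$ for all $n\ge 0$ and $0\le r<q$. Let $x(n)$ be the first component of $v(n)$ (so $x$ is a $q$-regular sequence with this linear representation), and put $X(N)=\sum_{0\le n<N}x(n)$ and $C=\sum_{r=0}^{q-1}A_r$. Fix a norm on $\mathbb{C}^d$ with its induced matrix norm, and let $R>0$ be such that $\|A_{r_1}\cdots A_{r_\ell}\|=O(R^\ell)$ uniformly for all $\ell\ge 0$ and $0\le r_1,\dots,r_\ell<q$. Let $\sigma(C)$ be the set of eigenvalues of $C$, and for $\lambda\in\sigma(C)$ let $m(\lambda)$ be the size of the largest Jordan block of $C$ for $\lambda$. Let $\log$ be the principal logarithm, $\log_q z=\log z/\log q$, $\{z\}=z-\lfloor z\rfloor$ for real $z$, and $\chi_\ell=2\ell\pi i/\log q$. Consider the Dirichlet series $\mathcal{V}(s)=\sum_{n\ge 1}n^{-s}v(n)$ and its first component $\mathcal{X}(s)=\sum_{n\ge1}n^{-s}x(n)$.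 Then there are $1$-periodic continuous functions $\Phi_{\lambda k}\colon\mathbb{R}\to\mathbb{C}$ ($\lambda\in\sigma(C)$, $|\lambda|>R$, $0\le k<m(\lambda)$) such that the following hold. 1. As $N\to\infty$ through the integers, $$X(N)=\sum_{\substack{\lambda\in\sigma(C)\\|\lambda|>R}}N^{\log_q\lambda}\sum_{0\le k<m(\lambda)}(\log_q N)^k\,\Phi_{\lambda k}(\{\log_q N\})+O\bigl(N^{\log_q R}(\log N)^{\max\{m(\lambda):\lambda\in\sigma(C),\,|\lambda|=R\}}\bigr),$$ where the maximum of the empty set is $0$. If no $\lambda\in\sigma(C)$ satisfies $|\lambda|\le R$, then the equation holds without the $O$-term for all integers $N\ge 1$. 2. Each $\Phi_{\lambda k}$ is Hölder continuous with every positive exponent smaller than $\log_q(|\lambda|/R)$. 3. The series $\mathcal{V}(s)$ converges absolutely and uniformly on compact subsets of the half plane $\Re s>\log_q R+1$ and has a meromorphic continuation, also denoted by $\mathcal{V}$, to the half plane $\Re s>\log_q R$. It satisfies $$(I-q^{-s}C)\mathcal{V}(s)=\sum_{n=1}^{q-1}n^{-s}v(n)+q^{-s}\sum_{r=0}^{q-1}A_r\sum_{k\ge1}\binom{-s}{k}\Bigl(\frac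 rq\Bigr)^k\mathcal{V}(s+k)$$ for all $s$ with $\Re s>\log_q R$ that are not poles of $\mathcal{V}$. The series over $k$ on the right-hand side converge absolutely and uniformly on compact subsets of $\Re s>\log_q R$. In particular, $\mathcal{V}$ can have poles only at points $s$ with $q^s\in\sigma(C)$. 4. For $\lambda\in\sigma(C)$ with $|\lambda|>\max\{R,1/q\}$ and $0\le k<m(\lambda)$, the Fourier series $$\Phi_{\lambda k}(u)=\sum_{\ell\in\mathbb{Z}}\varphi_{\lambda k\ell}\exp(2\ell\pi i u)$$ converges pointwise to $\Phi_{\lambda k}(u)$ for every $u\in\mathbb{R}$ (the sums over $-M\le\ell\le M'$ converge as $M,M'\to\infty$ independently), and its Fourier coefficients are $$\varphi_{\lambda k\ell}=\int_0^1\Phi_{\lambda k}(u)e^{-2\ell\pi i u}\,du=\frac{(\log q)^k}{k!}\operatorname*{Res}_{s=\log_q\lambda+\chi_\ell}\frac{\bigl(x(0)+\mathcal{X}(s)\bigr)\bigl(s-\log_q\lambda-\chi_\ell\bigr)^k}{s}\qquad(\ell\in\mathbb{Z}).$$ -/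

import Mathlib

open Filter Topology Asymptotics
open scoped Matrix NNReal

namespace QRegular

/-- `(A, v)` is a `q`-linear representation of the sequence `x`: the first component of `v` is `x`
and `v (q n + r) = A r v n` for all `n ≥ 0` and `0 ≤ r < q`. -/
structure IsLinearRepresentation (q d : ℕ) [NeZero d] (A : Fin q → Matrix (Fin d) (Fin d) ℂ)
    (v : ℕ → Fin d → ℂ) (x : ℕ → ℂ) : Prop where
  first_component : ∀ n : ℕ, v n 0 = x n
  recurrence : ∀ (n : ℕ) (r : Fin q), v (q * n + r) = A r *ᵥ v n

/-- `‖A r₁ ⋯ A r_ℓ‖ = O(R ^ ℓ)`, uniformly in `ℓ ≥ 0` and in the indices, for the matrix norm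
that is induced by the vector norm `nrm`: the induced norm of a matrix `M` is at most a constant
`K ≥ 0` if and only if `nrm (M y) ≤ K * nrm y` for all vectors `y`. -/
def ProductsBounded {q d : ℕ} (nrm : Seminorm ℂ (Fin d → ℂ))
    (A : Fin q → Matrix (Fin d) (Fin d) ℂ) (R : ℝ) : Prop :=
  ∃ c : ℝ, ∀ (w : List (Fin q)) (y : Fin d → ℂ),
    nrm ((w.map A).prod *ᵥ y) ≤ c * R ^ w.length * nrm y

/-- The spectrum (set of eigenvalues) of a complex matrix as a finite set. -/
noncomputable def eigenvalues {d : ℕ} (C : Matrix (Fin d) (Fin d) ℂ) : Finset ℂ :=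
  (Matrix.finite_spectrum C).toFinset

/-- The size of the largest Jordan block of `C` for `μ`, that is, the length of the longest Jordan
chain of `C` for `μ`: the least `k` such that the kernel of `(C - μ) ^ k` is the whole generalized
eigenspace. It is `0` if `μ` is not an eigenvalue. -/
noncomputable def maxJordanBlock {d : ℕ} (C : Matrix (Fin d) (Fin d) ℂ) (μ : ℂ) : ℕ :=
  Module.End.maxGenEigenspaceIndex (Matrix.toLin' C) μ

/-- The maximum of the sizes of the Jordan blocks of `C` for eigenvalues of absolute value `R`
(`0` if there are none). -/
noncomputable def criticalExponent {d : ℕ} (C : Matrix (Fin d) (Fin d) ℂ) (R : ℝ) : ℕ :=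
  ((eigenvalues C).filter (fun μ => ‖μ‖ = R)).sup (maxJordanBlock C)

/-- The complex number `log_q μ` for the principal value of the logarithm. -/
noncomputable def clogb (q : ℕ) (μ : ℂ) : ℂ := Complex.log μ / (Real.log q : ℂ)

/-- The summatory function `X N = ∑_{0 ≤ n < N} x n`. -/
def summatory (x : ℕ → ℂ) (N : ℕ) : ℂ := ∑ n ∈ Finset.range N, x n

/-- The sum over the eigenvalues `μ` with `|μ| > R` of
`N ^ (log_q μ) * ∑_{0 ≤ k < m(μ)} (log_q N) ^ k * Φ_{μ k} ({log_q N})`. -/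
noncomputable def fluctuationSum {d : ℕ} (q : ℕ) (C : Matrix (Fin d) (Fin d) ℂ) (R : ℝ)
    (Φ : ℂ → ℕ → ℝ → ℂ) (N : ℕ) : ℂ :=
  ∑ μ ∈ (eigenvalues C).filter (fun μ => R < ‖μ‖),
    (N : ℂ) ^ clogb q μ *
      ∑ k ∈ Finset.range (maxJordanBlock C μ),
        ((Real.logb q N : ℝ) : ℂ) ^ k * Φ μ k (Int.fract (Real.logb q N))

/-- The series `∑ f n` of functions converges absolutely and uniformly on compact subsets of `U`:
on every compact subset, the series of the absolute values converges uniformly. -/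
def ConvergesAbsUnifOnCompacts {E : Type*} [NormedAddCommGroup E] (f : ℕ → ℂ → E)
    (U : Set ℂ) : Prop :=
  (∀ s ∈ U, Summable fun n => ‖f n s‖) ∧
    ∀ K ⊆ U, IsCompact K →
      TendstoUniformlyOn (fun (M : ℕ) (s : ℂ) => ∑ n ∈ Finset.range M, ‖f n s‖)
        (fun s => ∑' n, ‖f n s‖) atTop K

/-- The summands of the Dirichlet series `∑_{n ≥ 1} n ^ (-s) v n`, with `n` shifted by one. -/
noncomputable def dirichletTerm {d : ℕ} (v : ℕ → Fin d → ℂ) (n : ℕ) (s : ℂ) : Fin d → ℂ :=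
  ((n + 1 : ℕ) : ℂ) ^ (-s) • v (n + 1)

/-- The summands of `∑_{k ≥ 1} binom(-s, k) * t ^ k * V (s + k)`, with `k` shifted by one. -/
noncomputable def shiftTerm {d : ℕ} (V : ℂ → Fin d → ℂ) (t : ℂ) (k : ℕ) (s : ℂ) : Fin d → ℂ :=
  (Ring.choose (-s) (k + 1) * t ^ (k + 1)) • V (s + ((k + 1 : ℕ) : ℂ))

/-- `f` is meromorphic at `c` and its residue at `c` is `a`: `∮ f = 2 π i a` along all
sufficiently small circles around `c`. -/
def HasResidueAt (f : ℂ → ℂ) (c a : ℂ) : Prop :=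
  MeromorphicAt f c ∧
    ∀ᶠ r : ℝ in 𝓝[>] 0, (∮ z in C(c, r), f z) = 2 * Real.pi * Complex.I * a

/-- The point `log_q μ + 2 ℓ π i / log q`. -/
noncomputable def polePoint (q : ℕ) (μ : ℂ) (l : ℤ) : ℂ :=
  clogb q μ + 2 * l * Real.pi * Complex.I / (Real.log q : ℂ)

end QRegular

/-!
Let `S N = ∑_{n < N} v n`. The recurrence gives `S (q N) = C S N`, and `S (q N + r) - C S N` is a
partial block of at most `q` terms `v n`, which are `O(R ^ L)` when the arguments have `L` digits.
If `R < 1`, then prepending zero digits shows that `v` vanishes, so let `R ≥ 1`.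

*The expansion.* By Bézout's identity (`exists_decomposition`) every row vector `e` is a sum of
generalized left eigenvectors `w` of `C`. For `|μ| ≤ R`, unfolding the digits of `N` shows that
`w ⬝ᵥ S N` belongs to the error term. For `|μ| > R`, the matrix `C` is invertible on the
generalized eigenspace, and `w C ^ (-n) ⬝ᵥ S ⌊t q ^ n⌋` converges geometrically as `n → ∞`
(`scaledLimit`). The limit agrees with `w ⬝ᵥ S N` at `t = N`, is locally Hölder continuous in `t`,
and the limits `S_j` for the Jordan chain `μ ^ (-j) w (C - μ) ^ j` satisfy
`S_j (q t) = μ (S_j t + S_{j+1} t)` (`BlockRegular.exists_jordan_chain`). Therefore, by Pascal's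
rule, the polynomial `μ ^ (-y) ∑_j S_j (q ^ y) binom(X - y, j)` is `1`-periodic in `y`
(`fluctuationPoly`); its coefficients are the fluctuations `Φ_{μ k}`, and its value at `X = y` is
`μ ^ (-y) S_0 (q ^ y)`, which is the expansion. The estimate is proved for all real `t`, not only
for integers (`BlockRegular.exists_expansion`), because it is integrated below.

*The continuation.* By partial summation, the components of `v 0 + 𝒱 s` are `s` times the integrals
of `S t ^ (-s-1)` over `t > 1`. Substituting `q t` for `t` in the integral of
`t ^ κ Φ (log_q t) t ^ (-s-1)` over `t > 1` gives a quotient with denominator `q ^ s - q ^ κ`, whose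
numerator at the zeros of the denominator is a Fourier coefficient of `Φ`; powers of `log_q t` are
produced by differentiation with respect to `s` (`waveMellin`, `hasPolarTerm_waveMellin`). The
remainder of the expansion contributes a function that is analytic for `Re s > log_q R`. This yields
the meromorphic continuation, its poles, and the residues.

*The functional equation.* In the half plane of absolute convergence, the Dirichlet series is split
into residue classes modulo `q`, `(q n + r) ^ (-s)` is expanded into a binomial series, and the sums
are interchanged (`dirichletSum_eq`). Both sides are meromorphic for `Re s > log_q R`, and the
identity theorem extends the equation (`functional_equation`).

*The Fourier series.* Hölder continuity makes Dini's criterion applicable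
(`tendsto_fourier_partial_sums`).
-/

namespace QRegular

/-! ### Linear algebra -/

variable {d : ℕ}

lemma norm_dotProduct_le (w y : Fin d → ℂ) : ‖w ⬝ᵥ y‖ ≤ d * ‖w‖ * ‖y‖ := by
  calc ‖w ⬝ᵥ y‖ ≤ ∑ i, ‖w i * y i‖ := norm_sum_le _ _
    _ ≤ ∑ _i : Fin d, ‖w‖ * ‖y‖ := by
        refine Finset.sum_le_sum fun i _ => ?_
        rw [norm_mul]
        exact mul_le_mul (norm_le_pi_norm w i) (norm_le_pi_norm y i) (norm_nonneg _) (norm_nonneg _)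
    _ = d * ‖w‖ * ‖y‖ := by simp [mul_assoc]

/-- Powers of a unipotent matrix grow polynomially on a row vector that is annihilated by
`X ^ (m + 1)`. -/
lemma exists_norm_vecMul_one_add_pow_le (X : Matrix (Fin d) (Fin d) ℂ) (m : ℕ) :
    ∀ w : Fin d → ℂ, w ᵥ* X ^ (m + 1) = 0 →
      ∃ K : ℝ, 0 ≤ K ∧ ∀ n : ℕ, ‖w ᵥ* (1 + X) ^ n‖ ≤ K * (n + 1) ^ m := by
  induction m with
  | zero =>
    intro w hw
    have h : ∀ n : ℕ, w ᵥ* (1 + X) ^ n = w := by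
      intro n
      induction n with
      | zero => simp
      | succ n ih =>
        rw [pow_succ, ← Matrix.vecMul_vecMul, ih, Matrix.vecMul_add, Matrix.vecMul_one]
        simpa using hw
    exact ⟨‖w‖, norm_nonneg _, fun n => by simp [h]⟩
  | succ m ih =>
    intro w hw
    obtain ⟨K, hK, hb⟩ := ih (w ᵥ* X) (by rw [Matrix.vecMul_vecMul, ← pow_succ', hw])
    refine ⟨‖w‖ + K, by positivity, fun n => ?_⟩
    have h : ∀ n : ℕ, ‖w ᵥ* (1 + X) ^ n‖ ≤ ‖w‖ + n * (K * (n + 1) ^ m) := by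
      intro n
      induction n with
      | zero => simp
      | succ n ih =>
        have e : w ᵥ* (1 + X) ^ (n + 1) = w ᵥ* (1 + X) ^ n + (w ᵥ* X) ᵥ* (1 + X) ^ n := by
          rw [pow_succ', Matrix.vecMul_vecMul, ← Matrix.vecMul_add, add_mul, one_mul]
        rw [e]
        have h1 := (norm_add_le (w ᵥ* (1 + X) ^ n) ((w ᵥ* X) ᵥ* (1 + X) ^ n)).trans
          (add_le_add ih (hb n))
        have h2 : K * ((n : ℝ) + 1) ^ m ≤ K * ((n + 1 : ℕ) + 1 : ℝ) ^ m := by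
          push_cast; gcongr; linarith
        refine h1.trans ?_
        push_cast at h2 ⊢
        nlinarith [mul_le_mul_of_nonneg_left h2 (Nat.cast_nonneg (α := ℝ) n)]
    refine (h n).trans ?_
    have h1 : (1 : ℝ) ≤ ((n : ℝ) + 1) ^ (m + 1) := one_le_pow₀ (by linarith [Nat.cast_nonneg (α := ℝ) n])
    have h2 : (n : ℝ) * (K * (n + 1) ^ m) ≤ K * (n + 1) ^ (m + 1) := by
      rw [pow_succ]
      have : 0 ≤ K * ((n : ℝ) + 1) ^ m := by positivity
      nlinarith
    nlinarith [norm_nonneg w]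

lemma exists_norm_vecMul_one_add_pow_le' (X : Matrix (Fin d) (Fin d) ℂ) (m : ℕ)
    (w : Fin d → ℂ) (hw : w ᵥ* X ^ m = 0) :
    ∃ K : ℝ, 0 ≤ K ∧ ∀ n : ℕ, ‖w ᵥ* (1 + X) ^ n‖ ≤ K * (n + 1) ^ (m - 1) := by
  rcases m with _ | m
  · have : w = 0 := by simpa using hw
    exact ⟨0, le_rfl, fun n => by simp [this]⟩
  · exact exists_norm_vecMul_one_add_pow_le X m w hw

/-- A polynomial is bounded by a constant times a growing exponential. -/
lemma exists_pow_le_mul_pow (m : ℕ) {r : ℝ} (hr : 1 < r) :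
    ∃ K : ℝ, 0 ≤ K ∧ ∀ n : ℕ, ((n : ℝ) + 1) ^ m ≤ K * r ^ n := by
  have h := tendsto_pow_const_div_const_pow_of_one_lt m hr
  have hb := (h.comp (tendsto_add_atTop_nat 1)).bddAbove_range
  obtain ⟨K, hK⟩ := hb
  have hr0 : 0 < r := by linarith
  have hK' : ∀ n : ℕ, ((n : ℝ) + 1) ^ m ≤ K * r * r ^ n := by
    intro n
    have := hK (Set.mem_range_self n)
    simp only [Function.comp_apply, Nat.cast_add, Nat.cast_one] at this
    rw [div_le_iff₀ (by positivity), pow_succ] at this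
    linarith
  refine ⟨K * r, ?_, hK'⟩
  have := hK' 0
  simp at this
  linarith

lemma vecMul_smul_one_add_pow (X : Matrix (Fin d) (Fin d) ℂ) (μ : ℂ) (w : Fin d → ℂ) (n : ℕ) :
    w ᵥ* (μ • (1 + X)) ^ n = μ ^ n • (w ᵥ* (1 + X) ^ n) := by
  rw [smul_pow, Matrix.vecMul_smul]

/-- A generalized left eigenvector `w` for `μ ≠ 0` grows like `n ^ (m - 1) * |μ| ^ n`. -/
lemma exists_norm_vecMul_pow_le (C : Matrix (Fin d) (Fin d) ℂ) {μ : ℂ} (hμ : μ ≠ 0) (m : ℕ)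
    (w : Fin d → ℂ) (hw : w ᵥ* (C - μ • 1) ^ m = 0) :
    ∃ K : ℝ, 0 ≤ K ∧ ∀ n : ℕ, ‖w ᵥ* C ^ n‖ ≤ K * (n + 1) ^ (m - 1) * ‖μ‖ ^ n := by
  set X := μ⁻¹ • (C - μ • 1) with hX
  have hC : C = μ • (1 + X) := by
    rw [hX, smul_add, smul_smul, mul_inv_cancel₀ hμ]; simp
  obtain ⟨K, hK, hb⟩ := exists_norm_vecMul_one_add_pow_le' X m w
    (by rw [hX, smul_pow, Matrix.vecMul_smul, hw, smul_zero])
  refine ⟨K, hK, fun n => ?_⟩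
  rw [hC, vecMul_smul_one_add_pow, norm_smul, norm_pow, mul_comm]
  gcongr
  exact hb n

/-- A generalized left eigenvector for `μ` grows at most like `β ^ n` for any `β > |μ|`. -/
lemma exists_norm_vecMul_pow_le_of_lt (C : Matrix (Fin d) (Fin d) ℂ) {μ : ℂ} {β : ℝ}
    (hβ : ‖μ‖ < β) (m : ℕ) (w : Fin d → ℂ) (hw : w ᵥ* (C - μ • 1) ^ m = 0) :
    ∃ K : ℝ, 0 ≤ K ∧ ∀ n : ℕ, ‖w ᵥ* C ^ n‖ ≤ K * β ^ n := by
  have hβ0 : 0 < β := (norm_nonneg _).trans_lt hβ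
  by_cases hμ : μ = 0
  · subst hμ
    simp only [zero_smul, sub_zero] at hw
    refine ⟨∑ j ∈ Finset.range m, ‖w ᵥ* C ^ j‖ / β ^ j,
      Finset.sum_nonneg fun j _ => by positivity, fun n => ?_⟩
    by_cases hn : n < m
    · rw [← div_le_iff₀ (by positivity)]
      exact Finset.single_le_sum (f := fun j => ‖w ᵥ* C ^ j‖ / β ^ j)
        (fun j _ => by positivity) (Finset.mem_range.2 hn)
    · obtain ⟨k, rfl⟩ := Nat.exists_eq_add_of_le (not_lt.1 hn)
      rw [pow_add, ← Matrix.vecMul_vecMul, hw]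
      simp only [Matrix.zero_vecMul, norm_zero]
      exact mul_nonneg (Finset.sum_nonneg fun j _ => by positivity) (by positivity)
  · obtain ⟨K, hK, hb⟩ := exists_norm_vecMul_pow_le C hμ m w hw
    have hμ' : 0 < ‖μ‖ := norm_pos_iff.2 hμ
    obtain ⟨K', hK', hb'⟩ := exists_pow_le_mul_pow (m - 1) (r := β / ‖μ‖) ((one_lt_div hμ').2 hβ)
    refine ⟨K * K', by positivity, fun n => (hb n).trans ?_⟩
    calc K * (n + 1) ^ (m - 1) * ‖μ‖ ^ n ≤ K * (K' * (β / ‖μ‖) ^ n) * ‖μ‖ ^ n := by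
          gcongr; exact hb' n
      _ = K * K' * β ^ n := by
          rw [div_pow]; field_simp

/-- On the generalized left eigenvectors for `μ ≠ 0` the matrix `C` has an inverse `D` that is a
polynomial in `C`, and whose powers are `O(β ^ (-n))` for any `β < |μ|`. -/
lemma exists_inverse_on_genEigenspace (C : Matrix (Fin d) (Fin d) ℂ) {μ : ℂ} (hμ : μ ≠ 0) (m : ℕ) :
    ∃ D : Matrix (Fin d) (Fin d) ℂ, Commute D C ∧
      (∀ w : Fin d → ℂ, w ᵥ* (C - μ • 1) ^ m = 0 → w ᵥ* (D * C) = w) ∧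
      ∀ w : Fin d → ℂ, w ᵥ* (C - μ • 1) ^ m = 0 → ∀ β : ℝ, 0 < β → β < ‖μ‖ →
        ∃ K : ℝ, 0 ≤ K ∧ ∀ n : ℕ, ‖w ᵥ* D ^ n‖ ≤ K * (β⁻¹) ^ n := by
  set N := C - μ • (1 : Matrix (Fin d) (Fin d) ℂ) with hN
  set Y : Matrix (Fin d) (Fin d) ℂ := (-μ⁻¹) • N with hY
  have hC : C = μ • (1 - Y) := by
    rw [hY, hN, smul_sub, smul_smul]; simp [hμ]
  set G := ∑ i ∈ Finset.range m, Y ^ i with hG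
  have hcG : Commute Y G := Commute.sum_right _ _ _ fun i _ => (Commute.refl Y).pow_right i
  have hYm : ∀ w : Fin d → ℂ, w ᵥ* N ^ m = 0 → w ᵥ* Y ^ m = 0 := by
    intro w hw; rw [hY, smul_pow, Matrix.vecMul_smul, hw, smul_zero]
  have hGY : G * (1 - Y) = 1 - Y ^ m := geom_sum_mul_neg Y m
  have hDC : (μ⁻¹ • G) * C = 1 - Y ^ m := by
    rw [hC, smul_mul_smul_comm, inv_mul_cancel₀ hμ, one_smul, hGY]
  have hcomm : Commute (μ⁻¹ • G) C := by
    rw [hC]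
    refine Commute.smul_left (Commute.smul_right ?_ _) _
    exact ((Commute.one_left G).sub_left hcG).symm
  refine ⟨μ⁻¹ • G, hcomm, fun w hw => ?_, fun w hw β hβ0 hβ => ?_⟩
  · rw [hDC, Matrix.vecMul_sub, hYm w hw]; simp
  · have hD : w ᵥ* (μ⁻¹ • G - μ⁻¹ • 1) ^ m = 0 := by
      rcases m with _ | m
      · simpa using hw
      · have h2 : G - 1 = Y * (G - Y ^ m) := by
          have : Y * G = G - (1 - Y ^ (m + 1)) := by
            rw [← hGY, mul_sub, mul_one, hcG.eq]; abel
          rw [mul_sub, ← pow_succ', this]; abel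
        have hc : Commute Y (G - Y ^ m) := hcG.sub_right ((Commute.refl Y).pow_right m)
        rw [← smul_sub, smul_pow, h2, hc.mul_pow, Matrix.vecMul_smul, ← Matrix.vecMul_vecMul,
          hYm w hw]
        simp
    have hβ' : ‖μ⁻¹‖ < β⁻¹ := by
      rw [norm_inv]; exact inv_strictAnti₀ hβ0 hβ
    exact exists_norm_vecMul_pow_le_of_lt _ hβ' m w hD

lemma mem_eigenvalues {C : Matrix (Fin d) (Fin d) ℂ} {μ : ℂ} :
    μ ∈ eigenvalues C ↔ μ ∈ spectrum ℂ C := by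
  simp [eigenvalues]

lemma aeval_prod_eq_zero (C : Matrix (Fin d) (Fin d) ℂ) :
    Polynomial.aeval C (∏ μ ∈ eigenvalues C,
      (Polynomial.X - Polynomial.C μ) ^ maxJordanBlock C μ) = 0 := by
  have haeval : ∀ μ, Polynomial.aeval C ((Polynomial.X - Polynomial.C μ) ^ maxJordanBlock C μ) =
      (C - μ • 1) ^ maxJordanBlock C μ := by
    intro μ
    simp [Algebra.algebraMap_eq_smul_one]
  have hgen : ∀ (μ : ℂ) (x : Fin d → ℂ),
      x ∈ Module.End.maxGenEigenspace (Matrix.toLin' C) μ →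
      (C - μ • 1) ^ maxJordanBlock C μ *ᵥ x = 0 := by
    intro μ x hx
    rw [Module.End.maxGenEigenspace_eq, Module.End.mem_genEigenspace_nat, LinearMap.mem_ker] at hx
    have : Matrix.toLin' C - μ • 1 = Matrix.toLin' (C - μ • 1) := by
      rw [map_sub, map_smul, Matrix.toLin'_one]; rfl
    rw [this, ← Matrix.toLin'_pow, Matrix.toLin'_apply] at hx
    exact hx
  set Q := ∏ μ ∈ eigenvalues C,
    (Polynomial.X - Polynomial.C μ : Polynomial ℂ) ^ maxJordanBlock C μ with hQ
  have key : ∀ x : Fin d → ℂ, Polynomial.aeval C Q *ᵥ x = 0 := by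
    intro x
    have hx : x ∈ ⨆ μ, Module.End.maxGenEigenspace (Matrix.toLin' C) μ := by
      rw [Module.End.iSup_maxGenEigenspace_eq_top]; trivial
    refine Submodule.iSup_induction _ (motive := fun x => Polynomial.aeval C Q *ᵥ x = 0) hx ?_
      (Matrix.mulVec_zero _) ?_
    · intro μ y hy
      have hy := hgen μ y hy
      by_cases hμ : μ ∈ eigenvalues C
      · rw [hQ, ← Finset.prod_erase_mul _ _ hμ, map_mul, haeval, ← Matrix.mulVec_mulVec, hy,
          Matrix.mulVec_zero]
      · rw [mem_eigenvalues, spectrum.notMem_iff, Algebra.algebraMap_eq_smul_one,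
          ← IsUnit.neg_iff, neg_sub] at hμ
        have hu := (hμ.pow (maxJordanBlock C μ))
        have : y = 0 := by
          rw [← Matrix.mulVec_injective_iff_isUnit] at hu
          exact hu (by rw [hy, Matrix.mulVec_zero])
        rw [this, Matrix.mulVec_zero]
    · intro x y hx hy
      rw [Matrix.mulVec_add, hx, hy, add_zero]
  ext i j
  have := congrFun (key (Pi.single j 1)) i
  simpa using this

/-- The identity is a sum, over the eigenvalues `μ`, of matrices that are annihilated by the powers
of `C - μ` given by the largest Jordan blocks. This is Bézout's identity for the coprime
polynomials `∏_{ν ≠ μ} (X - ν) ^ m(ν)`. -/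
lemma exists_decomposition (C : Matrix (Fin d) (Fin d) ℂ) :
    ∃ P : ℂ → Matrix (Fin d) (Fin d) ℂ, ∑ μ ∈ eigenvalues C, P μ = 1 ∧
      ∀ μ ∈ eigenvalues C, P μ * (C - μ • 1) ^ maxJordanBlock C μ = 0 := by
  classical
  have hkill := aeval_prod_eq_zero C
  have haeval : ∀ μ, Polynomial.aeval C ((Polynomial.X - Polynomial.C μ) ^ maxJordanBlock C μ) =
      (C - μ • 1) ^ maxJordanBlock C μ := by
    intro μ
    simp [Algebra.algebraMap_eq_smul_one]
  by_cases hne : (eigenvalues C).Nonempty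
  · have hcop : Pairwise (Function.onFun IsCoprime fun a : eigenvalues C =>
        (Polynomial.X - Polynomial.C (a : ℂ) : Polynomial ℂ) ^ maxJordanBlock C a) := by
      intro a b hab
      exact IsCoprime.pow (Polynomial.isCoprime_X_sub_C_of_isUnit_sub
        (isUnit_iff_ne_zero.2 (sub_ne_zero.2 fun h => hab (Subtype.ext h))))
    obtain ⟨a, ha⟩ := (exists_sum_eq_one_iff_pairwise_coprime
      (s := fun μ => (Polynomial.X - Polynomial.C μ : Polynomial ℂ) ^ maxJordanBlock C μ) hne).2 hcop
    refine ⟨fun μ => Polynomial.aeval C (a μ * ∏ j ∈ eigenvalues C \ {μ},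
      (Polynomial.X - Polynomial.C j) ^ maxJordanBlock C j), ?_, ?_⟩
    · rw [← map_sum, ha, map_one]
    · intro μ hμ
      rw [← haeval, ← map_mul, mul_assoc, Finset.sdiff_singleton_eq_erase,
        Finset.prod_erase_mul _ _ hμ, map_mul, hkill, mul_zero]
  · rw [Finset.not_nonempty_iff_eq_empty] at hne
    rw [hne, Finset.prod_empty, map_one] at hkill
    exact ⟨0, by simp [hne, hkill], by simp [hne]⟩

end QRegular

namespace QRegular

/-! ### Growth of the sequence and of its partial sums -/

section Growth

variable {q d : ℕ}

/-- All norms on `ℂ ^ d` are equivalent, so the bound on the matrix products holds for the supremum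
norm as well. -/
lemma ProductsBounded.exists_sup_norm_bound {nrm : Seminorm ℂ (Fin d → ℂ)}
    (hnrm : ∀ y, nrm y = 0 → y = 0) {A : Fin q → Matrix (Fin d) (Fin d) ℂ} {R : ℝ} (hR : 0 < R)
    (hAR : ProductsBounded nrm A R) :
    ∃ c : ℝ, 0 ≤ c ∧ ∀ (w : List (Fin q)) (y : Fin d → ℂ),
      ‖(w.map A).prod *ᵥ y‖ ≤ c * R ^ w.length * ‖y‖ := by
  obtain ⟨c, hc⟩ := hAR
  set b := ∑ i : Fin d, nrm (Pi.single i 1) with hb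
  have hb0 : 0 ≤ b := Finset.sum_nonneg fun i _ => apply_nonneg _ _
  have hup : ∀ y, nrm y ≤ b * ‖y‖ := by
    intro y
    have hy : y = ∑ i, y i • (Pi.single i 1 : Fin d → ℂ) := by
      ext j; simp [Finset.sum_apply, Pi.single_apply]
    calc nrm y = nrm (∑ i, y i • (Pi.single i 1 : Fin d → ℂ)) := by rw [← hy]
      _ ≤ ∑ i, nrm (y i • (Pi.single i 1 : Fin d → ℂ)) :=
          Finset.le_sum_of_subadditive _ (map_zero nrm).le (map_add_le_add _) _ _
      _ ≤ ∑ i, nrm (Pi.single i 1) * ‖y‖ := by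
          refine Finset.sum_le_sum fun i _ => ?_
          rw [map_smul_eq_mul, mul_comm]
          exact mul_le_mul_of_nonneg_left (norm_le_pi_norm y i) (apply_nonneg _ _)
      _ = b * ‖y‖ := by rw [hb, Finset.sum_mul]
  have hcont : Continuous nrm := by
    have : LipschitzWith ⟨b, hb0⟩ nrm := by
      refine LipschitzWith.of_dist_le_mul fun x y => ?_
      rw [Real.dist_eq, dist_eq_norm]
      refine (abs_sub_map_le_sub nrm x y).trans (hup _)
    exact this.continuous
  obtain ⟨a, ha, hlow⟩ : ∃ a : ℝ, 0 < a ∧ ∀ y, a * ‖y‖ ≤ nrm y := by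
    rcases (Metric.sphere (0 : Fin d → ℂ) 1).eq_empty_or_nonempty with he | hne
    · refine ⟨1, one_pos, fun y => ?_⟩
      by_cases hy : y = 0
      · simp [hy]
      · exfalso
        have : ((‖y‖⁻¹ : ℝ) : ℂ) • y ∈ Metric.sphere (0 : Fin d → ℂ) 1 := by
          simp [norm_smul, hy]
        rw [he] at this; exact this
    · obtain ⟨y₀, hy₀, hmin⟩ := (isCompact_sphere (0 : Fin d → ℂ) 1).exists_isMinOn hne
        hcont.continuousOn
      have hy₀' : y₀ ≠ 0 := by
        rintro rfl; simp at hy₀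
      refine ⟨nrm y₀, (apply_nonneg nrm y₀).lt_of_ne fun h => hy₀' (hnrm _ h.symm), fun y => ?_⟩
      by_cases hy : y = 0
      · simp [hy]
      · have hm : ((‖y‖⁻¹ : ℝ) : ℂ) • y ∈ Metric.sphere (0 : Fin d → ℂ) 1 := by
          simp [norm_smul, hy]
        have := hmin hm
        simp only [Set.mem_ofPred_eq, map_smul_eq_mul, Complex.norm_real, norm_inv, norm_norm] at this
        rw [← div_eq_inv_mul, le_div_iff₀ (norm_pos_iff.2 hy)] at this
        exact this
  refine ⟨a⁻¹ * (|c| * b), by positivity, fun w y => ?_⟩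
  have h1 := (hlow _).trans ((hc w y).trans (mul_le_mul
    (mul_le_mul_of_nonneg_right (le_abs_self c) (by positivity)) (hup y) (apply_nonneg _ _)
    (by positivity)))
  rw [← le_div_iff₀' ha] at h1
  refine h1.trans (le_of_eq ?_)
  field_simp

/-- The properties of the sequence `v` on which the analysis of its summatory function rests: the
sum over a block of length `q` is given by `C`, and terms with at most `L` digits are
`O(R ^ L)`. -/
structure BlockRegular (q : ℕ) (C : Matrix (Fin d) (Fin d) ℂ) (v : ℕ → Fin d → ℂ) (c R : ℝ) :
    Prop where
  two_le : 2 ≤ q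
  one_le : 1 ≤ R
  block_sum : ∀ n, ∑ r ∈ Finset.range q, v (q * n + r) = C *ᵥ v n
  growth : ∀ L n : ℕ, n < q ^ L → ‖v n‖ ≤ c * R ^ L

/-- The base `q` digits of `n`, padded with zeros to length `L`, express `v n` by `v 0`. -/
lemma exists_growth_bound (hq : 2 ≤ q) {A : Fin q → Matrix (Fin d) (Fin d) ℂ} {v : ℕ → Fin d → ℂ}
    (hrec : ∀ (n : ℕ) (r : Fin q), v (q * n + r) = A r *ᵥ v n) {R c : ℝ}
    (hc : ∀ (w : List (Fin q)) (y : Fin d → ℂ),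
      ‖(w.map A).prod *ᵥ y‖ ≤ c * R ^ w.length * ‖y‖) :
    ∀ L n : ℕ, n < q ^ L → ‖v n‖ ≤ c * ‖v 0‖ * R ^ L := by
  have h : ∀ L n : ℕ, n < q ^ L → ∃ w : List (Fin q), w.length = L ∧
      v n = (w.map A).prod *ᵥ v 0 := by
    intro L
    induction L with
    | zero => intro n hn; exact ⟨[], rfl, by simp [show n = 0 by simpa using hn]⟩
    | succ L ih =>
      intro n hn
      obtain ⟨w, hw, hv⟩ := ih (n / q) (by
        rw [Nat.div_lt_iff_lt_mul (by omega), ← pow_succ]; exact hn)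
      have hr : n % q < q := Nat.mod_lt _ (by omega)
      refine ⟨⟨n % q, hr⟩ :: w, by simp [hw], ?_⟩
      have := hrec (n / q) ⟨n % q, hr⟩
      simp only [Nat.div_add_mod] at this
      rw [this, hv, Matrix.mulVec_mulVec, List.map_cons, List.prod_cons]
  intro L n hn
  obtain ⟨w, rfl, hv⟩ := h L n hn
  rw [hv]
  exact (hc w _).trans (le_of_eq (by ring))

lemma exists_blockRegular (hq : 2 ≤ q) {A : Fin q → Matrix (Fin d) (Fin d) ℂ} {v : ℕ → Fin d → ℂ}
    (hrec : ∀ (n : ℕ) (r : Fin q), v (q * n + r) = A r *ᵥ v n)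
    {C : Matrix (Fin d) (Fin d) ℂ} (hC : C = ∑ r, A r) {R c : ℝ} (hR1 : 1 ≤ R)
    (hc : ∀ (w : List (Fin q)) (y : Fin d → ℂ),
      ‖(w.map A).prod *ᵥ y‖ ≤ c * R ^ w.length * ‖y‖) :
    BlockRegular q C v (c * ‖v 0‖) R where
  two_le := hq
  one_le := hR1
  block_sum n := by
    rw [Finset.sum_range, hC, Matrix.sum_mulVec]
    exact Finset.sum_congr rfl fun r _ => hrec n r
  growth := exists_growth_bound hq hrec hc

/-- Leading zeros may be added to the digits of `n`, so that `v n = O(R ^ L)` for all large `L`. -/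
lemma eq_zero_of_lt_one (hq : 2 ≤ q) {A : Fin q → Matrix (Fin d) (Fin d) ℂ} {v : ℕ → Fin d → ℂ}
    (hrec : ∀ (n : ℕ) (r : Fin q), v (q * n + r) = A r *ᵥ v n) {R c : ℝ} (hR : 0 < R) (hR1 : R < 1)
    (hc : ∀ (w : List (Fin q)) (y : Fin d → ℂ),
      ‖(w.map A).prod *ᵥ y‖ ≤ c * R ^ w.length * ‖y‖) (n : ℕ) : v n = 0 := by
  have hg := exists_growth_bound hq hrec hc
  have hlim : Tendsto (fun L : ℕ => c * ‖v 0‖ * R ^ L) atTop (𝓝 0) := by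
    simpa using (tendsto_pow_atTop_nhds_zero_of_lt_one hR.le hR1).const_mul (c * ‖v 0‖)
  rw [← norm_le_zero_iff]
  refine ge_of_tendsto hlim ?_
  filter_upwards [eventually_ge_atTop n] with L hL
  exact hg L n ((Nat.lt_pow_self (by omega)).trans_le (Nat.pow_le_pow_right (by omega) hL))

/-- Eigenvalues of `C = ∑ A r` have absolute value at most `q * R`. -/
lemma norm_le_of_mem_spectrum {A : Fin q → Matrix (Fin d) (Fin d) ℂ}
    {C : Matrix (Fin d) (Fin d) ℂ} (hC : C = ∑ r, A r) {R c : ℝ} (hR : 0 < R) (hq : 2 ≤ q)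
    (hc : ∀ (w : List (Fin q)) (y : Fin d → ℂ),
      ‖(w.map A).prod *ᵥ y‖ ≤ c * R ^ w.length * ‖y‖) {μ : ℂ} (hμ : μ ∈ spectrum ℂ C) :
    ‖μ‖ ≤ q * R := by
  have hev : Module.End.HasEigenvalue (Matrix.toLin' C) μ := by
    rw [Module.End.hasEigenvalue_iff_mem_spectrum, Matrix.spectrum_toLin']; exact hμ
  obtain ⟨y, hy⟩ := hev.exists_hasEigenvector
  have hCy : C *ᵥ y = μ • y := by simpa using hy.apply_eq_smul
  have hy0 : 0 < ‖y‖ := norm_pos_iff.2 hy.2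
  -- `μ ^ n y = C ^ n y` is a sum of `q ^ n` products of the matrices `A r` applied to `y`.
  have key : ∀ (n : ℕ) (w : List (Fin q)),
      ‖(w.map A).prod *ᵥ (μ ^ n • y)‖ ≤ c * (q : ℝ) ^ n * R ^ (w.length + n) * ‖y‖ := by
    intro n
    induction n with
    | zero => intro w; simpa using hc w y
    | succ n ih =>
      intro w
      have e : (w.map A).prod *ᵥ (μ ^ (n + 1) • y) =
          ∑ r : Fin q, ((w ++ [r]).map A).prod *ᵥ (μ ^ n • y) := by
        rw [pow_succ, mul_smul, ← hCy, ← Matrix.mulVec_smul, hC, Matrix.sum_mulVec,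
          Matrix.mulVec_sum]
        refine Finset.sum_congr rfl fun r _ => ?_
        rw [Matrix.mulVec_mulVec]
        simp
      rw [e]
      refine (norm_sum_le _ _).trans ((Finset.sum_le_sum fun r _ => ih (w ++ [r])).trans
        (le_of_eq ?_))
      simp only [List.length_append, List.length_singleton, Finset.sum_const, Finset.card_univ,
        Fintype.card_fin, nsmul_eq_mul]
      rw [pow_succ (q : ℝ), show w.length + 1 + n = w.length + (n + 1) by ring]
      ring
  have hqR : 0 < (q : ℝ) * R := by positivity
  by_contra! hlt
  have hr : 1 < ‖μ‖ / (q * R) := (one_lt_div hqR).2 hlt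
  obtain ⟨n, hn⟩ := pow_unbounded_of_one_lt c hr
  have h := key n []
  simp only [List.map_nil, List.prod_nil, Matrix.one_mulVec, norm_smul, norm_pow,
    List.length_nil, zero_add] at h
  have h' := le_of_mul_le_mul_right h hy0
  rw [div_pow, lt_div_iff₀ (by positivity), mul_pow] at hn
  linarith

/-- The summatory function of a sequence of vectors. -/
noncomputable def vecSum (v : ℕ → Fin d → ℂ) (N : ℕ) : Fin d → ℂ := ∑ n ∈ Finset.range N, v n

variable {C : Matrix (Fin d) (Fin d) ℂ} {v : ℕ → Fin d → ℂ} {c R : ℝ}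

namespace BlockRegular

lemma c_nonneg (h : BlockRegular q C v c R) : 0 ≤ c := by
  have := h.growth 0 0 (by simp)
  simp only [pow_zero, mul_one] at this
  exact (norm_nonneg _).trans this

lemma vecSum_mul (h : BlockRegular q C v c R) (N : ℕ) :
    vecSum v (q * N) = C *ᵥ vecSum v N := by
  induction N with
  | zero => simp [vecSum]
  | succ N ih =>
    rw [vecSum, mul_add, mul_one, Finset.sum_range_add, ← vecSum, ih, h.block_sum, vecSum, vecSum,
      Finset.sum_range_succ, Matrix.mulVec_add]

lemma norm_vecSum_sub_le (h : BlockRegular q C v c R) {M L : ℕ} (hM : M < q ^ L) :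
    ‖vecSum v M - C *ᵥ vecSum v (M / q)‖ ≤ q * c * R ^ L := by
  have hR := h.one_le
  have hc := h.c_nonneg
  have e : vecSum v M - C *ᵥ vecSum v (M / q) =
      ∑ r ∈ Finset.range (M % q), v (q * (M / q) + r) := by
    rw [← h.vecSum_mul]
    conv_lhs => rw [← Nat.div_add_mod M q]
    rw [vecSum, Finset.sum_range_add, ← vecSum, Nat.div_add_mod, add_sub_cancel_left]
  rw [e]
  calc _ ≤ ∑ r ∈ Finset.range (M % q), c * R ^ L := by
        refine norm_sum_le_of_le _ fun r hr => h.growth _ _ ?_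
        rw [Finset.mem_range] at hr
        have := Nat.div_add_mod M q
        omega
    _ ≤ q * c * R ^ L := by
        rw [Finset.sum_const, Finset.card_range, nsmul_eq_mul, mul_assoc]
        refine mul_le_mul_of_nonneg_right ?_ (by positivity)
        exact_mod_cast (Nat.mod_lt M (by have := h.two_le; omega)).le

/-- A crude bound that is obtained by unfolding the digits of `n`. -/
lemma norm_dotProduct_vecSum_le (h : BlockRegular q C v c R) (L : ℕ) :
    ∀ (n : ℕ) (w : Fin d → ℂ), n < q ^ L → ‖w ⬝ᵥ vecSum v n‖ ≤
      d * q * c * R * ∑ j ∈ Finset.range L, ‖w ᵥ* C ^ j‖ * R ^ (L - 1 - j) := by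
  induction L with
  | zero => intro n w hn; simp [show n = 0 by simpa using hn, vecSum]
  | succ L ih =>
    intro n w hn
    have hR := h.one_le
    have hdiv : n / q < q ^ L := by
      rw [Nat.div_lt_iff_lt_mul (by have := h.two_le; omega), ← pow_succ]; exact hn
    have e : w ⬝ᵥ vecSum v n = w ⬝ᵥ (vecSum v n - C *ᵥ vecSum v (n / q)) +
        (w ᵥ* C) ⬝ᵥ vecSum v (n / q) := by
      rw [dotProduct_sub, Matrix.dotProduct_mulVec]; ring
    rw [e, Finset.sum_range_succ']
    refine (norm_add_le _ _).trans ?_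
    have h1 := (norm_dotProduct_le w (vecSum v n - C *ᵥ vecSum v (n / q))).trans
      (mul_le_mul_of_nonneg_left (h.norm_vecSum_sub_le hn) (by positivity))
    have h2 := ih (n / q) (w ᵥ* C) hdiv
    have e3 : ∑ j ∈ Finset.range L, ‖w ᵥ* C ^ (j + 1)‖ * R ^ (L + 1 - 1 - (j + 1)) =
        ∑ j ∈ Finset.range L, ‖(w ᵥ* C) ᵥ* C ^ j‖ * R ^ (L - 1 - j) := by
      refine Finset.sum_congr rfl fun j _ => ?_
      rw [Matrix.vecMul_vecMul, ← pow_succ', show L + 1 - 1 - (j + 1) = L - 1 - j by omega]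
    rw [e3, mul_add, add_comm]
    refine add_le_add h2 (h1.trans (le_of_eq ?_))
    simp only [pow_zero, Matrix.vecMul_one, Nat.add_sub_cancel, Nat.sub_zero, pow_succ]
    ring

/-- The contribution of an eigenvalue `μ` with `|μ| < R` is `O(R ^ L)`. -/
lemma exists_bound_of_norm_lt (h : BlockRegular q C v c R) {μ : ℂ} (hμ : ‖μ‖ < R) (m : ℕ)
    (w : Fin d → ℂ) (hw : w ᵥ* (C - μ • 1) ^ m = 0) :
    ∃ K : ℝ, 0 ≤ K ∧ ∀ L n : ℕ, n < q ^ L → ‖w ⬝ᵥ vecSum v n‖ ≤ K * R ^ L := by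
  have hR := h.one_le
  have hc := h.c_nonneg
  obtain ⟨β, hβ1, hβ2⟩ := exists_between hμ
  have hβ0 : 0 ≤ β := (norm_nonneg _).trans hβ1.le
  obtain ⟨K, hK, hb⟩ := exists_norm_vecMul_pow_le_of_lt C hβ1 m w hw
  set r := β / R with hr
  have hr0 : 0 ≤ r := by positivity
  have hr1 : r < 1 := (div_lt_one (by positivity)).2 hβ2
  refine ⟨d * q * c * (K * (1 - r)⁻¹), ?_, fun L n hn => ?_⟩
  · have : 0 ≤ (1 - r)⁻¹ := inv_nonneg.2 (by linarith)
    positivity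
  refine (h.norm_dotProduct_vecSum_le L n w hn).trans ?_
  have hs : ∑ j ∈ Finset.range L, ‖w ᵥ* C ^ j‖ * R ^ (L - 1 - j) ≤
      K * (R ^ L / R) * (1 - r)⁻¹ := by
    calc _ ≤ ∑ j ∈ Finset.range L, K * (R ^ L / R) * r ^ j := by
          refine Finset.sum_le_sum fun j hj => ?_
          rw [Finset.mem_range] at hj
          have e : R ^ L / R = R ^ (L - 1 - j) * R ^ j := by
            rw [← pow_add, show L - 1 - j + j = L - 1 by omega,
              div_eq_iff (by positivity), ← pow_succ, show L - 1 + 1 = L by omega]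
          rw [e, hr, div_pow]
          calc _ ≤ K * β ^ j * R ^ (L - 1 - j) := by gcongr; exact hb j
            _ = _ := by field_simp
      _ ≤ _ := by
          rw [← Finset.mul_sum]
          refine mul_le_mul_of_nonneg_left ?_ (by positivity)
          rw [← tsum_geometric_of_lt_one hr0 hr1]
          exact (summable_geometric_of_lt_one hr0 hr1).sum_le_tsum _ (fun _ _ => by positivity)
  calc _ ≤ d * q * c * R * (K * (R ^ L / R) * (1 - r)⁻¹) := by gcongr
    _ = _ := by field_simp

/-- The contribution of an eigenvalue `μ` with `|μ| = R` is `O(R ^ L * L ^ m)`. -/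
lemma exists_bound_of_norm_eq (h : BlockRegular q C v c R) {μ : ℂ} (hμ : ‖μ‖ = R) (m : ℕ)
    (w : Fin d → ℂ) (hw : w ᵥ* (C - μ • 1) ^ m = 0) :
    ∃ K : ℝ, 0 ≤ K ∧ ∀ L n : ℕ, n < q ^ L → ‖w ⬝ᵥ vecSum v n‖ ≤ K * R ^ L * L ^ m := by
  have hR := h.one_le
  have hc := h.c_nonneg
  rcases m with _ | m
  · have : w = 0 := by simpa using hw
    exact ⟨0, le_rfl, fun L n _ => by simp [this]⟩
  have hμ0 : μ ≠ 0 := by rintro rfl; simp at hμ; linarith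
  obtain ⟨K, hK, hb⟩ := exists_norm_vecMul_pow_le C hμ0 _ w hw
  rw [hμ, Nat.add_sub_cancel] at hb
  refine ⟨d * q * c * K, by positivity, fun L n hn => ?_⟩
  refine (h.norm_dotProduct_vecSum_le L n w hn).trans ?_
  have hs : ∑ j ∈ Finset.range L, ‖w ᵥ* C ^ j‖ * R ^ (L - 1 - j) ≤
      K * (R ^ L / R) * L ^ (m + 1) := by
    calc _ ≤ ∑ j ∈ Finset.range L, K * (R ^ L / R) * L ^ m := by
          refine Finset.sum_le_sum fun j hj => ?_
          rw [Finset.mem_range] at hj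
          have e : R ^ L / R = R ^ (L - 1 - j) * R ^ j := by
            rw [← pow_add, show L - 1 - j + j = L - 1 by omega,
              div_eq_iff (by positivity), ← pow_succ, show L - 1 + 1 = L by omega]
          have hj' : (j : ℝ) + 1 ≤ L := by exact_mod_cast hj
          rw [e]
          calc _ ≤ K * L ^ m * R ^ j * R ^ (L - 1 - j) := by
                refine mul_le_mul_of_nonneg_right ((hb j).trans ?_) (by positivity)
                gcongr
            _ = _ := by ring
      _ = _ := by simp [pow_succ]; ring
  calc _ ≤ d * q * c * R * (K * (R ^ L / R) * L ^ (m + 1)) := by gcongr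
    _ = _ := by field_simp

end BlockRegular

/-! ### The limits that define the fluctuations -/

/-- The limit of `ω n ⬝ᵥ ∑_{j < t q ^ n} v j` as `n → ∞`. For `ω n = w C ^ (-n)` it extends the map
`N ↦ w ⬝ᵥ ∑_{j < N} v j` from the natural numbers to `t ≥ 0`. -/
noncomputable def scaledLimit (q : ℕ) (v : ℕ → Fin d → ℂ) (ω : ℕ → Fin d → ℂ) (t : ℝ) : ℂ :=
  limUnder atTop fun n : ℕ => ω n ⬝ᵥ vecSum v ⌊t * (q : ℝ) ^ n⌋₊

/-- `ω` is a backward orbit of `C` (acting on row vectors) that is `O(β ^ (-n))`. -/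
structure BackwardOrbit (C : Matrix (Fin d) (Fin d) ℂ) (β K : ℝ) (ω : ℕ → Fin d → ℂ) : Prop where
  succ : ∀ n, ω (n + 1) ᵥ* C = ω n
  norm_le : ∀ n, ‖ω n‖ ≤ K * (β⁻¹) ^ n

namespace BlockRegular

lemma floor_mul_lt (h : BlockRegular q C v c R) {t : ℝ} (ht : 0 ≤ t) {L : ℕ}
    (htL : t < (q : ℝ) ^ L) (n : ℕ) : ⌊t * (q : ℝ) ^ n⌋₊ < q ^ (L + n) := by
  have hq : (0 : ℝ) < q := by exact_mod_cast (by have := h.two_le; omega : 0 < q)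
  rw [Nat.floor_lt (by positivity), Nat.cast_pow, pow_add]
  gcongr

lemma floor_mul_div (h : BlockRegular q C v c R) (t : ℝ) (n : ℕ) :
    ⌊t * (q : ℝ) ^ (n + 1)⌋₊ / q = ⌊t * (q : ℝ) ^ n⌋₊ := by
  have hq : (0 : ℝ) < q := by exact_mod_cast (by have := h.two_le; omega : 0 < q)
  rw [← Nat.floor_div_natCast, pow_succ, ← mul_assoc, mul_div_cancel_right₀ _ hq.ne']

variable {β K : ℝ} {ω : ℕ → Fin d → ℂ}

/-- Consecutive approximations differ by the contribution of one incomplete block. -/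
lemma dist_succ_le (h : BlockRegular q C v c R) (hβ : R < β) (hω : BackwardOrbit C β K ω)
    {t : ℝ} (ht : 0 ≤ t) {L : ℕ} (htL : t < (q : ℝ) ^ L) (n : ℕ) :
    dist (ω n ⬝ᵥ vecSum v ⌊t * (q : ℝ) ^ n⌋₊) (ω (n + 1) ⬝ᵥ vecSum v ⌊t * (q : ℝ) ^ (n + 1)⌋₊) ≤
      (d * K * β⁻¹ * q * c * R) * R ^ L * (R / β) ^ n := by
  have hR := h.one_le
  have hc := h.c_nonneg
  have hβ0 : 0 < β := by linarith
  rw [dist_comm, dist_eq_norm, ← hω.succ n, ← Matrix.dotProduct_mulVec, ← h.floor_mul_div t n,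
    ← dotProduct_sub]
  refine (norm_dotProduct_le _ _).trans ?_
  have h1 := h.norm_vecSum_sub_le (h.floor_mul_lt ht htL (n + 1))
  have h2 := hω.norm_le (n + 1)
  calc _ ≤ d * (K * β⁻¹ ^ (n + 1)) * (q * c * R ^ (L + (n + 1))) := by
        gcongr
        exact mul_nonneg (Nat.cast_nonneg _) ((norm_nonneg _).trans h2)
    _ = _ := by rw [div_eq_mul_inv, mul_pow]; ring

lemma tendsto_scaledLimit (h : BlockRegular q C v c R) (hβ : R < β) (hω : BackwardOrbit C β K ω)
    {t : ℝ} (ht : 0 ≤ t) :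
    Tendsto (fun n : ℕ => ω n ⬝ᵥ vecSum v ⌊t * (q : ℝ) ^ n⌋₊) atTop (𝓝 (scaledLimit q v ω t)) := by
  have hR := h.one_le
  obtain ⟨L, hL⟩ := pow_unbounded_of_one_lt t
    (show (1 : ℝ) < q by exact_mod_cast (by have := h.two_le; omega : 1 < q))
  exact (cauchySeq_of_le_geometric _ _ ((div_lt_one (by linarith)).2 hβ)
    (h.dist_succ_le hβ hω ht hL)).tendsto_limUnder

lemma dist_scaledLimit_le (h : BlockRegular q C v c R) (hβ : R < β) (hω : BackwardOrbit C β K ω)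
    {t : ℝ} (ht : 0 ≤ t) {L : ℕ} (htL : t < (q : ℝ) ^ L) (n : ℕ) :
    dist (ω n ⬝ᵥ vecSum v ⌊t * (q : ℝ) ^ n⌋₊) (scaledLimit q v ω t) ≤
      (d * K * β⁻¹ * q * c * R) * R ^ L * (R / β) ^ n / (1 - R / β) := by
  have hR := h.one_le
  exact dist_le_of_le_geometric_of_tendsto _ _ ((div_lt_one (by linarith)).2 hβ)
    (h.dist_succ_le hβ hω ht htL) (h.tendsto_scaledLimit hβ hω ht) n

lemma scaledLimit_natCast (h : BlockRegular q C v c R) (hβ : R < β) (hω : BackwardOrbit C β K ω)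
    (N : ℕ) : scaledLimit q v ω N = ω 0 ⬝ᵥ vecSum v N := by
  refine tendsto_nhds_unique (h.tendsto_scaledLimit hβ hω N.cast_nonneg) ?_
  have : ∀ n : ℕ, ω n ⬝ᵥ vecSum v ⌊(N : ℝ) * (q : ℝ) ^ n⌋₊ = ω 0 ⬝ᵥ vecSum v N := by
    intro n
    have e : ⌊(N : ℝ) * (q : ℝ) ^ n⌋₊ = N * q ^ n := by
      rw [← Nat.cast_pow, ← Nat.cast_mul, Nat.floor_natCast]
    rw [e]
    induction n with
    | zero => simp
    | succ n ih =>
      rw [← ih (by rw [← Nat.cast_pow, ← Nat.cast_mul, Nat.floor_natCast]), pow_succ, ← mul_assoc,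
        mul_comm _ q, h.vecSum_mul, Matrix.dotProduct_mulVec, hω.succ]
  simp only [this]
  exact tendsto_const_nhds

end BlockRegular

end Growth

end QRegular

namespace QRegular

/-! ### Functional equation and regularity of the limits -/

variable {q d : ℕ} {C : Matrix (Fin d) (Fin d) ℂ} {v : ℕ → Fin d → ℂ} {c R : ℝ}

namespace BlockRegular

variable {β K : ℝ} {ω : ℕ → Fin d → ℂ}

/-- The value at `q t` is the limit at `t` for the shifted orbit `n ↦ ω n C`. -/
lemma scaledLimit_mul (h : BlockRegular q C v c R) (hβ : R < β) (hω : BackwardOrbit C β K ω)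
    {t : ℝ} (ht : 0 ≤ t) :
    Tendsto (fun n : ℕ => (ω n ᵥ* C) ⬝ᵥ vecSum v ⌊t * (q : ℝ) ^ n⌋₊) atTop
      (𝓝 (scaledLimit q v ω (q * t))) := by
  have h1 := h.tendsto_scaledLimit hβ hω (mul_nonneg q.cast_nonneg ht)
  rw [← tendsto_add_atTop_iff_nat 1]
  refine h1.congr fun n => ?_
  rw [hω.succ, pow_succ, mul_assoc, mul_left_comm, ← mul_assoc, mul_comm ((q : ℝ) ^ n),
    ← mul_assoc, mul_comm t]

lemma norm_vecSum_sub_vecSum_le (h : BlockRegular q C v c R) {L M M' : ℕ} (hM : M < q ^ L)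
    (hM' : M' < q ^ L) (h1 : M ≤ M' + 1) (h2 : M' ≤ M + 1) :
    ‖vecSum v M - vecSum v M'‖ ≤ c * R ^ L := by
  have hR := h.one_le
  have hc := h.c_nonneg
  rcases lt_trichotomy M M' with hlt | rfl | hlt
  · obtain rfl : M' = M + 1 := by omega
    rw [vecSum, vecSum, Finset.sum_range_succ, sub_add_cancel_left, norm_neg]
    exact h.growth _ _ hM
  · rw [sub_self, norm_zero]; positivity
  · obtain rfl : M = M' + 1 := by omega
    rw [vecSum, vecSum, Finset.sum_range_succ, add_sub_cancel_left]
    exact h.growth _ _ hM'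

/-- Points at distance at most `q ^ (-n)` are compared by means of the `n`-th approximation: both
approximation errors and the difference of the approximations are `O(q ^ (-α n))`. -/
lemma exists_holder_scaledLimit (h : BlockRegular q C v c R) {α : ℝ} (hα : 0 < α)
    (hω : BackwardOrbit C (R * (q : ℝ) ^ α) K ω) (L : ℕ) :
    ∃ K' : ℝ, ∀ t t' : ℝ, 0 ≤ t → 0 ≤ t' → t < (q : ℝ) ^ L → t' < (q : ℝ) ^ L →
      ‖scaledLimit q v ω t - scaledLimit q v ω t'‖ ≤ K' * |t - t'| ^ α := by
  have hR := h.one_le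
  have hR0 : 0 < R := by linarith
  have hc := h.c_nonneg
  have hq1 : (1 : ℝ) < q := by exact_mod_cast (by have := h.two_le; omega : 1 < q)
  have hq0 : (0 : ℝ) < q := by linarith
  set β := R * (q : ℝ) ^ α with hβdef
  have hqα : 1 < (q : ℝ) ^ α := Real.one_lt_rpow hq1 hα
  have hβ : R < β := by rw [hβdef]; nlinarith
  set ρ := R / β with hρ
  have hρq : ρ = ((q : ℝ)⁻¹) ^ α := by
    rw [hρ, hβdef, Real.inv_rpow hq0.le]; field_simp
  have hρ0 : 0 < ρ := div_pos hR0 (by linarith)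
  have hρ1 : ρ < 1 := (div_lt_one (by linarith)).2 hβ
  have hK : 0 ≤ K := by
    have := hω.norm_le 0
    simp only [pow_zero, mul_one] at this
    exact (norm_nonneg _).trans this
  set T := (d * K * β⁻¹ * q * c * R) * R ^ L / (1 - ρ) with hT
  have hT0 : 0 ≤ T := by
    have : 0 < 1 - ρ := by linarith
    have : 0 < β := by linarith
    positivity
  have happrox : ∀ t : ℝ, 0 ≤ t → t < (q : ℝ) ^ L → ∀ n : ℕ,
      ‖scaledLimit q v ω t - ω n ⬝ᵥ vecSum v ⌊t * (q : ℝ) ^ n⌋₊‖ ≤ T * ρ ^ n := by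
    intro t ht htL n
    have := h.dist_scaledLimit_le hβ hω ht htL n
    rw [dist_comm, dist_eq_norm] at this
    refine this.trans (le_of_eq ?_)
    rw [hT]; ring
  set B := ∑ n ∈ Finset.range (q ^ L), ‖ω 0 ⬝ᵥ vecSum v n‖ with hB
  have hB0 : 0 ≤ B := Finset.sum_nonneg fun _ _ => norm_nonneg _
  have hbdd : ∀ t : ℝ, 0 ≤ t → t < (q : ℝ) ^ L → ‖scaledLimit q v ω t‖ ≤ T + B := by
    intro t ht htL
    have h1 := happrox t ht htL 0
    simp only [pow_zero, mul_one] at h1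
    have h2 : ‖ω 0 ⬝ᵥ vecSum v ⌊t⌋₊‖ ≤ B := by
      refine Finset.single_le_sum (f := fun n => ‖ω 0 ⬝ᵥ vecSum v n‖) (fun _ _ => norm_nonneg _) ?_
      have := h.floor_mul_lt ht htL 0
      simpa using this
    have h3 := norm_le_norm_add_norm_sub' (scaledLimit q v ω t) (ω 0 ⬝ᵥ vecSum v ⌊t⌋₊)
    linarith
  refine ⟨(2 * T + d * K * c * R ^ L) * (q : ℝ) ^ α + 2 * (T + B), fun t t' ht ht' htL htL' => ?_⟩
  have hxα : 0 ≤ |t - t'| ^ α := by positivity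
  have hco1 : 0 ≤ (2 * T + d * K * c * R ^ L) * (q : ℝ) ^ α := by positivity
  rcases le_or_gt |t - t'| 1 with hle | hgt
  · rcases (abs_nonneg (t - t')).eq_or_lt with h0 | hpos
    · rw [sub_eq_zero.1 (abs_eq_zero.1 h0.symm), sub_self, norm_zero, sub_self, abs_zero,
        Real.zero_rpow hα.ne', mul_zero]
    · obtain ⟨n, hn1, hn2⟩ := exists_nat_pow_near_of_lt_one hpos hle (inv_pos.2 hq0)
        (inv_lt_one_of_one_lt₀ hq1)
      have hclose : |t * (q : ℝ) ^ n - t' * (q : ℝ) ^ n| ≤ 1 := by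
        rw [← sub_mul, abs_mul, abs_of_pos (pow_pos hq0 n)]
        rw [inv_pow] at hn2
        calc |t - t'| * (q : ℝ) ^ n ≤ ((q : ℝ) ^ n)⁻¹ * (q : ℝ) ^ n := by gcongr
          _ = 1 := inv_mul_cancel₀ (pow_pos hq0 n).ne'
      have hfl : ∀ x y : ℝ, 0 ≤ y → x ≤ y + 1 → ⌊x⌋₊ ≤ ⌊y⌋₊ + 1 := by
        intro x y hy hxy
        rw [← Nat.floor_add_one hy]
        exact Nat.floor_mono hxy
      rw [abs_le] at hclose
      have hpow : ρ ^ n ≤ (q : ℝ) ^ α * |t - t'| ^ α := by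
        have e : ρ ^ n = (q : ℝ) ^ α * ((q : ℝ)⁻¹ ^ (n + 1)) ^ α := by
          rw [hρq, Real.rpow_pow_comm (by positivity), pow_succ,
            Real.mul_rpow (by positivity) (by positivity), Real.inv_rpow hq0.le α]
          field_simp
        rw [e]
        gcongr
      have hmid : ‖ω n ⬝ᵥ vecSum v ⌊t * (q : ℝ) ^ n⌋₊ - ω n ⬝ᵥ vecSum v ⌊t' * (q : ℝ) ^ n⌋₊‖ ≤
          d * K * c * R ^ L * ρ ^ n := by
        rw [← dotProduct_sub]
        refine (norm_dotProduct_le _ _).trans ?_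
        have h1 := h.norm_vecSum_sub_vecSum_le (h.floor_mul_lt ht htL n)
          (h.floor_mul_lt ht' htL' n)
          (hfl _ _ (by positivity) (by linarith)) (hfl _ _ (by positivity) (by linarith))
        have h2 := hω.norm_le n
        calc _ ≤ d * (K * β⁻¹ ^ n) * (c * R ^ (L + n)) := by gcongr
          _ = _ := by rw [hρ, div_eq_mul_inv, mul_pow, pow_add]; ring
      have e : scaledLimit q v ω t - scaledLimit q v ω t' =
          (scaledLimit q v ω t - ω n ⬝ᵥ vecSum v ⌊t * (q : ℝ) ^ n⌋₊) +
          (ω n ⬝ᵥ vecSum v ⌊t * (q : ℝ) ^ n⌋₊ - ω n ⬝ᵥ vecSum v ⌊t' * (q : ℝ) ^ n⌋₊) -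
          (scaledLimit q v ω t' - ω n ⬝ᵥ vecSum v ⌊t' * (q : ℝ) ^ n⌋₊) := by ring
      rw [e]
      have h1 := happrox t ht htL n
      have h2 := happrox t' ht' htL' n
      calc _ ≤ T * ρ ^ n + d * K * c * R ^ L * ρ ^ n + T * ρ ^ n :=
            (norm_sub_le _ _).trans (add_le_add ((norm_add_le _ _).trans (add_le_add h1 hmid)) h2)
        _ = (2 * T + d * K * c * R ^ L) * ρ ^ n := by ring
        _ ≤ (2 * T + d * K * c * R ^ L) * ((q : ℝ) ^ α * |t - t'| ^ α) := by gcongr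
        _ ≤ _ := by
          have : 0 ≤ 2 * (T + B) * |t - t'| ^ α := by positivity
          linarith
  · have h1 : 1 ≤ |t - t'| ^ α := Real.one_le_rpow hgt.le hα.le
    calc _ ≤ ‖scaledLimit q v ω t‖ + ‖scaledLimit q v ω t'‖ := norm_sub_le _ _
      _ ≤ 2 * (T + B) := by linarith [hbdd t ht htL, hbdd t' ht' htL']
      _ ≤ 2 * (T + B) * |t - t'| ^ α := le_mul_of_one_le_right (by positivity) h1
      _ ≤ _ := by
        rw [add_mul]
        exact le_add_of_nonneg_left (by positivity)

/-- The scaling limits attached to the Jordan chain `μ ^ (-j) w (C - μ) ^ j` of a generalized left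
eigenvector `w` for an eigenvalue `μ` with `|μ| > R`. -/
lemma exists_jordan_chain (h : BlockRegular q C v c R) {μ : ℂ} (hμ : R < ‖μ‖) (m : ℕ)
    (w : Fin d → ℂ) (hw : w ᵥ* (C - μ • 1) ^ m = 0) :
    ∃ S : ℕ → ℝ → ℂ,
      (∀ j t, 0 ≤ t → S j (q * t) = μ * (S j t + S (j + 1) t)) ∧
      (∀ t, 0 ≤ t → S m t = 0) ∧
      (∀ N : ℕ, S 0 N = w ⬝ᵥ vecSum v N) ∧
      (∃ K : ℝ, 0 ≤ K ∧ ∀ (L : ℕ) (t : ℝ), 0 ≤ t → t < (q : ℝ) ^ L →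
        ‖S 0 t - w ⬝ᵥ vecSum v ⌊t⌋₊‖ ≤ K * R ^ L) ∧
      ∀ α : ℝ, 0 < α → R * (q : ℝ) ^ α < ‖μ‖ → ∀ j L : ℕ, ∃ K' : ℝ, ∀ t t' : ℝ, 0 ≤ t → 0 ≤ t' →
        t < (q : ℝ) ^ L → t' < (q : ℝ) ^ L → ‖S j t - S j t'‖ ≤ K' * |t - t'| ^ α := by
  have hR := h.one_le
  have hμ0 : μ ≠ 0 := by rintro rfl; simp at hμ; linarith
  obtain ⟨D, hDC, hinv, hbd⟩ := exists_inverse_on_genEigenspace C hμ0 m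
  set N := C - μ • (1 : Matrix (Fin d) (Fin d) ℂ) with hN
  set u : ℕ → Fin d → ℂ := fun j => (μ⁻¹) ^ j • (w ᵥ* N ^ j) with hu
  have hu0 : u 0 = w := by simp [hu]
  have huker : ∀ j, u j ᵥ* N ^ m = 0 := by
    intro j
    rw [hu, Matrix.smul_vecMul, Matrix.vecMul_vecMul, ← pow_add, add_comm, pow_add,
      ← Matrix.vecMul_vecMul, hw]
    simp
  have hum : u m = 0 := by simp [hu, hw]
  have huC : ∀ j, u j ᵥ* C = μ • (u j + u (j + 1)) := by
    intro j
    have hC : C = μ • 1 + N := by rw [hN]; abel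
    have e1 : u j ᵥ* N = μ • u (j + 1) := by
      simp only [hu]
      rw [Matrix.smul_vecMul, Matrix.vecMul_vecMul, ← pow_succ, smul_smul, pow_succ,
        mul_comm μ, pow_succ, mul_assoc (μ⁻¹ ^ j), inv_mul_cancel₀ hμ0, mul_one]
    conv_lhs => rw [hC]
    rw [Matrix.vecMul_add, e1, Matrix.vecMul_smul, Matrix.vecMul_one, smul_add]
  set ω : ℕ → ℕ → Fin d → ℂ := fun j n => u j ᵥ* D ^ n with hω
  have hsucc : ∀ j n, ω j (n + 1) ᵥ* C = ω j n := by
    intro j n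
    have hcc : D ^ (n + 1) * C = (D * C) * D ^ n := by
      rw [pow_succ', mul_assoc, (hDC.pow_left n).eq, mul_assoc]
    simp only [hω]
    rw [Matrix.vecMul_vecMul, hcc, ← Matrix.vecMul_vecMul, hinv _ (huker j)]
  have horb : ∀ j β, 0 < β → β < ‖μ‖ → ∃ K, 0 ≤ K ∧ BackwardOrbit C β K (ω j) := by
    intro j β hβ0 hβ
    obtain ⟨K, hK, hb⟩ := hbd _ (huker j) β hβ0 hβ
    exact ⟨K, hK, hsucc j, hb⟩
  have hωC : ∀ j n, ω j n ᵥ* C = μ • (ω j n + ω (j + 1) n) := by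
    intro j n
    simp only [hω]
    rw [Matrix.vecMul_vecMul, (hDC.pow_left n).eq, ← Matrix.vecMul_vecMul, huC,
      Matrix.smul_vecMul, Matrix.add_vecMul]
  obtain ⟨β, hβ1, hβ2⟩ := exists_between hμ
  have hβ0 : 0 < β := by linarith
  refine ⟨fun j => scaledLimit q v (ω j), ?_, ?_, ?_, ?_, ?_⟩
  · intro j t ht
    obtain ⟨K, _, hK⟩ := horb j β hβ0 hβ2
    obtain ⟨K', _, hK'⟩ := horb (j + 1) β hβ0 hβ2
    refine tendsto_nhds_unique (h.scaledLimit_mul hβ1 hK ht) ?_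
    refine (((h.tendsto_scaledLimit hβ1 hK ht).add
      (h.tendsto_scaledLimit hβ1 hK' ht)).const_mul μ).congr fun n => ?_
    rw [hωC, smul_dotProduct, add_dotProduct, smul_eq_mul]
  · intro t ht
    obtain ⟨K, _, hK⟩ := horb m β hβ0 hβ2
    refine tendsto_nhds_unique (h.tendsto_scaledLimit hβ1 hK ht) ?_
    simp [hω, hum]
  · intro M
    obtain ⟨K, _, hK⟩ := horb 0 β hβ0 hβ2
    simp only [h.scaledLimit_natCast hβ1 hK]
    simp [hω, hu0]
  · obtain ⟨K, hK0, hK⟩ := horb 0 β hβ0 hβ2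
    have hc := h.c_nonneg
    have : 0 < 1 - R / β := by rw [sub_pos, div_lt_one hβ0]; exact hβ1
    refine ⟨(d * K * β⁻¹ * q * c * R) / (1 - R / β), by positivity, fun L t ht htL => ?_⟩
    have h1 := h.dist_scaledLimit_le hβ1 hK ht htL 0
    rw [dist_comm, dist_eq_norm] at h1
    have e : ω 0 0 = w := by simp [hω, hu0]
    simp only [e, pow_zero, mul_one] at h1
    refine h1.trans_eq ?_
    ring
  · intro α hα hαμ j L
    have : 0 < R * (q : ℝ) ^ α := mul_pos (by linarith)
      (Real.rpow_pos_of_pos (by exact_mod_cast (by have := h.two_le; omega : 0 < q)) _)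
    obtain ⟨K, _, hK⟩ := horb j _ this hαμ
    exact h.exists_holder_scaledLimit hα hK L

end BlockRegular

end QRegular

namespace QRegular

/-! ### Hölder continuity of periodic functions -/

/-- Hölder continuity with exponent `α` on the interval `[0, 2]`, which determines a `1`-periodic
function together with its local behaviour at every point. -/
def HolderOnTwoPeriods (α : ℝ) (f : ℝ → ℂ) : Prop :=
  ∃ K : ℝ, 0 ≤ K ∧ ∀ y ∈ Set.Icc (0 : ℝ) 2, ∀ y' ∈ Set.Icc (0 : ℝ) 2,
    ‖f y - f y'‖ ≤ K * |y - y'| ^ α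

namespace HolderOnTwoPeriods

variable {α : ℝ} {f g : ℝ → ℂ}

lemma exists_bound (hα : 0 < α) (hf : HolderOnTwoPeriods α f) :
    ∃ M : ℝ, 0 ≤ M ∧ ∀ y ∈ Set.Icc (0 : ℝ) 2, ‖f y‖ ≤ M := by
  obtain ⟨K, hK, h⟩ := hf
  refine ⟨K * 2 ^ α + ‖f 0‖, by positivity, fun y hy => ?_⟩
  have h1 := h y hy 0 ⟨le_rfl, by norm_num⟩
  have h2 : |y - 0| ^ α ≤ 2 ^ α := by
    refine Real.rpow_le_rpow (abs_nonneg _) ?_ hα.le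
    rw [sub_zero, abs_of_nonneg hy.1]; exact hy.2
  have h3 := norm_le_norm_sub_add (f y) (f 0)
  nlinarith [mul_le_mul_of_nonneg_left h2 hK]

lemma mul (hα : 0 < α) (hf : HolderOnTwoPeriods α f) (hg : HolderOnTwoPeriods α g) :
    HolderOnTwoPeriods α (fun y => f y * g y) := by
  obtain ⟨M, hM, hfM⟩ := hf.exists_bound hα
  obtain ⟨M', hM', hgM⟩ := hg.exists_bound hα
  obtain ⟨K, hK, h⟩ := hf
  obtain ⟨K', hK', h'⟩ := hg
  refine ⟨K * M' + M * K', by positivity, fun y hy y' hy' => ?_⟩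
  have e : f y * g y - f y' * g y' = (f y - f y') * g y + f y' * (g y - g y') := by ring
  rw [e]
  refine (norm_add_le _ _).trans ?_
  rw [norm_mul, norm_mul, add_mul]
  refine add_le_add ?_ ?_
  · calc _ ≤ (K * |y - y'| ^ α) * M' :=
        mul_le_mul (h y hy y' hy') (hgM y hy) (norm_nonneg _) (by positivity)
      _ = _ := by ring
  · calc _ ≤ M * (K' * |y - y'| ^ α) :=
        mul_le_mul (hfM y' hy') (h' y hy y' hy') (norm_nonneg _) hM
      _ = _ := by ring

lemma sum {ι : Type*} {s : Finset ι} {F : ι → ℝ → ℂ} (h : ∀ i ∈ s, HolderOnTwoPeriods α (F i)) :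
    HolderOnTwoPeriods α (fun y => ∑ i ∈ s, F i y) := by
  classical
  induction s using Finset.induction_on with
  | empty => exact ⟨0, le_rfl, by simp⟩
  | insert a s ha ih =>
    obtain ⟨K, hK, h1⟩ := ih fun i hi => h i (Finset.mem_insert_of_mem hi)
    obtain ⟨K', hK', h2⟩ := h a (Finset.mem_insert_self _ _)
    refine ⟨K' + K, by positivity, fun y hy y' hy' => ?_⟩
    simp only [Finset.sum_insert ha]
    rw [add_sub_add_comm, add_mul]
    exact (norm_add_le _ _).trans (add_le_add (h2 y hy y' hy') (h1 y hy y' hy'))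

lemma exists_lipschitz {E : Type*} [NormedAddCommGroup E] [NormedSpace ℝ E] {f : ℝ → E}
    (hf : ContDiff ℝ 1 f) : ∃ K : ℝ, 0 ≤ K ∧ ∀ y ∈ Set.Icc (0 : ℝ) 2, ∀ y' ∈ Set.Icc (0 : ℝ) 2,
    ‖f y - f y'‖ ≤ K * |y - y'| := by
  obtain ⟨K, hK⟩ := hf.contDiffOn.exists_lipschitzOnWith one_ne_zero (convex_Icc (0 : ℝ) 2)
    isCompact_Icc
  refine ⟨K, K.2, fun y hy y' hy' => ?_⟩
  have := hK.dist_le_mul y hy y' hy'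
  rwa [dist_eq_norm, Real.dist_eq] at this

lemma abs_le_two_mul_rpow (hα1 : α ≤ 1) (hα : 0 < α) {y y' : ℝ} (hy : y ∈ Set.Icc (0 : ℝ) 2)
    (hy' : y' ∈ Set.Icc (0 : ℝ) 2) : |y - y'| ≤ 2 * |y - y'| ^ α := by
  have h2 : |y - y'| ≤ 2 := by
    rw [abs_le]; constructor <;> linarith [hy.1, hy.2, hy'.1, hy'.2]
  rcases le_or_gt |y - y'| 1 with h | h
  · have := Real.rpow_le_rpow_of_exponent_ge' (abs_nonneg (y - y')) h hα.le hα1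
    rw [Real.rpow_one] at this
    have h0 : 0 ≤ |y - y'| ^ α := by positivity
    linarith
  · have := Real.one_le_rpow h.le hα.le
    linarith

lemma of_contDiff (hα : 0 < α) (hα1 : α ≤ 1) (hf : ContDiff ℝ 1 f) : HolderOnTwoPeriods α f := by
  obtain ⟨K, hK, h⟩ := exists_lipschitz hf
  refine ⟨K * 2, by positivity, fun y hy y' hy' => (h y hy y' hy').trans ?_⟩
  rw [mul_assoc]
  exact mul_le_mul_of_nonneg_left (abs_le_two_mul_rpow hα1 hα hy hy') hK

/-- Any two points can be moved by integers, without increasing their distance, into `[0, 2]`. -/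
lemma holderWith {α : ℝ≥0} (hf : HolderOnTwoPeriods α f) (hper : Function.Periodic f 1) :
    ∃ K : ℝ≥0, HolderWith K α f := by
  obtain ⟨K, hK, h⟩ := hf
  have main : ∀ y y' : ℝ, y ≤ y' → ‖f y - f y'‖ ≤ K * |y - y'| ^ (α : ℝ) := by
    intro y y' hyy
    set a := Int.fract y with ha
    set b := a + Int.fract (y' - y) with hb
    have hfa : f a = f y := by
      have := hper.sub_int_mul_eq (x := y) ⌊y⌋
      rwa [mul_one] at this
    have hfb : f b = f y' := by
      have := hper.sub_int_mul_eq (x := y') (⌊y⌋ + ⌊y' - y⌋)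
      rw [mul_one] at this
      rw [← this]
      congr 1
      rw [hb, ha, Int.fract, Int.fract]; push_cast; ring
    have ha0 := Int.fract_nonneg y
    have ha1 := Int.fract_lt_one y
    have hb0 := Int.fract_nonneg (y' - y)
    have hb1 := Int.fract_lt_one (y' - y)
    have hle : Int.fract (y' - y) ≤ y' - y := by
      have : (0 : ℝ) ≤ ⌊y' - y⌋ := by exact_mod_cast Int.floor_nonneg.2 (sub_nonneg.2 hyy)
      rw [Int.fract]; linarith
    have := h a ⟨ha0, by linarith⟩ b ⟨by positivity, by linarith⟩
    rw [hfa, hfb] at this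
    refine this.trans (mul_le_mul_of_nonneg_left ?_ hK)
    refine Real.rpow_le_rpow (abs_nonneg _) ?_ α.2
    rw [hb, sub_add_cancel_left, abs_neg, abs_of_nonneg hb0, abs_sub_comm, abs_of_nonneg
      (sub_nonneg.2 hyy)]
    exact hle
  have main' : ∀ y y' : ℝ, ‖f y - f y'‖ ≤ K * |y - y'| ^ (α : ℝ) := by
    intro y y'
    rcases le_total y y' with hyy | hyy
    · exact main y y' hyy
    · rw [norm_sub_rev, abs_sub_comm]; exact main y' y hyy
  refine ⟨K.toNNReal, fun y y' => ?_⟩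
  rw [edist_dist, edist_dist, ENNReal.ofReal_rpow_of_nonneg dist_nonneg α.coe_nonneg, dist_eq_norm,
    Real.dist_eq]
  refine (ENNReal.ofReal_le_ofReal (main' y y')).trans ?_
  rw [ENNReal.ofReal_mul hK]
  exact le_rfl

end HolderOnTwoPeriods

/-! ### Fluctuations from Jordan chains -/

open Polynomial in
/-- The binomial coefficient `binom(X, j)` as a polynomial. -/
noncomputable def binomPoly : ℕ → ℂ[X]
  | 0 => 1
  | j + 1 => Polynomial.C ((j : ℂ) + 1)⁻¹ * ((X - Polynomial.C (j : ℂ)) * binomPoly j)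

lemma binomPoly_succ_eval (j : ℕ) (z : ℂ) :
    ((j : ℂ) + 1) * (binomPoly (j + 1)).eval z = (z - j) * (binomPoly j).eval z := by
  have : (j : ℂ) + 1 ≠ 0 := Nat.cast_add_one_ne_zero j
  rw [binomPoly]; simp; field_simp

lemma binomPoly_eval_add_one (j : ℕ) (z : ℂ) :
    (binomPoly (j + 1)).eval (z + 1) = (binomPoly (j + 1)).eval z + (binomPoly j).eval z := by
  induction j with
  | zero => simp [binomPoly]
  | succ j ih =>
    have h1 : ((j : ℂ) + 1 + 1) ≠ 0 := by exact_mod_cast Nat.succ_ne_zero (j + 1)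
    have e1 := binomPoly_succ_eval (j + 1) (z + 1)
    have e2 := binomPoly_succ_eval (j + 1) z
    have e3 := binomPoly_succ_eval j z
    push_cast at e1 e2
    refine mul_left_cancel₀ h1 ?_
    rw [e1, mul_add, e2, ih]
    linear_combination (-1 : ℂ) * e3

lemma binomPoly_natDegree_le (j : ℕ) : (binomPoly j).natDegree ≤ j := by
  induction j with
  | zero => simp [binomPoly]
  | succ j ih =>
    rw [binomPoly]
    refine (Polynomial.natDegree_C_mul_le _ _).trans ?_
    refine Polynomial.natDegree_mul_le.trans ?_
    rw [Polynomial.natDegree_X_sub_C]; omega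

lemma binomPoly_succ_eval_zero (j : ℕ) : (binomPoly (j + 1)).eval 0 = 0 := by
  induction j with
  | zero => simp [binomPoly]
  | succ j ih => rw [binomPoly]; simp [ih]

lemma sum_binomPoly_pascal (S : ℕ → ℂ) (z : ℂ) (m : ℕ) :
    ∑ j ∈ Finset.range (m + 1), (S j + S (j + 1)) * (binomPoly j).eval z =
      ∑ j ∈ Finset.range (m + 1), S j * (binomPoly j).eval (z + 1) +
        S (m + 1) * (binomPoly m).eval z := by
  induction m with
  | zero => simp [binomPoly]
  | succ m ih =>
    rw [Finset.sum_range_succ, ih, Finset.sum_range_succ _ (m + 1), binomPoly_eval_add_one]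
    ring

/-- The polynomial `μ ^ (-y) ∑_{j < m} S j (q ^ y) binom(X - y, j)`. By Pascal's rule it is
`1`-periodic in `y` when `S` is a Jordan chain for `μ` under `t ↦ q t`. -/
noncomputable def fluctuationPoly (q : ℕ) (μ : ℂ) (S : ℕ → ℝ → ℂ) (m : ℕ) (y : ℝ) :
    Polynomial ℂ :=
  ∑ j ∈ Finset.range m, Polynomial.C (Complex.exp (-(y * Complex.log μ)) * S j ((q : ℝ) ^ y)) *
    Polynomial.taylor (-(y : ℂ)) (binomPoly j)

section Fluctuation

variable {q : ℕ} {μ : ℂ} {S : ℕ → ℝ → ℂ} {m : ℕ}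

lemma fluctuationPoly_eval (y : ℝ) (u : ℂ) : (fluctuationPoly q μ S m y).eval u =
    Complex.exp (-(y * Complex.log μ)) *
      ∑ j ∈ Finset.range m, S j ((q : ℝ) ^ y) * (binomPoly j).eval (u - y) := by
  simp only [fluctuationPoly, Polynomial.eval_finsetSum, Polynomial.eval_mul, Polynomial.eval_C,
    Polynomial.taylor_eval, Finset.mul_sum, sub_eq_add_neg, mul_assoc]

lemma fluctuationPoly_add_one (hq : 2 ≤ q) (hμ : μ ≠ 0)
    (hS : ∀ j t, 0 ≤ t → S j (q * t) = μ * (S j t + S (j + 1) t)) (hm : ∀ t, 0 ≤ t → S m t = 0)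
    (y : ℝ) : fluctuationPoly q μ S m (y + 1) = fluctuationPoly q μ S m y := by
  have hq0 : (0 : ℝ) < q := by positivity
  refine Polynomial.funext fun u => ?_
  rw [fluctuationPoly_eval, fluctuationPoly_eval]
  rcases m with _ | m
  · simp
  have e1 : Complex.exp (-(((y + 1 : ℝ) : ℂ) * Complex.log μ)) =
      Complex.exp (-(y * Complex.log μ)) * μ⁻¹ := by
    rw [← Complex.exp_log (inv_ne_zero hμ), ← Complex.exp_add]
    rw [show -(((y + 1 : ℝ) : ℂ) * Complex.log μ) = -(y * Complex.log μ) + -Complex.log μ by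
      push_cast; ring, Complex.exp_add, Complex.exp_neg (Complex.log μ), Complex.exp_log hμ,
      Complex.exp_add, Complex.exp_log (inv_ne_zero hμ)]
  have e2 : ∀ j, S j ((q : ℝ) ^ (y + 1)) =
      μ * (S j ((q : ℝ) ^ y) + S (j + 1) ((q : ℝ) ^ y)) := by
    intro j
    rw [Real.rpow_add hq0, Real.rpow_one, mul_comm, hS _ _ (by positivity)]
  have e3 := sum_binomPoly_pascal (fun j => S j ((q : ℝ) ^ y)) (u - (y + 1 : ℝ)) m
  rw [hm _ (by positivity), zero_mul, add_zero,
    show u - ((y + 1 : ℝ) : ℂ) + 1 = u - y by push_cast; ring] at e3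
  rw [e1, ← e3]
  simp only [e2, Finset.mul_sum]
  refine Finset.sum_congr rfl fun j _ => ?_
  field_simp

lemma fluctuationPoly_coeff (y : ℝ) (k : ℕ) : (fluctuationPoly q μ S m y).coeff k =
    ∑ j ∈ Finset.range m, Complex.exp (-(y * Complex.log μ)) * S j ((q : ℝ) ^ y) *
      (Polynomial.hasseDeriv k (binomPoly j)).eval (-(y : ℂ)) := by
  simp only [fluctuationPoly, Polynomial.finsetSum_coeff, Polynomial.coeff_C_mul,
    Polynomial.taylor_coeff]

lemma fluctuationPoly_natDegree_lt (y : ℝ) (hm : 0 < m) :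
    (fluctuationPoly q μ S m y).natDegree < m := by
  rw [fluctuationPoly]
  refine (Polynomial.natDegree_sum_le_of_forall_le (n := m - 1) _ _ fun j hj => ?_).trans_lt
    (by omega)
  rw [Finset.mem_range] at hj
  refine (Polynomial.natDegree_C_mul_le _ _).trans ?_
  rw [Polynomial.natDegree_taylor]
  exact (binomPoly_natDegree_le j).trans (by omega)

lemma sum_pow_mul_fluctuationPoly_coeff (u : ℝ) :
    ∑ k ∈ Finset.range m, (u : ℂ) ^ k * (fluctuationPoly q μ S m u).coeff k =
      Complex.exp (-(u * Complex.log μ)) * if m = 0 then 0 else S 0 ((q : ℝ) ^ u) := by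
  rcases m with _ | m
  · simp
  have h := Polynomial.eval_eq_sum_range' (fluctuationPoly_natDegree_lt (q := q) (μ := μ) (S := S)
    u m.succ_pos) (u : ℂ)
  rw [fluctuationPoly_eval, Finset.sum_range_succ'] at h
  simp only [sub_self, binomPoly_succ_eval_zero, mul_zero, Finset.sum_const_zero, zero_add] at h
  simp only [Nat.succ_ne_zero, if_false]
  simp only [binomPoly, Polynomial.eval_one, mul_one] at h
  rw [h]
  exact Finset.sum_congr rfl fun k _ => mul_comm _ _

lemma fluctuationPoly_coeff_holder (hq : 2 ≤ q) {α : ℝ} (hα : 0 < α) (hα1 : α ≤ 1)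
    (hS : ∀ j L : ℕ, ∃ K' : ℝ, ∀ t t' : ℝ, 0 ≤ t → 0 ≤ t' →
        t < (q : ℝ) ^ L → t' < (q : ℝ) ^ L → ‖S j t - S j t'‖ ≤ K' * |t - t'| ^ α) (k : ℕ) :
    HolderOnTwoPeriods α (fun y => (fluctuationPoly q μ S m y).coeff k) := by
  have hq1 : (1 : ℝ) < q := by exact_mod_cast (by omega : 1 < q)
  have hq0 : (0 : ℝ) < q := by linarith
  simp only [fluctuationPoly_coeff]
  refine HolderOnTwoPeriods.sum fun j _ => ?_
  refine HolderOnTwoPeriods.mul hα (HolderOnTwoPeriods.mul hα ?_ ?_) ?_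
  · refine .of_contDiff hα hα1 ?_
    have : ContDiff ℝ 1 (fun y : ℝ => (y : ℂ)) := Complex.ofRealCLM.contDiff
    exact (this.mul contDiff_const).neg.cexp
  · obtain ⟨K, hK⟩ := hS j 3
    have hcd : ContDiff ℝ 1 (fun y : ℝ => (q : ℝ) ^ y) := contDiff_const.rpow contDiff_id
      fun _ => hq0.ne'
    obtain ⟨K', hK', hlip⟩ := HolderOnTwoPeriods.exists_lipschitz hcd
    refine ⟨|K| * K' ^ α, by positivity, fun y hy y' hy' => ?_⟩
    have hlt : ∀ y ∈ Set.Icc (0 : ℝ) 2, (q : ℝ) ^ y < (q : ℝ) ^ 3 := by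
      intro y hy
      rw [← Real.rpow_natCast]
      exact Real.rpow_lt_rpow_of_exponent_lt hq1 (by push_cast; linarith [hy.2])
    refine (hK _ _ (by positivity) (by positivity) (hlt y hy) (hlt y' hy')).trans ?_
    calc _ ≤ |K| * (K' * |y - y'|) ^ α := by
          refine mul_le_mul (le_abs_self K) ?_ (by positivity) (abs_nonneg _)
          exact Real.rpow_le_rpow (abs_nonneg _) (hlip y hy y' hy') hα.le
      _ = _ := by rw [Real.mul_rpow hK' (abs_nonneg _)]; ring
  · refine .of_contDiff hα hα1 ?_
    have h1 : ContDiff ℝ 1 (fun y : ℝ => -(y : ℂ)) := Complex.ofRealCLM.contDiff.neg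
    exact ((Polynomial.differentiable (𝕜 := ℂ) _).contDiff.restrict_scalars ℝ).comp h1

end Fluctuation

end QRegular

namespace QRegular

/-! ### The asymptotic expansion -/

/-- The main term `∑_μ t ^ (log_q μ) ∑_k (log_q t) ^ k Φ_{μ k} (log_q t)` at a real argument. -/
noncomputable def mainTerm {d : ℕ} (q : ℕ) (C : Matrix (Fin d) (Fin d) ℂ) (R : ℝ)
    (Φ : ℂ → ℕ → ℝ → ℂ) (t : ℝ) : ℂ :=
  ∑ μ ∈ (eigenvalues C).filter (fun μ => R < ‖μ‖),
    (t : ℂ) ^ clogb q μ *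
      ∑ k ∈ Finset.range (maxJordanBlock C μ),
        ((Real.logb q t : ℝ) : ℂ) ^ k * Φ μ k (Real.logb q t)

variable {q d : ℕ} {C : Matrix (Fin d) (Fin d) ℂ} {v : ℕ → Fin d → ℂ} {c R : ℝ}

/-- The regularity of the fluctuations for an eigenvalue `μ`. -/
structure IsFluctuation (q : ℕ) (R : ℝ) (μ : ℂ) (f : ℝ → ℂ) : Prop where
  periodic : Function.Periodic f 1
  continuous : Continuous f
  holder : ∀ α : ℝ≥0, 0 < α → (α : ℝ) < Real.logb q (‖μ‖ / R) → ∃ K : ℝ≥0, HolderWith K α f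

lemma cpow_clogb (hq : 2 ≤ q) {t : ℝ} (ht : 0 < t) (μ : ℂ) :
    (t : ℂ) ^ clogb q μ = Complex.exp ((Real.logb q t : ℝ) * Complex.log μ) := by
  have hlog : (Real.log q : ℂ) ≠ 0 := by
    exact_mod_cast (Real.log_pos (by exact_mod_cast (by omega : 1 < q))).ne'
  rw [Complex.cpow_def_of_ne_zero (by exact_mod_cast ht.ne'), clogb, ← Complex.ofReal_log ht.le,
    Real.logb]
  push_cast
  congr 1
  field_simp

namespace BlockRegular

/-- The contribution of an eigenvalue `μ` with `|μ| > R`. -/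
lemma exists_fluctuation (h : BlockRegular q C v c R) {μ : ℂ} (hμ : R < ‖μ‖) (hμq : ‖μ‖ ≤ q * R)
    (m : ℕ) (w : Fin d → ℂ) (hw : w ᵥ* (C - μ • 1) ^ m = 0) :
    ∃ Φ : ℕ → ℝ → ℂ, (∀ k, IsFluctuation q R μ (Φ k)) ∧
      (∀ N : ℕ, 1 ≤ N → w ⬝ᵥ vecSum v N = ((N : ℝ) : ℂ) ^ clogb q μ *
        ∑ k ∈ Finset.range m, ((Real.logb q N : ℝ) : ℂ) ^ k * Φ k (Real.logb q N)) ∧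
      ∃ K : ℝ, 0 ≤ K ∧ ∀ (L : ℕ) (t : ℝ), 0 < t → t < (q : ℝ) ^ L →
        ‖w ⬝ᵥ vecSum v ⌊t⌋₊ - (t : ℂ) ^ clogb q μ *
          ∑ k ∈ Finset.range m, ((Real.logb q t : ℝ) : ℂ) ^ k * Φ k (Real.logb q t)‖ ≤
          K * R ^ L := by
  have hR := h.one_le
  have hR0 : 0 < R := by linarith
  have hq := h.two_le
  have hq1 : (1 : ℝ) < q := by exact_mod_cast (by omega : 1 < q)
  have hq0 : (0 : ℝ) < q := by linarith
  have hμ0 : μ ≠ 0 := by rintro rfl; simp at hμ; linarith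
  obtain ⟨S, hS, hSm, hS0, ⟨K, hK, hSK⟩, hSh⟩ := h.exists_jordan_chain hμ m w hw
  have hrep : ∀ t : ℝ, 0 < t → (t : ℂ) ^ clogb q μ * ∑ k ∈ Finset.range m,
      ((Real.logb q t : ℝ) : ℂ) ^ k * (fluctuationPoly q μ S m (Real.logb q t)).coeff k = S 0 t := by
    intro t ht
    rw [sum_pow_mul_fluctuationPoly_coeff, cpow_clogb hq ht, ← mul_assoc, ← Complex.exp_add,
      add_neg_cancel, Complex.exp_zero, one_mul, Real.rpow_logb hq0 hq1.ne' ht]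
    split_ifs with h0
    · subst h0; exact (hSm t ht.le).symm
    · rfl
  have hper : ∀ k, Function.Periodic (fun y => (fluctuationPoly q μ S m y).coeff k) 1 := by
    intro k y
    simp only [fluctuationPoly_add_one hq hμ0 hS hSm]
  -- Since `|μ| ≤ q R`, only Hölder exponents below `1` occur.
  have hlog1 : Real.logb q (‖μ‖ / R) ≤ 1 := by
    rw [Real.logb_le_iff_le_rpow hq1 (by positivity), Real.rpow_one, div_le_iff₀ hR0]
    exact hμq
  have hhol : ∀ k, ∀ α : ℝ≥0, 0 < α → (α : ℝ) < Real.logb q (‖μ‖ / R) →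
      ∃ K : ℝ≥0, HolderWith K α (fun y => (fluctuationPoly q μ S m y).coeff k) := by
    intro k α hα hαlt
    have hlt : R * (q : ℝ) ^ (α : ℝ) < ‖μ‖ := by
      rw [Real.lt_logb_iff_rpow_lt hq1 (by positivity), lt_div_iff₀ hR0] at hαlt
      linarith
    exact (fluctuationPoly_coeff_holder hq (by exact_mod_cast hα) (hαlt.le.trans hlog1)
      (hSh α (by exact_mod_cast hα) hlt) k).holderWith (hper k)
  have hlogpos : 0 < Real.logb q (‖μ‖ / R) :=
    Real.logb_pos hq1 ((one_lt_div hR0).2 hμ)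
  refine ⟨fun k y => (fluctuationPoly q μ S m y).coeff k, fun k => ⟨hper k, ?_, hhol k⟩, ?_,
    K, hK, ?_⟩
  · obtain ⟨α, hα0, hα⟩ := exists_between hlogpos
    obtain ⟨K', hK'⟩ := hhol k ⟨α, hα0.le⟩ hα0 hα
    exact hK'.continuous hα0
  · intro N hN
    rw [hrep N (by exact_mod_cast hN), hS0]
  · intro L t ht htL
    rw [hrep t ht, norm_sub_rev]
    exact hSK L t ht.le htL

/-- The asymptotic expansion at real arguments, with the error in terms of the number `L` of
digits. -/
lemma exists_expansion (h : BlockRegular q C v c R)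
    (hspec : ∀ μ ∈ eigenvalues C, ‖μ‖ ≤ q * R) (e : Fin d → ℂ) :
    ∃ Φ : ℂ → ℕ → ℝ → ℂ,
      (∀ μ ∈ eigenvalues C, R < ‖μ‖ → ∀ k, IsFluctuation q R μ (Φ μ k)) ∧
      ((∀ μ ∈ eigenvalues C, R < ‖μ‖) → ∀ N : ℕ, 1 ≤ N →
        e ⬝ᵥ vecSum v N = mainTerm q C R Φ N) ∧
      ∃ K : ℝ, 0 ≤ K ∧ ∀ (L : ℕ) (t : ℝ), 0 < t → t < (q : ℝ) ^ L →
        ‖e ⬝ᵥ vecSum v ⌊t⌋₊ - mainTerm q C R Φ t‖ ≤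
          K * R ^ L * (L + 1) ^ criticalExponent C R := by
  classical
  have hR := h.one_le
  obtain ⟨P, hP1, hP0⟩ := exists_decomposition C
  set w : ℂ → Fin d → ℂ := fun μ => e ᵥ* P μ with hwdef
  have hw : ∀ μ ∈ eigenvalues C, w μ ᵥ* (C - μ • 1) ^ maxJordanBlock C μ = 0 := by
    intro μ hμ
    rw [hwdef, Matrix.vecMul_vecMul, hP0 μ hμ, Matrix.vecMul_zero]
  have hsum : ∀ y, e ⬝ᵥ y = ∑ μ ∈ eigenvalues C, w μ ⬝ᵥ y := by
    intro y
    rw [← sum_dotProduct, hwdef, ← Matrix.vecMul_sum, hP1, Matrix.vecMul_one]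
  have hbig : ∀ μ : ℂ, ∃ Φ : ℕ → ℝ → ℂ, (μ ∈ eigenvalues C ∧ R < ‖μ‖) →
      (∀ k, IsFluctuation q R μ (Φ k)) ∧
      (∀ N : ℕ, 1 ≤ N → w μ ⬝ᵥ vecSum v N = ((N : ℝ) : ℂ) ^ clogb q μ *
        ∑ k ∈ Finset.range (maxJordanBlock C μ),
          ((Real.logb q N : ℝ) : ℂ) ^ k * Φ k (Real.logb q N)) ∧
      ∃ K : ℝ, 0 ≤ K ∧ ∀ (L : ℕ) (t : ℝ), 0 < t → t < (q : ℝ) ^ L →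
        ‖w μ ⬝ᵥ vecSum v ⌊t⌋₊ - (t : ℂ) ^ clogb q μ *
          ∑ k ∈ Finset.range (maxJordanBlock C μ),
            ((Real.logb q t : ℝ) : ℂ) ^ k * Φ k (Real.logb q t)‖ ≤ K * R ^ L := by
    intro μ
    by_cases hμ : μ ∈ eigenvalues C ∧ R < ‖μ‖
    · obtain ⟨Φ, hΦ⟩ := h.exists_fluctuation hμ.2 (hspec μ hμ.1) _ _ (hw μ hμ.1)
      exact ⟨Φ, fun _ => hΦ⟩
    · exact ⟨0, fun h => absurd h hμ⟩
  choose Φ hΦ using hbig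
  have hterm : ∀ μ ∈ eigenvalues C, ∃ K : ℝ, 0 ≤ K ∧ ∀ (L : ℕ) (t : ℝ), 0 < t → t < (q : ℝ) ^ L →
      ‖w μ ⬝ᵥ vecSum v ⌊t⌋₊ - (if R < ‖μ‖ then (t : ℂ) ^ clogb q μ *
          ∑ k ∈ Finset.range (maxJordanBlock C μ),
            ((Real.logb q t : ℝ) : ℂ) ^ k * Φ μ k (Real.logb q t) else 0)‖ ≤
        K * (R ^ L * (L + 1) ^ criticalExponent C R) := by
    intro μ hμ
    have hfloor : ∀ (L : ℕ) (t : ℝ), 0 < t → t < (q : ℝ) ^ L → ⌊t⌋₊ < q ^ L := by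
      intro L t ht htL
      simpa using h.floor_mul_lt ht.le htL 0
    have hge1 : ∀ (L n : ℕ), (1 : ℝ) ≤ ((L : ℝ) + 1) ^ n := fun L n =>
      one_le_pow₀ (by linarith [Nat.cast_nonneg (α := ℝ) L])
    rcases lt_trichotomy ‖μ‖ R with hlt | heq | hgt
    · obtain ⟨K, hK, hb⟩ := h.exists_bound_of_norm_lt hlt _ _ (hw μ hμ)
      refine ⟨K, hK, fun L t ht htL => ?_⟩
      rw [if_neg hlt.le.not_gt, sub_zero]
      refine (hb L _ (hfloor L t ht htL)).trans (mul_le_mul_of_nonneg_left ?_ hK)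
      exact le_mul_of_one_le_right (by positivity) (hge1 _ _)
    · obtain ⟨K, hK, hb⟩ := h.exists_bound_of_norm_eq heq _ _ (hw μ hμ)
      refine ⟨K, hK, fun L t ht htL => ?_⟩
      rw [if_neg heq.le.not_gt, sub_zero]
      refine (hb L _ (hfloor L t ht htL)).trans ?_
      rw [mul_assoc]
      have hm : maxJordanBlock C μ ≤ criticalExponent C R :=
        Finset.le_sup (f := maxJordanBlock C) (Finset.mem_filter.2 ⟨hμ, heq⟩)
      have h1 : (L : ℝ) ^ maxJordanBlock C μ ≤ ((L : ℝ) + 1) ^ criticalExponent C R :=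
        (pow_le_pow_left₀ (Nat.cast_nonneg _) (by linarith) _).trans
          (pow_le_pow_right₀ (by linarith [Nat.cast_nonneg (α := ℝ) L]) hm)
      gcongr
    · obtain ⟨-, -, K, hK, hb⟩ := hΦ μ ⟨hμ, hgt⟩
      refine ⟨K, hK, fun L t ht htL => ?_⟩
      rw [if_pos hgt]
      refine (hb L t ht htL).trans (mul_le_mul_of_nonneg_left ?_ hK)
      exact le_mul_of_one_le_right (by positivity) (hge1 _ _)
  refine ⟨Φ, fun μ hμ hμR => (hΦ μ ⟨hμ, hμR⟩).1, fun hall N hN => ?_, ?_⟩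
  · rw [hsum, mainTerm, Finset.filter_true_of_mem hall]
    exact Finset.sum_congr rfl fun μ hμ => (hΦ μ ⟨hμ, hall μ hμ⟩).2.1 N hN
  · choose! K hK hb using hterm
    refine ⟨∑ μ ∈ eigenvalues C, K μ, Finset.sum_nonneg hK, fun L t ht htL => ?_⟩
    rw [hsum, mainTerm, Finset.sum_filter, ← Finset.sum_sub_distrib, mul_assoc, Finset.sum_mul]
    exact norm_sum_le_of_le _ fun μ hμ => hb μ hμ L t ht htL

end BlockRegular

/-- Converts a bound in terms of the number of digits into one in terms of the argument. -/
lemma isBigO_of_digits_bound (hq : 2 ≤ q) (hR : 1 ≤ R) {f : ℝ → ℂ} {K : ℝ} (hK : 0 ≤ K) {m : ℕ}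
    (hf : ∀ (L : ℕ) (t : ℝ), 0 < t → t < (q : ℝ) ^ L → ‖f t‖ ≤ K * R ^ L * (L + 1) ^ m) :
    f =O[atTop] fun t : ℝ => t ^ Real.logb q R * Real.log t ^ m := by
  have hq1 : (1 : ℝ) < q := by exact_mod_cast (by omega : 1 < q)
  have hq0 : (0 : ℝ) < q := by linarith
  have hlogq : 0 < Real.log q := Real.log_pos hq1
  refine IsBigO.of_bound (K * R * ((Real.log q)⁻¹ + 2) ^ m) ?_
  filter_upwards [eventually_ge_atTop (Real.exp 1)] with t ht
  have ht1 : 1 < t := lt_of_lt_of_le (by simp) ht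
  have ht0 : 0 < t := by linarith
  have hlogt : 1 ≤ Real.log t := by rw [Real.le_log_iff_exp_le ht0]; exact ht
  have hlogb : 0 ≤ Real.logb q t := Real.logb_nonneg hq1 ht1.le
  set n := ⌊Real.logb q t⌋₊ with hn
  have hn1 : (n : ℝ) ≤ Real.logb q t := Nat.floor_le hlogb
  have hn2 : t < (q : ℝ) ^ (n + 1) := by
    rw [← Real.rpow_natCast, ← Real.logb_lt_iff_lt_rpow hq1 ht0]
    push_cast; exact Nat.lt_floor_add_one _
  refine (hf (n + 1) t ht0 hn2).trans ?_
  have e1 : R ^ n ≤ t ^ Real.logb q R := by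
    calc R ^ n = R ^ (n : ℝ) := (Real.rpow_natCast _ _).symm
      _ ≤ R ^ Real.logb q t := Real.rpow_le_rpow_of_exponent_le hR hn1
      _ = t ^ Real.logb q R := by
        rw [Real.rpow_def_of_pos (by linarith), Real.rpow_def_of_pos ht0, Real.logb, Real.logb]
        congr 1; ring
  have e2 : ((n + 1 : ℕ) : ℝ) + 1 ≤ ((Real.log q)⁻¹ + 2) * Real.log t := by
    have : Real.logb q t = (Real.log q)⁻¹ * Real.log t := by rw [Real.logb]; ring
    push_cast; nlinarith
  have e3 : 0 ≤ t ^ Real.logb q R := by positivity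
  rw [Real.norm_of_nonneg (by positivity)]
  calc _ ≤ K * (R ^ n * R) * (((Real.log q)⁻¹ + 2) * Real.log t) ^ m := by
        rw [pow_succ R]
        gcongr
    _ ≤ K * (t ^ Real.logb q R * R) * (((Real.log q)⁻¹ + 2) * Real.log t) ^ m := by gcongr
    _ = _ := by rw [mul_pow]; ring

end QRegular

namespace QRegular

/-! ### Pointwise convergence of Fourier series -/

open MeasureTheory in
/-- The Riemann–Lebesgue lemma along a sequence of Fourier coefficients. For non-integrable `g` all
integrals are `0` by convention. -/
lemma tendsto_fourier_integral {g : ℝ → ℂ} (φ : ℕ → ℤ)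
    (hφ : Tendsto (fun n => ((φ n : ℤ) : ℝ)) atTop (cocompact ℝ)) :
    Tendsto (fun n => ∫ t in (0 : ℝ)..1, g t * Complex.exp (-(2 * (φ n : ℤ) * Real.pi * Complex.I * t)))
      atTop (𝓝 0) := by
  have h := (Real.tendsto_integral_exp_smul_cocompact
    ((Set.Ioc (0 : ℝ) 1).indicator g)).comp hφ
  refine h.congr fun n => ?_
  rw [intervalIntegral.integral_of_le zero_le_one, ← integral_indicator measurableSet_Ioc]
  refine integral_congr_ae (Eventually.of_forall fun t => ?_)
  by_cases ht : t ∈ Set.Ioc (0 : ℝ) 1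
  · simp only [Set.indicator_of_mem ht]
    rw [Circle.smul_def, Real.fourierChar_apply, smul_eq_mul, mul_comm]
    congr 2
    push_cast; ring
  · simp only [Set.indicator_of_notMem ht, smul_zero]

lemma sum_Icc_int_telescope (c : ℤ → ℂ) (a : ℤ) (n : ℕ) :
    ∑ l ∈ Finset.Icc a (a + n), (c (l - 1) - c l) = c (a - 1) - c (a + n) := by
  induction n with
  | zero => simp
  | succ n ih =>
    have : Finset.Icc a (a + (n + 1 : ℕ)) = insert (a + (n + 1 : ℕ)) (Finset.Icc a (a + n)) := by
      ext x; simp only [Finset.mem_Icc, Finset.mem_insert]; push_cast; omega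
    rw [this, Finset.sum_insert (by simp), ih]
    rw [show a + ((n + 1 : ℕ) : ℤ) - 1 = a + n by push_cast; ring]
    ring

lemma norm_exp_sub_one_ge {t : ℝ} (h0 : 0 ≤ t) (h1 : t ≤ 1 / 2) :
    4 * t ≤ ‖Complex.exp (2 * Real.pi * Complex.I * t) - 1‖ := by
  rw [show (2 * Real.pi * Complex.I * t : ℂ) = Complex.I * ((2 * Real.pi * t : ℝ) : ℂ) by
    push_cast; ring, Complex.norm_exp_I_mul_ofReal_sub_one, show 2 * Real.pi * t / 2 = Real.pi * t by
    ring]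
  have hpi := Real.pi_pos
  have := Real.mul_le_sin (x := Real.pi * t) (by positivity) (by nlinarith)
  rw [show 2 / Real.pi * (Real.pi * t) = 2 * t by field_simp] at this
  rw [Real.norm_of_nonneg (by linarith)]
  linarith

lemma norm_exp_sub_one_ge' {t : ℝ} (h0 : 1 / 2 ≤ t) (h1 : t ≤ 1) :
    4 * (1 - t) ≤ ‖Complex.exp (2 * Real.pi * Complex.I * t) - 1‖ := by
  have h := norm_exp_sub_one_ge (t := 1 - t) (by linarith) (by linarith)
  have e : Complex.exp (2 * Real.pi * Complex.I * (1 - t : ℝ)) =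
      (Complex.exp (2 * Real.pi * Complex.I * t))⁻¹ := by
    rw [← Complex.exp_neg, show (2 * Real.pi * Complex.I * ((1 - t : ℝ) : ℂ)) =
      2 * Real.pi * Complex.I + -(2 * Real.pi * Complex.I * t) by push_cast; ring,
      Complex.exp_add, Complex.exp_two_pi_mul_I, one_mul]
  have hn : ‖Complex.exp (2 * Real.pi * Complex.I * t)‖ = 1 := by
    rw [show (2 * Real.pi * Complex.I * t : ℂ) = ((2 * Real.pi * t : ℝ) : ℂ) * Complex.I by
      push_cast; ring, Complex.norm_exp_ofReal_mul_I]
  rw [e] at h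
  have e2 : (Complex.exp (2 * Real.pi * Complex.I * t))⁻¹ - 1 =
      -((Complex.exp (2 * Real.pi * Complex.I * t))⁻¹ *
        (Complex.exp (2 * Real.pi * Complex.I * t) - 1)) := by
    field_simp [Complex.exp_ne_zero]; ring
  rwa [e2, norm_neg, norm_mul, norm_inv, hn, inv_one, one_mul] at h

/-- The difference quotient in Dini's criterion. -/
noncomputable def diniQuotient (f : ℝ → ℂ) (u t : ℝ) : ℂ :=
  (f (u + t) - f u) / (Complex.exp (2 * Real.pi * Complex.I * t) - 1)

lemma exp_ne_one_of_mem_Ioo {t : ℝ} (ht : t ∈ Set.Ioo (0 : ℝ) 1) :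
    Complex.exp (2 * Real.pi * Complex.I * t) - 1 ≠ 0 := by
  rw [← norm_pos_iff]
  rcases le_total t (1 / 2) with h | h
  · exact lt_of_lt_of_le (by linarith [ht.1]) (norm_exp_sub_one_ge ht.1.le h)
  · exact lt_of_lt_of_le (by linarith [ht.2]) (norm_exp_sub_one_ge' h ht.2.le)

open MeasureTheory in
lemma intervalIntegrable_diniQuotient {f : ℝ → ℂ} (hper : Function.Periodic f 1)
    (hcont : Continuous f) {K α : ℝ≥0} (hα : 0 < α) (hf : HolderWith K α f) (u : ℝ) :
    IntervalIntegrable (diniQuotient f u) volume 0 1 := by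
  have hα' : (-1 : ℝ) < (α : ℝ) - 1 := by
    have : (0 : ℝ) < α := by exact_mod_cast hα
    linarith
  have hi1 : IntervalIntegrable (fun t : ℝ => t ^ ((α : ℝ) - 1)) volume 0 1 :=
    intervalIntegral.intervalIntegrable_rpow' hα'
  have hi2 : IntervalIntegrable (fun t : ℝ => (1 - t) ^ ((α : ℝ) - 1)) volume 0 1 := by
    simpa using (hi1.comp_sub_left 1).symm
  have hbound := (hi1.add hi2).const_mul ((K : ℝ) / 4)
  rw [intervalIntegrable_iff_integrableOn_Ioo_of_le zero_le_one] at hbound ⊢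
  refine Integrable.mono' hbound ?_ ?_
  · refine ContinuousOn.aestronglyMeasurable ?_ measurableSet_Ioo
    refine ContinuousOn.div (by fun_prop) (by fun_prop) fun t ht => exp_ne_one_of_mem_Ioo ht
  · refine (ae_restrict_iff' measurableSet_Ioo).2 (Eventually.of_forall fun t ht => ?_)
    have p1 : 0 ≤ t ^ ((α : ℝ) - 1) := Real.rpow_nonneg ht.1.le _
    have p2 : 0 ≤ (1 - t) ^ ((α : ℝ) - 1) := Real.rpow_nonneg (by linarith [ht.2]) _
    have hK : (0 : ℝ) ≤ K := K.2
    rw [diniQuotient, norm_div]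
    have key : ∀ s : ℝ, 0 < s → ‖f (u + t) - f u‖ ≤ K * s ^ (α : ℝ) →
        4 * s ≤ ‖Complex.exp (2 * Real.pi * Complex.I * t) - 1‖ →
        ‖f (u + t) - f u‖ / ‖Complex.exp (2 * Real.pi * Complex.I * t) - 1‖ ≤
          K / 4 * s ^ ((α : ℝ) - 1) := by
      intro s hs h1 h2
      calc _ ≤ (K * s ^ (α : ℝ)) / (4 * s) := div_le_div₀ (by positivity) h1 (by positivity) h2
        _ = _ := by rw [Real.rpow_sub_one hs.ne']; field_simp
    rcases le_total t (1 / 2) with h | h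
    · have h1 := hf.dist_le (u + t) u
      rw [dist_eq_norm, Real.dist_eq, add_sub_cancel_left, abs_of_pos ht.1] at h1
      refine (key t ht.1 h1 (norm_exp_sub_one_ge ht.1.le h)).trans ?_
      nlinarith
    · have h1 := hf.dist_le (u + t) (u + 1)
      rw [hper u, dist_eq_norm, Real.dist_eq, add_sub_add_left_eq_sub, abs_sub_comm,
        abs_of_pos (by linarith [ht.2])] at h1
      refine (key (1 - t) (by linarith [ht.2]) h1 (norm_exp_sub_one_ge' h ht.2.le)).trans ?_
      nlinarith

lemma exp_two_pi_int (l : ℤ) : Complex.exp (2 * l * Real.pi * Complex.I) = 1 := by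
  rw [show (2 * l * Real.pi * Complex.I : ℂ) = l * (2 * Real.pi * Complex.I) by ring]
  exact Complex.exp_int_mul_two_pi_mul_I l

lemma integral_exp_neg (l : ℤ) :
    ∫ t in (0 : ℝ)..1, Complex.exp (-(2 * l * Real.pi * Complex.I * t)) =
      if l = 0 then 1 else 0 := by
  split_ifs with h
  · simp [h]
  · have hc : (-(2 * l * Real.pi * Complex.I) : ℂ) ≠ 0 := by
      simp [h, Real.pi_ne_zero]
    have := integral_exp_mul_complex (a := 0) (b := 1) hc
    simp only [Complex.ofReal_one, mul_one, Complex.ofReal_zero, mul_zero, Complex.exp_zero,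
      Complex.exp_neg, exp_two_pi_int, inv_one, sub_self, zero_div] at this
    rw [← this]
    refine intervalIntegral.integral_congr fun t _ => ?_
    simp only [neg_mul, Complex.exp_neg]

/-- Dini's criterion: the Fourier series of a Hölder continuous function converges pointwise. The
partial sums telescope to Fourier coefficients of the Dini quotient, which tend to zero by the
Riemann–Lebesgue lemma; hence the two bounds of summation may grow independently. -/
lemma tendsto_fourier_partial_sums {f : ℝ → ℂ} (hper : Function.Periodic f 1)
    (hcont : Continuous f) {K α : ℝ≥0} (hα : 0 < α) (hf : HolderWith K α f) (u : ℝ) :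
    Tendsto (fun p : ℕ × ℕ => ∑ l ∈ Finset.Icc (-(p.1 : ℤ)) (p.2 : ℤ),
      (∫ y in (0 : ℝ)..1, f y * Complex.exp (-(2 * l * Real.pi * Complex.I * y))) *
        Complex.exp (2 * l * Real.pi * Complex.I * u)) (atTop ×ˢ atTop) (𝓝 (f u)) := by
  have hg := intervalIntegrable_diniQuotient hper hcont hα hf u
  set c : ℤ → ℂ := fun l => ∫ t in (0 : ℝ)..1,
    diniQuotient f u t * Complex.exp (-(2 * l * Real.pi * Complex.I * t)) with hc
  have hint : ∀ l : ℤ, IntervalIntegrable (fun t : ℝ => diniQuotient f u t *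
      Complex.exp (-(2 * l * Real.pi * Complex.I * t))) MeasureTheory.volume 0 1 := fun l =>
    hg.mul_continuousOn (by fun_prop)
  have hcoef : ∀ l : ℤ, (∫ y in (0 : ℝ)..1, f y * Complex.exp (-(2 * l * Real.pi * Complex.I * y))) *
      Complex.exp (2 * l * Real.pi * Complex.I * u) =
      (c (l - 1) - c l) + f u * if l = 0 then 1 else 0 := by
    intro l
    have hP : Function.Periodic
        (fun y : ℝ => f y * Complex.exp (-(2 * l * Real.pi * Complex.I * y))) 1 := by
      intro y
      simp only [hper y]
      congr 1
      rw [show -(2 * l * Real.pi * Complex.I * ((y + 1 : ℝ) : ℂ)) =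
        -(2 * l * Real.pi * Complex.I * y) + -(2 * l * Real.pi * Complex.I) by push_cast; ring,
        Complex.exp_add, Complex.exp_neg (2 * l * Real.pi * Complex.I), exp_two_pi_int, inv_one,
        mul_one]
    have h1 := hP.intervalIntegral_add_eq 0 u
    rw [zero_add] at h1
    have h2 : ∫ y in u..u + 1, f y * Complex.exp (-(2 * l * Real.pi * Complex.I * y)) =
        ∫ t in (0 : ℝ)..1, f (u + t) *
          Complex.exp (-(2 * l * Real.pi * Complex.I * ((u + t : ℝ) : ℂ))) := by
      rw [intervalIntegral.integral_comp_add_left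
        (fun y : ℝ => f y * Complex.exp (-(2 * l * Real.pi * Complex.I * y))) u, add_zero]
    rw [h1, h2, ← integral_exp_neg l, ← intervalIntegral.integral_mul_const, hc]
    simp only
    rw [← intervalIntegral.integral_sub (hint _) (hint _), ← intervalIntegral.integral_const_mul,
      ← intervalIntegral.integral_add ((hint _).sub (hint _))
        (Continuous.intervalIntegrable (by fun_prop) _ _)]
    refine intervalIntegral.integral_congr_ae ?_
    have hne : ∀ᵐ t : ℝ, t ≠ 1 := by
      simp [MeasureTheory.ae_iff, MeasureTheory.measure_singleton]
    filter_upwards [hne] with t ht1 ht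
    rw [Set.uIoc_of_le zero_le_one] at ht
    have hexp := exp_ne_one_of_mem_Ioo (t := t) ⟨ht.1, lt_of_le_of_ne ht.2 ht1⟩
    have e1 : Complex.exp (-(2 * l * Real.pi * Complex.I * ((u + t : ℝ) : ℂ))) *
        Complex.exp (2 * l * Real.pi * Complex.I * u) =
        Complex.exp (-(2 * l * Real.pi * Complex.I * t)) := by
      rw [← Complex.exp_add]; congr 1; push_cast; ring
    have e2 : Complex.exp (-(2 * ((l - 1 : ℤ) : ℂ) * Real.pi * Complex.I * t)) =
        Complex.exp (2 * Real.pi * Complex.I * t) *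
          Complex.exp (-(2 * l * Real.pi * Complex.I * t)) := by
      rw [← Complex.exp_add]; congr 1; push_cast; ring
    rw [mul_assoc, e1, e2, diniQuotient]
    field_simp
    ring
  have hsum : ∀ p : ℕ × ℕ, ∑ l ∈ Finset.Icc (-(p.1 : ℤ)) (p.2 : ℤ),
      (∫ y in (0 : ℝ)..1, f y * Complex.exp (-(2 * l * Real.pi * Complex.I * y))) *
        Complex.exp (2 * l * Real.pi * Complex.I * u) =
      c (-((p.1 : ℤ) + 1)) - c p.2 + f u := by
    intro p
    simp only [hcoef, Finset.sum_add_distrib]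
    have h1 := sum_Icc_int_telescope c (-(p.1 : ℤ)) (p.1 + p.2)
    rw [show -(p.1 : ℤ) + ((p.1 + p.2 : ℕ) : ℤ) = p.2 by push_cast; ring,
      show -(p.1 : ℤ) - 1 = -((p.1 : ℤ) + 1) by ring] at h1
    rw [h1, ← Finset.mul_sum, Finset.sum_ite_eq', if_pos (by simp), mul_one]
  simp only [hsum]
  have hnat : Tendsto (fun n : ℕ => (n : ℝ)) atTop (cocompact ℝ) := by
    rw [cocompact_eq_atBot_atTop]
    exact tendsto_natCast_atTop_atTop.mono_right le_sup_right
  have hlim1 : Tendsto (fun n : ℕ => c (-((n : ℤ) + 1))) atTop (𝓝 0) := by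
    refine tendsto_fourier_integral (fun n : ℕ => -((n : ℤ) + 1)) ?_
    rw [cocompact_eq_atBot_atTop]
    refine Tendsto.mono_right ?_ le_sup_left
    push_cast
    exact tendsto_neg_atTop_atBot.comp (tendsto_natCast_atTop_atTop.atTop_add tendsto_const_nhds)
  have hlim2 : Tendsto (fun n : ℕ => c (n : ℤ)) atTop (𝓝 0) :=
    tendsto_fourier_integral (fun n : ℕ => (n : ℤ)) (by simpa using hnat)
  simpa using ((hlim1.comp tendsto_fst).sub (hlim2.comp tendsto_snd)).add_const (f u)

end QRegular

namespace QRegular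

/-! ### Polar parts -/

/-- Division of `f - f a` by `s - a`. -/
lemma exists_analytic_slope {f : ℂ → ℂ} {a : ℂ} (hf : AnalyticAt ℂ f a) :
    ∃ g : ℂ → ℂ, AnalyticAt ℂ g a ∧ g a = deriv f a ∧ ∀ s, f s = f a + (s - a) * g s := by
  obtain ⟨p, hp⟩ := hf
  refine ⟨dslope f a, hp.has_fpower_series_dslope_fslope.analyticAt, dslope_same f a, fun s => ?_⟩
  have := sub_smul_dslope f a s
  rw [smul_eq_mul] at this
  rw [this]; ring

/-- `f` has a polar part `c / (s - a) ^ (k + 1)` that consists of a single term. -/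
def HasPolarTerm (f : ℂ → ℂ) (a c : ℂ) (k : ℕ) : Prop :=
  ∃ h : ℂ → ℂ, AnalyticAt ℂ h a ∧ f =ᶠ[𝓝[≠] a] fun s => c / (s - a) ^ (k + 1) + h s

lemma hasPolarTerm_div {A D : ℂ → ℂ} {a : ℂ} (hA : AnalyticAt ℂ A a) (hD : AnalyticAt ℂ D a)
    (hDa : D a = 0) (hD' : deriv D a ≠ 0) :
    HasPolarTerm (fun s => A s / D s) a (A a / deriv D a) 0 := by
  obtain ⟨E, hE, hEa, hDE⟩ := exists_analytic_slope hD
  have hEne : E a ≠ 0 := by rwa [hEa]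
  have hAE : AnalyticAt ℂ (fun s => A s / E s) a := hA.div hE hEne
  obtain ⟨h, hh, -, hs⟩ := exists_analytic_slope hAE
  refine ⟨h, hh, ?_⟩
  have hE0 : ∀ᶠ s in 𝓝[≠] a, E s ≠ 0 :=
    (hE.continuousAt.eventually_ne hEne).filter_mono nhdsWithin_le_nhds
  filter_upwards [hE0, self_mem_nhdsWithin] with s hs0 hsa
  have hsa' : s - a ≠ 0 := sub_ne_zero.2 hsa
  have h1 := hs s
  rw [hDE s, hDa, zero_add, zero_add, pow_one, ← hEa]
  have : A s / ((s - a) * E s) = (A s / E s) / (s - a) := by field_simp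
  rw [this, h1]
  field_simp

lemma HasPolarTerm.deriv {f : ℂ → ℂ} {a c : ℂ} {k : ℕ} (hf : HasPolarTerm f a c k) :
    HasPolarTerm (deriv f) a (-((k + 1 : ℕ) : ℂ) * c) (k + 1) := by
  obtain ⟨h, hh, he⟩ := hf
  refine ⟨_root_.deriv h, hh.deriv, ?_⟩
  have hev := eventually_eventually_nhdsWithin.2 he
  have hha : ∀ᶠ s in 𝓝[≠] a, AnalyticAt ℂ h s :=
    hh.eventually_analyticAt.filter_mono nhdsWithin_le_nhds
  filter_upwards [hev, hha, self_mem_nhdsWithin] with s hs hhs hsa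
  have hsa' : s - a ≠ 0 := sub_ne_zero.2 hsa
  have hs' : f =ᶠ[𝓝 s] fun s => c / (s - a) ^ (k + 1) + h s := by
    have : 𝓝[{a}ᶜ] s = 𝓝 s := IsOpen.nhdsWithin_eq isOpen_compl_singleton hsa
    rw [← this]; exact hs
  have hd : HasDerivAt (fun s => c / (s - a) ^ (k + 1) + h s)
      (-((k + 1 : ℕ) : ℂ) * c / (s - a) ^ (k + 1 + 1) + _root_.deriv h s) s := by
    refine HasDerivAt.add ?_ hhs.differentiableAt.hasDerivAt
    have h1 : HasDerivAt (fun s => (s - a) ^ (k + 1)) (((k + 1 : ℕ) : ℂ) * (s - a) ^ k * 1) s := by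
      exact ((hasDerivAt_id s).sub_const a).pow (k + 1)
    have h2 := (h1.inv (pow_ne_zero _ hsa')).const_mul c
    refine HasDerivAt.congr_deriv h2 ?_
    field_simp
    ring
  rw [hs'.deriv_eq, hd.deriv]

lemma HasPolarTerm.const_mul {f : ℂ → ℂ} {a c : ℂ} {k : ℕ} (hf : HasPolarTerm f a c k) (b : ℂ) :
    HasPolarTerm (fun s => b * f s) a (b * c) k := by
  obtain ⟨h, hh, he⟩ := hf
  refine ⟨fun s => b * h s, analyticAt_const.mul hh, ?_⟩
  filter_upwards [he] with s hs
  rw [hs]; ring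

lemma HasPolarTerm.meromorphicAt {f : ℂ → ℂ} {a c : ℂ} {k : ℕ} (hf : HasPolarTerm f a c k) :
    MeromorphicAt f a := by
  obtain ⟨h, hh, he⟩ := hf
  refine MeromorphicAt.congr ?_ he.symm
  refine MeromorphicAt.add (MeromorphicAt.div analyticAt_const.meromorphicAt ?_) hh.meromorphicAt
  exact ((analyticAt_id.sub analyticAt_const).pow _).meromorphicAt

/-! ### Mellin transforms of periodic fluctuations -/

open MeasureTheory Set

lemma _root_.MeasureTheory.LocallyIntegrableOn.indicator_set {f : ℝ → ℂ} {s T : Set ℝ}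
    (hf : LocallyIntegrableOn f s) (hT : MeasurableSet T) :
    LocallyIntegrableOn (T.indicator f) s := by
  intro x hx
  obtain ⟨U, hU, hi⟩ := hf x hx
  exact ⟨U, hU, hi.indicator hT⟩

/-- `t ^ κ (log_q t) ^ k Φ (log_q t)`. -/
noncomputable def wave (q : ℕ) (κ : ℂ) (Φ : ℝ → ℂ) (k : ℕ) (t : ℝ) : ℂ :=
  (t : ℂ) ^ κ * (((Real.logb q t : ℝ) : ℂ) ^ k * Φ (Real.logb q t))

/-- The function `t ^ κ (log_q t) ^ k Φ (log_q t)`, cut off to `t > 1`. -/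
noncomputable def truncWave (q : ℕ) (κ : ℂ) (Φ : ℝ → ℂ) (k : ℕ) : ℝ → ℂ :=
  (Ioi (1 : ℝ)).indicator (wave q κ Φ k)

/-- The meromorphic continuation of `s ↦ ∫_1^∞ t ^ κ (log_q t) ^ k Φ (log_q t) t ^ (-s-1) dt` for
`1`-periodic `Φ`. The value at `k = 0` comes from the substitution of `q t` for `t`, and each further
factor `log_q t` from a derivative with respect to `s`. -/
noncomputable def waveMellin (q : ℕ) (κ : ℂ) (Φ : ℝ → ℂ) : ℕ → ℂ → ℂ
  | 0 => fun s => mellin ((Ioc (q : ℝ)⁻¹ 1).indicator fun t => (q : ℂ) ^ κ * wave q κ Φ 0 t) (-s) /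
      ((q : ℂ) ^ s - (q : ℂ) ^ κ)
  | k + 1 => fun s => (-(Real.log q : ℂ)⁻¹) * deriv (waveMellin q κ Φ k) s

section Wave

variable {q : ℕ} {κ : ℂ} {Φ : ℝ → ℂ}

lemma continuousOn_wave (hΦ : Continuous Φ) (k : ℕ) : ContinuousOn (wave q κ Φ k) (Ioi 0) := by
  have hlog : ContinuousOn (fun t : ℝ => Real.logb q t) (Ioi 0) := by
    refine (Real.continuousOn_log.mono fun t ht => ?_).div_const _
    exact (ne_of_gt ht : t ≠ 0)
  refine ContinuousOn.mul ?_ (ContinuousOn.mul ?_ (hΦ.comp_continuousOn hlog))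
  · exact fun t ht => (Complex.continuousAt_ofReal_cpow_const _ _
      (Or.inr (ne_of_gt ht))).continuousWithinAt
  · exact (Complex.continuous_ofReal.comp_continuousOn hlog).pow k

lemma locallyIntegrableOn_wave (hΦ : Continuous Φ) (k : ℕ) :
    LocallyIntegrableOn (wave q κ Φ k) (Ioi 0) :=
  (continuousOn_wave hΦ k).locallyIntegrableOn measurableSet_Ioi

lemma locallyIntegrableOn_truncWave (hΦ : Continuous Φ) (k : ℕ) :
    LocallyIntegrableOn (truncWave q κ Φ k) (Ioi 0) :=
  (locallyIntegrableOn_wave hΦ k).indicator_set measurableSet_Ioi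

lemma isBigO_zero_of_indicator {f : ℝ → ℂ} {T : Set ℝ} {a : ℝ} (ha : 0 < a) (hT : T ⊆ Ici a)
    (b : ℝ) : T.indicator f =O[𝓝[>] 0] (fun t : ℝ => t ^ (-b)) := by
  refine EventuallyEq.trans_isBigO ?_ (isBigO_zero _ _)
  have : Iio a ∈ 𝓝[>] (0 : ℝ) := mem_nhdsWithin_of_mem_nhds (Iio_mem_nhds ha)
  filter_upwards [this] with t ht
  exact indicator_of_notMem (fun h => (lt_irrefl t) (lt_of_lt_of_le ht (hT h))) _

lemma exists_bound_of_periodic (hΦ : Continuous Φ) (hper : Function.Periodic Φ 1) :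
    ∃ B : ℝ, 0 ≤ B ∧ ∀ y, ‖Φ y‖ ≤ B := by
  obtain ⟨B, hB⟩ := (isCompact_Icc (a := (0 : ℝ)) (b := 1)).exists_bound_of_continuousOn
    hΦ.continuousOn
  have h : ∀ y, ‖Φ y‖ ≤ B := by
    intro y
    have := hper.sub_int_mul_eq (x := y) ⌊y⌋
    rw [mul_one] at this
    rw [← this]
    exact hB _ ⟨Int.fract_nonneg y, (Int.fract_lt_one y).le⟩
  exact ⟨B, (norm_nonneg _).trans (h 0), h⟩

lemma truncWave_succ (k : ℕ) (t : ℝ) :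
    truncWave q κ Φ (k + 1) t = (Real.log q : ℂ)⁻¹ * (Real.log t • truncWave q κ Φ k t) := by
  by_cases ht : t ∈ Ioi (1 : ℝ)
  · simp only [truncWave, indicator_of_mem ht, wave, Real.logb, Complex.real_smul]
    push_cast; ring
  · simp [truncWave, indicator_of_notMem ht]

lemma isBigO_truncWave (hΦ : Continuous Φ) (hper : Function.Periodic Φ 1) (k : ℕ) :
    ∀ a : ℝ, a < -κ.re → truncWave q κ Φ k =O[atTop] fun t : ℝ => t ^ (-a) := by
  induction k with
  | zero =>
    intro a ha
    obtain ⟨B, hB0, hB⟩ := exists_bound_of_periodic hΦ hper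
    refine IsBigO.of_bound B ?_
    filter_upwards [eventually_gt_atTop 1] with t ht
    have ht0 : 0 < t := by linarith
    rw [truncWave, indicator_of_mem (show t ∈ Ioi (1 : ℝ) from ht), wave, pow_zero, one_mul,
      norm_mul, Complex.norm_cpow_eq_rpow_re_of_pos ht0, Real.norm_of_nonneg (by positivity),
      mul_comm]
    refine mul_le_mul (hB _) ?_ (by positivity) hB0
    exact Real.rpow_le_rpow_of_exponent_le ht.le (by linarith)
  | succ k ih =>
    intro a ha
    obtain ⟨a', h1, h2⟩ := exists_between ha
    have := isBigO_rpow_top_log_smul h1 (ih a' h2)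
    refine (this.const_mul_left ((Real.log q : ℂ)⁻¹)).congr_left fun t => ?_
    rw [truncWave_succ]

lemma hasDerivAt_mellin_truncWave (hΦ : Continuous Φ) (hper : Function.Periodic Φ 1) (k : ℕ)
    {s : ℂ} (hs : κ.re < s.re) :
    MellinConvergent (truncWave q κ Φ k) (-s) ∧
    HasDerivAt (mellin (truncWave q κ Φ k))
      (mellin (fun t => Real.log t • truncWave q κ Φ k t) (-s)) (-s) := by
  obtain ⟨a, h1, h2⟩ := exists_between (neg_lt_neg hs)
  have hO := isBigO_truncWave (q := q) hΦ hper k a h2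
  have h0 : truncWave q κ Φ k =O[𝓝[>] 0] (fun t : ℝ => t ^ (-((-s).re - 1))) :=
    isBigO_zero_of_indicator one_pos Ioi_subset_Ici_self _
  have hs1 : (-s).re < a := by rw [Complex.neg_re]; exact h1
  exact ⟨mellinConvergent_of_isBigO_rpow (locallyIntegrableOn_truncWave hΦ k) hO hs1 h0
    (by linarith), (mellin_hasDerivAt_of_isBigO_rpow (locallyIntegrableOn_truncWave hΦ k) hO hs1 h0
    (by linarith)).2⟩

lemma natCast_ne_zero_of_two_le (hq : 2 ≤ q) : (q : ℂ) ≠ 0 := by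
  exact_mod_cast (by omega : q ≠ 0)

lemma cpow_ne_of_re_lt (hq : 2 ≤ q) {s : ℂ} (hs : κ.re < s.re) : (q : ℂ) ^ s ≠ (q : ℂ) ^ κ := by
  intro h
  have h1 := congrArg norm h
  rw [Complex.norm_natCast_cpow_of_pos (by omega), Complex.norm_natCast_cpow_of_pos (by omega)] at h1
  exact absurd h1 (ne_of_gt (Real.rpow_lt_rpow_of_exponent_lt
    (by exact_mod_cast (by omega : 1 < q)) hs))

lemma differentiable_mellin_indicator_Ioc (hq : 2 ≤ q) (hΦ : Continuous Φ) :
    Differentiable ℂ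
      (mellin ((Ioc (q : ℝ)⁻¹ 1).indicator fun t => (q : ℂ) ^ κ * wave q κ Φ 0 t)) := by
  intro s
  have hq0 : (0 : ℝ) < (q : ℝ)⁻¹ := by positivity
  have hli : LocallyIntegrableOn (fun t => (q : ℂ) ^ κ * wave q κ Φ 0 t) (Ioi 0) :=
    (continuousOn_const.mul (continuousOn_wave hΦ 0)).locallyIntegrableOn measurableSet_Ioi
  refine mellin_differentiableAt_of_isBigO_rpow (a := s.re + 1) (b := s.re - 1)
    (hli.indicator_set measurableSet_Ioc) ?_ (by linarith)
    (isBigO_zero_of_indicator hq0 (fun t ht => ht.1.le) _) (by linarith)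
  refine EventuallyEq.trans_isBigO ?_ (isBigO_zero _ _)
  filter_upwards [eventually_gt_atTop 1] with t ht
  exact indicator_of_notMem (fun h => absurd h.2 (not_le.2 ht)) _

/-- Comparing the integral with its image under `t ↦ q t` gives the continuation for `k = 0`. -/
lemma waveMellin_zero_eq (hq : 2 ≤ q) (hΦ : Continuous Φ) (hper : Function.Periodic Φ 1) {s : ℂ}
    (hs : κ.re < s.re) : waveMellin q κ Φ 0 s = mellin (truncWave q κ Φ 0) (-s) := by
  have hq0 : (0 : ℝ) < q := by positivity
  have hq1 : (1 : ℝ) < q := by exact_mod_cast (by omega : 1 < q)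
  have hconv := (hasDerivAt_mellin_truncWave (q := q) hΦ hper 0 hs).1
  have h1 := mellin_comp_mul_left (truncWave q κ Φ 0) (-s) hq0
  have hpt : ∀ t ∈ Ioi (0 : ℝ), truncWave q κ Φ 0 (q * t) = (q : ℂ) ^ κ • truncWave q κ Φ 0 t +
      (Ioc (q : ℝ)⁻¹ 1).indicator (fun t => (q : ℂ) ^ κ * wave q κ Φ 0 t) t := by
    intro t ht
    have ht0 : (0 : ℝ) < t := ht
    have hw : wave q κ Φ 0 (q * t) = (q : ℂ) ^ κ * wave q κ Φ 0 t := by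
      have hl : Real.logb q (q * t) = Real.logb q t + 1 := by
        rw [Real.logb_mul hq0.ne' ht0.ne', Real.logb_self_eq_one hq1, add_comm]
      rw [wave, wave, hl, hper, pow_zero, pow_zero, Complex.ofReal_mul, Complex.ofReal_natCast,
        ← Complex.ofReal_natCast, Complex.mul_cpow_ofReal_nonneg hq0.le ht0.le]
      ring
    have hiff : q * t ∈ Ioi (1 : ℝ) ↔ (q : ℝ)⁻¹ < t := by
      rw [mem_Ioi, inv_lt_iff_one_lt_mul₀' hq0]
    by_cases hc1 : t ∈ Ioi (1 : ℝ)
    · have : q * t ∈ Ioi (1 : ℝ) := by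
        rw [mem_Ioi] at hc1 ⊢; nlinarith
      rw [truncWave, indicator_of_mem this, indicator_of_mem hc1,
        indicator_of_notMem (fun h => absurd h.2 (not_le.2 hc1)), hw, add_zero, smul_eq_mul]
    · by_cases hc2 : (q : ℝ)⁻¹ < t
      · rw [truncWave, indicator_of_mem (hiff.2 hc2), indicator_of_notMem hc1,
          indicator_of_mem (show t ∈ Ioc (q : ℝ)⁻¹ 1 from ⟨hc2, not_lt.1 hc1⟩), hw, smul_zero, zero_add]
      · rw [truncWave, indicator_of_notMem (fun h => hc2 (hiff.1 h)), indicator_of_notMem hc1,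
          indicator_of_notMem (fun h => hc2 h.1), smul_zero, add_zero]
  set g := (Ioc (q : ℝ)⁻¹ 1).indicator (fun t => (q : ℂ) ^ κ * wave q κ Φ 0 t) with hg
  have hqs : (q : ℂ) ^ s - (q : ℂ) ^ κ ≠ 0 := sub_ne_zero.2 (cpow_ne_of_re_lt hq hs)
  have hconvq : MellinConvergent (fun t => truncWave q κ Φ 0 (q * t)) (-s) :=
    (MellinConvergent.comp_mul_left hq0).2 hconv
  have hmg : mellin g (-s) = mellin (fun t => truncWave q κ Φ 0 (q * t)) (-s) -
      (q : ℂ) ^ κ • mellin (truncWave q κ Φ 0) (-s) := by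
    rw [← (hasMellin_const_smul hconv ((q : ℂ) ^ κ)).2,
      ← (hasMellin_sub hconvq (hconv.const_smul ((q : ℂ) ^ κ))).2]
    refine setIntegral_congr_fun measurableSet_Ioi fun t ht => ?_
    simp only [hpt t ht, add_sub_cancel_left]
  simp only [waveMellin]
  rw [← hg, hmg, h1, neg_neg, smul_eq_mul, smul_eq_mul, ← sub_mul,
    Complex.ofReal_natCast, mul_div_cancel_left₀ _ hqs]

lemma analyticAt_waveMellin (hq : 2 ≤ q) (hΦ : Continuous Φ) (k : ℕ) :
    ∀ s : ℂ, (q : ℂ) ^ s ≠ (q : ℂ) ^ κ → AnalyticAt ℂ (waveMellin q κ Φ k) s := by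
  have hq0 := natCast_ne_zero_of_two_le hq
  induction k with
  | zero =>
    intro s hs
    refine AnalyticAt.div ?_ ?_ (sub_ne_zero.2 hs)
    · have : Differentiable ℂ fun s => mellin
          ((Ioc (q : ℝ)⁻¹ 1).indicator fun t => (q : ℂ) ^ κ * wave q κ Φ 0 t) (-s) :=
        (differentiable_mellin_indicator_Ioc hq hΦ).comp differentiable_neg
      exact this.analyticAt s
    · have : Differentiable ℂ fun s : ℂ => (q : ℂ) ^ s - (q : ℂ) ^ κ := fun s =>
        ((differentiableAt_id.const_cpow (Or.inl hq0)).sub_const _)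
      exact this.analyticAt s
  | succ k ih => exact fun s hs => analyticAt_const.mul (ih s hs).deriv

lemma waveMellin_eq (hq : 2 ≤ q) (hΦ : Continuous Φ) (hper : Function.Periodic Φ 1) (k : ℕ) :
    ∀ s : ℂ, κ.re < s.re → waveMellin q κ Φ k s = mellin (truncWave q κ Φ k) (-s) := by
  induction k with
  | zero => exact fun s hs => waveMellin_zero_eq hq hΦ hper hs
  | succ k ih =>
    intro s hs
    have hev : waveMellin q κ Φ k =ᶠ[𝓝 s] fun s => mellin (truncWave q κ Φ k) (-s) := by
      have : {s : ℂ | κ.re < s.re} ∈ 𝓝 s :=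
        (isOpen_lt continuous_const Complex.continuous_re).mem_nhds hs
      filter_upwards [this] with z hz using ih z hz
    have hd := (hasDerivAt_mellin_truncWave (q := q) hΦ hper k hs).2.comp s (hasDerivAt_neg s)
    have e : truncWave q κ Φ (k + 1) =
        fun t => (Real.log q : ℂ)⁻¹ • (Real.log t • truncWave q κ Φ k t) := by
      funext t; rw [truncWave_succ, smul_eq_mul]
    simp only [waveMellin]
    rw [hev.deriv_eq, e, mellin_const_smul]
    have := hd.deriv
    simp only [Function.comp_def] at this
    rw [this, smul_eq_mul]
    ring

/-- At the poles, the `Ioc` integral is a Fourier coefficient, by the substitution `t = q ^ u`. -/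
lemma mellin_indicator_Ioc_at_pole (hq : 2 ≤ q) (hΦ : Continuous Φ) (hper : Function.Periodic Φ 1)
    (l : ℤ) :
    mellin ((Ioc (q : ℝ)⁻¹ 1).indicator fun t => (q : ℂ) ^ κ * wave q κ Φ 0 t)
      (-(κ + 2 * l * Real.pi * Complex.I / (Real.log q : ℂ))) =
    (q : ℂ) ^ κ * (Real.log q : ℂ) *
      ∫ u in (0 : ℝ)..1, Φ u * Complex.exp (-(2 * l * Real.pi * Complex.I * u)) := by
  have hq0 : (0 : ℝ) < q := by positivity
  have hq1 : (1 : ℝ) < q := by exact_mod_cast (by omega : 1 < q)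
  have hlog : (Real.log q : ℂ) ≠ 0 := by exact_mod_cast (Real.log_pos hq1).ne'
  have hinv1 : (q : ℝ)⁻¹ ≤ 1 := inv_le_one_of_one_le₀ hq1.le
  set χ : ℂ := 2 * l * Real.pi * Complex.I / (Real.log q : ℂ) with hχ
  set G : ℝ → ℂ := fun t => (t : ℂ) ^ (-(κ + χ) - 1) * ((q : ℂ) ^ κ * wave q κ Φ 0 t) with hG
  have h1 : mellin ((Ioc (q : ℝ)⁻¹ 1).indicator fun t => (q : ℂ) ^ κ * wave q κ Φ 0 t) (-(κ + χ)) =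
      ∫ t in (q : ℝ)⁻¹..1, G t := by
    rw [mellin, intervalIntegral.integral_of_le hinv1]
    simp_rw [smul_eq_mul]
    have : ∀ t : ℝ, (t : ℂ) ^ (-(κ + χ) - 1) *
        (Ioc (q : ℝ)⁻¹ 1).indicator (fun t => (q : ℂ) ^ κ * wave q κ Φ 0 t) t =
        (Ioc (q : ℝ)⁻¹ 1).indicator G t := by
      intro t
      by_cases ht : t ∈ Ioc (q : ℝ)⁻¹ 1
      · simp only [indicator_of_mem ht, hG]
      · simp only [indicator_of_notMem ht, mul_zero]
    simp_rw [this]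
    rw [setIntegral_indicator measurableSet_Ioc]
    congr 2
    rw [inter_eq_right]
    exact fun t ht => lt_trans (inv_pos.2 hq0) ht.1
  have hcpow : ∀ u : ℝ, (((q : ℝ) ^ u : ℝ) : ℂ) = Complex.exp ((u : ℂ) * (Real.log q : ℂ)) := by
    intro u
    rw [Real.rpow_def_of_pos hq0]; push_cast; rw [mul_comm]
  have h2 : ∫ t in (q : ℝ)⁻¹..1, G t =
      ∫ u in (-1 : ℝ)..0, (Real.log q * (q : ℝ) ^ u) • G ((q : ℝ) ^ u) := by
    have hsub := intervalIntegral.integral_deriv_smul_comp'' (a := -1) (b := 0)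
      (f := fun u : ℝ => (q : ℝ) ^ u) (f' := fun u : ℝ => Real.log q * (q : ℝ) ^ u) (g := G)
      (by fun_prop (disch := positivity)) ?_ ?_ ?_
    · simp only [Function.comp_def, Real.rpow_neg_one, Real.rpow_zero] at hsub
      exact hsub.symm
    · intro u _
      have := (Real.hasStrictDerivAt_const_rpow hq0 u).hasDerivAt
      rw [mul_comm] at this
      exact this.hasDerivWithinAt
    · exact Continuous.continuousOn (continuous_const.mul
        (Continuous.rpow continuous_const continuous_id fun _ => Or.inl hq0.ne'))
    · have hsubset : (fun u : ℝ => (q : ℝ) ^ u) '' uIcc (-1) 0 ⊆ Ioi 0 := by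
        rintro _ ⟨u, -, rfl⟩; exact Real.rpow_pos_of_pos hq0 _
      refine ContinuousOn.mono ?_ hsubset
      refine ContinuousOn.mul ?_ (continuousOn_const.mul (continuousOn_wave hΦ 0))
      exact fun t ht => (Complex.continuousAt_ofReal_cpow_const _ _
        (Or.inr (ne_of_gt ht))).continuousWithinAt
  have h3 : ∀ u : ℝ, (Real.log q * (q : ℝ) ^ u) • G ((q : ℝ) ^ u) =
      (q : ℂ) ^ κ * (Real.log q : ℂ) *
        (Φ u * Complex.exp (-(2 * l * Real.pi * Complex.I * u))) := by
    intro u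
    have hpos : (0 : ℝ) < (q : ℝ) ^ u := Real.rpow_pos_of_pos hq0 _
    have hne : (((q : ℝ) ^ u : ℝ) : ℂ) ≠ 0 := by exact_mod_cast hpos.ne'
    have hlogu : Complex.log (((q : ℝ) ^ u : ℝ) : ℂ) = u * (Real.log q : ℂ) := by
      rw [← Complex.ofReal_log hpos.le, Real.log_rpow hq0]; push_cast; ring
    have e : (((q : ℝ) ^ u : ℝ) : ℂ) * (((((q : ℝ) ^ u : ℝ) : ℂ)) ^ (-(κ + χ) - 1) *
        ((((q : ℝ) ^ u : ℝ) : ℂ)) ^ κ) = Complex.exp (-(2 * l * Real.pi * Complex.I * u)) := by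
      rw [Complex.cpow_def_of_ne_zero hne, Complex.cpow_def_of_ne_zero hne, hlogu, hcpow,
        ← Complex.exp_add, ← Complex.exp_add]
      congr 1
      rw [hχ]; field_simp; ring
    rw [← e, Complex.real_smul, hG]
    simp only [wave, Real.logb_rpow hq0 hq1.ne', pow_zero]
    push_cast
    ring
  rw [h1, h2]
  simp_rw [h3]
  rw [intervalIntegral.integral_const_mul]
  congr 1
  have hP : Function.Periodic
      (fun y : ℝ => Φ y * Complex.exp (-(2 * l * Real.pi * Complex.I * y))) 1 := by
    intro y
    simp only [hper y]
    congr 1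
    rw [show -(2 * l * Real.pi * Complex.I * ((y + 1 : ℝ) : ℂ)) =
      -(2 * l * Real.pi * Complex.I * y) + -(2 * l * Real.pi * Complex.I) by push_cast; ring,
      Complex.exp_add, Complex.exp_neg (2 * l * Real.pi * Complex.I), exp_two_pi_int, inv_one,
      mul_one]
  have := hP.intervalIntegral_add_eq (-1) 0
  simpa using this

lemma cpow_add_pole (hq : 2 ≤ q) (κ : ℂ) (l : ℤ) :
    (q : ℂ) ^ (κ + 2 * l * Real.pi * Complex.I / (Real.log q : ℂ)) = (q : ℂ) ^ κ := by
  have hq1 : (1 : ℝ) < q := by exact_mod_cast (by omega : 1 < q)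
  have hlog : (Real.log q : ℂ) ≠ 0 := by exact_mod_cast (Real.log_pos hq1).ne'
  have hq0 := natCast_ne_zero_of_two_le hq
  rw [Complex.cpow_add _ _ hq0, Complex.cpow_def_of_ne_zero hq0 (_ / _), ← Complex.natCast_log,
    mul_div_cancel₀ _ hlog, exp_two_pi_int, mul_one]

lemma hasPolarTerm_waveMellin (hq : 2 ≤ q) (hΦ : Continuous Φ) (hper : Function.Periodic Φ 1)
    (l : ℤ) (k : ℕ) :
    HasPolarTerm (waveMellin q κ Φ k) (κ + 2 * l * Real.pi * Complex.I / (Real.log q : ℂ))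
      ((k.factorial : ℂ) / (Real.log q : ℂ) ^ k *
        ∫ u in (0 : ℝ)..1, Φ u * Complex.exp (-(2 * l * Real.pi * Complex.I * u))) k := by
  have hq1 : (1 : ℝ) < q := by exact_mod_cast (by omega : 1 < q)
  have hlog : (Real.log q : ℂ) ≠ 0 := by exact_mod_cast (Real.log_pos hq1).ne'
  have hq0 := natCast_ne_zero_of_two_le hq
  set a := κ + 2 * l * Real.pi * Complex.I / (Real.log q : ℂ) with ha
  induction k with
  | zero =>
    have hA : Differentiable ℂ fun s => mellin
        ((Ioc (q : ℝ)⁻¹ 1).indicator fun t => (q : ℂ) ^ κ * wave q κ Φ 0 t) (-s) :=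
      (differentiable_mellin_indicator_Ioc hq hΦ).comp differentiable_neg
    have hD : Differentiable ℂ fun s : ℂ => (q : ℂ) ^ s - (q : ℂ) ^ κ := fun s =>
      ((differentiableAt_id.const_cpow (Or.inl hq0)).sub_const _)
    have hD' : deriv (fun s : ℂ => (q : ℂ) ^ s - (q : ℂ) ^ κ) a = (q : ℂ) ^ κ * Real.log q := by
      have := ((hasDerivAt_id a).const_cpow (c := (q : ℂ)) (Or.inl hq0)).sub_const ((q : ℂ) ^ κ)
      simp only [id] at this
      rw [this.deriv, ha, cpow_add_pole hq, ← Complex.natCast_log, mul_one]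
    have hqκ : (q : ℂ) ^ κ ≠ 0 := by simp [Complex.cpow_eq_zero_iff, hq0]
    have := hasPolarTerm_div (hA.analyticAt a) (hD.analyticAt a)
      (by rw [ha, cpow_add_pole hq, sub_self]) (by rw [hD']; exact mul_ne_zero hqκ hlog)
    rw [hD', ha, mellin_indicator_Ioc_at_pole hq hΦ hper l,
      mul_div_cancel_left₀ _ (mul_ne_zero hqκ hlog), ← ha] at this
    simpa [waveMellin] using this
  | succ k ih =>
    have := ih.deriv.const_mul (-(Real.log q : ℂ)⁻¹)
    rw [waveMellin]
    convert this using 1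
    rw [Nat.factorial_succ, pow_succ]; push_cast; field_simp

end Wave

end QRegular

namespace QRegular

/-! ### Residues -/

/-- The residue of `f s * (s - a) ^ k` is the coefficient of `(s - a) ^ (-k-1)` in the polar part of
`f`. -/
lemma hasResidueAt_of_eventuallyEq {f h : ℂ → ℂ} {a : ℂ} {m : ℕ} {c : ℕ → ℂ} (hh : AnalyticAt ℂ h a)
    (hf : f =ᶠ[𝓝[≠] a] fun s => ∑ j ∈ Finset.range m, c j / (s - a) ^ (j + 1) + h s) {k : ℕ}
    (hk : k < m) {g : ℂ → ℂ} (hg : g =ᶠ[𝓝[≠] a] fun s => f s * (s - a) ^ k) :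
    HasResidueAt g a (c k) := by
  have hsub : AnalyticAt ℂ (fun s : ℂ => s - a) a := analyticAt_id.sub analyticAt_const
  have hg' : g =ᶠ[𝓝[≠] a] fun s => ∑ j ∈ Finset.range m, c j * (s - a) ^ ((k : ℤ) - j - 1) +
      h s * (s - a) ^ k := by
    filter_upwards [hg, hf, self_mem_nhdsWithin] with s h1 h2 hsa
    have hsa' : s - a ≠ 0 := sub_ne_zero.2 hsa
    rw [h1, h2, add_mul, Finset.sum_mul]
    congr 1
    refine Finset.sum_congr rfl fun j _ => ?_
    rw [sub_sub, zpow_sub₀ hsa', zpow_natCast, ← Nat.cast_add_one, zpow_natCast]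
    exact div_mul_eq_mul_div _ _ _ |>.trans (mul_div_assoc _ _ _)
  refine ⟨MeromorphicAt.congr (MeromorphicAt.add (MeromorphicAt.fun_sum fun j _ => ?_)
    (hh.mul (hsub.pow k)).meromorphicAt) hg'.symm, ?_⟩
  · exact analyticAt_const.meromorphicAt.mul (hsub.meromorphicAt.zpow _)
  rw [Filter.EventuallyEq, eventually_nhdsWithin_iff, Metric.eventually_nhds_iff] at hg'
  obtain ⟨ε, hε, hεg⟩ := hg'
  obtain ⟨δ, hδ, hδh⟩ := Metric.eventually_nhds_iff.1 hh.eventually_analyticAt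
  filter_upwards [Ioo_mem_nhdsGT (lt_min hε hδ)] with r hr
  have hr0 : 0 < r := hr.1
  have hrε : r < ε := hr.2.trans_le (min_le_left _ _)
  have hrδ : r < δ := hr.2.trans_le (min_le_right _ _)
  have hh' : ∀ z ∈ Metric.closedBall a r, AnalyticAt ℂ (fun s => h s * (s - a) ^ k) z := by
    intro z hz
    exact (hδh (lt_of_le_of_lt hz hrδ)).mul ((analyticAt_id.sub analyticAt_const).pow k)
  have hci : ∀ j : ℕ, CircleIntegrable (fun z => c j * (z - a) ^ ((k : ℤ) - j - 1)) a r := by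
    intro j
    have : CircleIntegrable (fun z => (z - a) ^ ((k : ℤ) - j - 1)) a r := by
      rw [circleIntegrable_sub_zpow_iff]
      right; right
      simp [(abs_pos.2 hr0.ne').ne]
    exact this.const_smul (a := c j)
  rw [circleIntegral.integral_congr hr0.le
    (g := fun s => ∑ j ∈ Finset.range m, c j * (s - a) ^ ((k : ℤ) - j - 1) + h s * (s - a) ^ k)]
  · rw [circleIntegral.integral_add (CircleIntegrable.fun_sum _ fun j _ => hci j)
      (ContinuousOn.circleIntegrable hr0.le fun z hz =>
        (hh' z (Metric.sphere_subset_closedBall hz)).continuousAt.continuousWithinAt),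
      circleIntegral.integral_fun_sum (fun j _ => hci j),
      Complex.circleIntegral_eq_zero_of_differentiable_on_off_countable hr0.le Set.countable_empty
        (fun z hz => (hh' z hz).continuousAt.continuousWithinAt)
        (fun z hz => (hh' z (Metric.ball_subset_closedBall hz.1)).differentiableAt), add_zero]
    rw [Finset.sum_eq_single k]
    · rw [circleIntegral.integral_const_mul, show (k : ℤ) - k - 1 = -1 by ring]
      simp only [zpow_neg_one]
      rw [circleIntegral.integral_sub_center_inv a hr0.ne']
      ring
    · intro j _ hjk
      rw [circleIntegral.integral_const_mul, circleIntegral.integral_sub_zpow_of_ne (by omega),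
        mul_zero]
    · intro hk'
      exact absurd (Finset.mem_range.2 hk) hk'
  · intro z hz
    have hd : dist z a = r := hz
    refine hεg (by rw [hd]; exact hrε) ?_
    rintro rfl
    rw [dist_self] at hd
    exact hr0.ne hd

/-! ### Continuation of the Dirichlet series of a linear functional -/

open MeasureTheory Set

variable {q d : ℕ} {C : Matrix (Fin d) (Fin d) ℂ} {v : ℕ → Fin d → ℂ} {c R : ℝ}

lemma cpow_clogb_self (hq : 2 ≤ q) {μ : ℂ} (hμ : μ ≠ 0) : (q : ℂ) ^ clogb q μ = μ := by
  have hq1 : (1 : ℝ) < q := by exact_mod_cast (by omega : 1 < q)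
  have := cpow_clogb hq (t := q) (by linarith) μ
  rw [Real.logb_self_eq_one hq1] at this
  simpa [Complex.exp_log hμ] using this

lemma clogb_re (μ : ℂ) : (clogb q μ).re = Real.logb q ‖μ‖ := by
  rw [clogb, Complex.div_ofReal_re, Complex.log_re, Real.logb]

lemma mainTerm_eq (Φ : ℂ → ℕ → ℝ → ℂ) (t : ℝ) : mainTerm q C R Φ t =
    ∑ μ ∈ (eigenvalues C).filter (fun μ => R < ‖μ‖), ∑ k ∈ Finset.range (maxJordanBlock C μ),
      wave q (clogb q μ) (Φ μ k) k t := by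
  simp only [mainTerm, wave, Finset.mul_sum]

/-- The difference between the summatory function and its main term, cut off to `t > 1`. The sum
includes the index `⌊t⌋`, as partial summation requires. -/
noncomputable def truncRemainder (q : ℕ) (C : Matrix (Fin d) (Fin d) ℂ) (v : ℕ → Fin d → ℂ) (R : ℝ)
    (e : Fin d → ℂ) (Φ : ℂ → ℕ → ℝ → ℂ) : ℝ → ℂ :=
  (Ioi (1 : ℝ)).indicator fun t => e ⬝ᵥ vecSum v (⌊t⌋₊ + 1) - mainTerm q C R Φ t

/-- The meromorphic continuation of `∫_1^∞ (∑_{n ≤ t} e ⬝ᵥ v n) t ^ (-s-1) dt`: the main terms are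
continued individually, and the remainder converges for `Re s > log_q R`. -/
noncomputable def summatoryMellin (q : ℕ) (C : Matrix (Fin d) (Fin d) ℂ) (v : ℕ → Fin d → ℂ) (R : ℝ)
    (e : Fin d → ℂ) (Φ : ℂ → ℕ → ℝ → ℂ) (s : ℂ) : ℂ :=
  (∑ μ ∈ (eigenvalues C).filter (fun μ => R < ‖μ‖), ∑ k ∈ Finset.range (maxJordanBlock C μ),
    waveMellin q (clogb q μ) (Φ μ k) k s) + mellin (truncRemainder q C v R e Φ) (-s)

lemma locallyIntegrableOn_floor (F : ℕ → ℂ) : LocallyIntegrableOn (fun t : ℝ => F ⌊t⌋₊) (Ioi 0) := by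
  intro x hx
  refine ⟨Iio (x + 1) ∩ Ioi 0, ?_, ?_⟩
  · rw [inter_comm]
    exact inter_mem_nhdsWithin _ (Iio_mem_nhds (by linarith))
  · have hfin : volume (Iio (x + 1) ∩ Ioi (0 : ℝ)) ≠ ⊤ := by
      rw [inter_comm, Ioi_inter_Iio]; simp
    refine Measure.integrableOn_of_bounded (M := ∑ j ∈ Finset.range (⌊x + 1⌋₊ + 1), ‖F j‖) hfin ?_ ?_
    · exact ((measurable_from_top (f := F)).comp Nat.measurable_floor).aestronglyMeasurable
    · refine (ae_restrict_iff' (measurableSet_Iio.inter measurableSet_Ioi)).2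
        (Eventually.of_forall fun t ht => ?_)
      refine Finset.single_le_sum (f := fun j => ‖F j‖) (fun _ _ => norm_nonneg _) ?_
      rw [Finset.mem_range, Nat.lt_succ_iff]
      exact Nat.floor_mono (le_of_lt ht.1)

namespace BlockRegular

lemma norm_le_rpow (h : BlockRegular q C v c R) {n : ℕ} (hn : 1 ≤ n) :
    ‖v n‖ ≤ c * R * (n : ℝ) ^ Real.logb q R := by
  have hR := h.one_le
  have hc := h.c_nonneg
  have hq1 : (1 : ℝ) < q := by exact_mod_cast (by have := h.two_le; omega : 1 < q)
  have hn0 : (0 : ℝ) < n := by exact_mod_cast hn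
  refine (h.growth (Nat.log q n + 1) n (Nat.lt_pow_succ_log_self (by have := h.two_le; omega) n)).trans ?_
  have hle : ((Nat.log q n : ℕ) : ℝ) ≤ Real.logb q n := by
    rw [Real.le_logb_iff_rpow_le hq1 hn0, Real.rpow_natCast]
    exact_mod_cast Nat.pow_log_le_self q (by omega)
  have e1 : R ^ Nat.log q n ≤ (n : ℝ) ^ Real.logb q R := by
    calc R ^ Nat.log q n = R ^ ((Nat.log q n : ℕ) : ℝ) := (Real.rpow_natCast _ _).symm
      _ ≤ R ^ Real.logb q n := Real.rpow_le_rpow_of_exponent_le hR hle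
      _ = (n : ℝ) ^ Real.logb q R := by
        rw [Real.rpow_def_of_pos (by linarith), Real.rpow_def_of_pos hn0, Real.logb, Real.logb]
        congr 1; ring
  calc c * R ^ (Nat.log q n + 1) = c * R * R ^ Nat.log q n := by rw [pow_succ]; ring
    _ ≤ _ := by gcongr

lemma logb_nonneg (h : BlockRegular q C v c R) : 0 ≤ Real.logb q R :=
  Real.logb_nonneg (by exact_mod_cast (by have := h.two_le; omega : 1 < q)) h.one_le

lemma norm_dotProduct_le_rpow (h : BlockRegular q C v c R) (e : Fin d → ℂ) {n : ℕ} (hn : 1 ≤ n) :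
    ‖e ⬝ᵥ v n‖ ≤ (d * ‖e‖ * (c * R)) * (n : ℝ) ^ Real.logb q R := by
  refine (norm_dotProduct_le _ _).trans ?_
  rw [mul_assoc (d * ‖e‖)]
  exact mul_le_mul_of_nonneg_left (h.norm_le_rpow hn) (by positivity)

/-- Partial summation. -/
lemma dirichlet_eq_integral (h : BlockRegular q C v c R) (e : Fin d → ℂ) {s : ℂ}
    (hs : Real.logb q R + 1 < s.re) :
    e ⬝ᵥ v 0 + ∑' n : ℕ, ((n + 1 : ℕ) : ℂ) ^ (-s) * e ⬝ᵥ v (n + 1) =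
      s * mellin ((Ioi (1 : ℝ)).indicator fun t => e ⬝ᵥ vecSum v (⌊t⌋₊ + 1)) (-s) := by
  have hR := h.one_le
  have hc := h.c_nonneg
  have hlog := h.logb_nonneg
  set f : ℕ → ℂ := fun n => e ⬝ᵥ v n with hf
  set r := Real.logb q R + 1 with hr
  have hr0 : 0 ≤ r := by linarith
  have hs0 : s ≠ 0 := Complex.ne_zero_of_re_pos (by linarith)
  set B := d * ‖e‖ * (c * R) with hB
  have hB0 : 0 ≤ B := by positivity
  have hO : (fun n ↦ ∑ k ∈ Finset.Icc 1 n, ‖f k‖) =O[atTop] fun n : ℕ ↦ (n : ℝ) ^ r := by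
    refine IsBigO.of_bound B ?_
    filter_upwards [eventually_ge_atTop 1] with n hn
    have hn0 : (0 : ℝ) < n := by exact_mod_cast hn
    rw [Real.norm_of_nonneg (Finset.sum_nonneg fun _ _ => norm_nonneg _),
      Real.norm_of_nonneg (by positivity)]
    calc _ ≤ ∑ k ∈ Finset.Icc 1 n, B * (n : ℝ) ^ Real.logb q R := by
          refine Finset.sum_le_sum fun k hk => ?_
          rw [Finset.mem_Icc] at hk
          refine (h.norm_dotProduct_le_rpow e hk.1).trans ?_
          gcongr
          exact hk.2
      _ = _ := by
          rw [Finset.sum_const, Nat.card_Icc, Nat.add_sub_cancel, nsmul_eq_mul, hr,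
            Real.rpow_add hn0, Real.rpow_one]
          ring
  have hsum := LSeriesSummable_of_sum_norm_bigO hO hr0 hs
  have hL := LSeries_eq_mul_integral' f hr0 hs hO
  have hser : ∑' n : ℕ, ((n + 1 : ℕ) : ℂ) ^ (-s) * f (n + 1) = LSeries f s := by
    rw [LSeries, Summable.tsum_eq_zero_add hsum, LSeries.term_zero, zero_add]
    refine tsum_congr fun n => ?_
    rw [LSeries.term_of_ne_zero (Nat.succ_ne_zero n), Complex.cpow_neg, div_eq_mul_inv, mul_comm]
  have hI1 : IntegrableOn (fun t : ℝ => (t : ℂ) ^ (-(s + 1))) (Ioi 1) :=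
    integrableOn_Ioi_cpow_of_lt (by simp; linarith) one_pos
  have hI1v : ∫ t in Ioi (1 : ℝ), (t : ℂ) ^ (-(s + 1)) = 1 / s := by
    rw [integral_Ioi_cpow_of_lt (by simp; linarith) one_pos, Complex.ofReal_one, Complex.one_cpow,
      show -(s + 1) + 1 = -s by ring, div_neg, neg_div, neg_neg]
  have hpt : ∀ t : ℝ, e ⬝ᵥ vecSum v (⌊t⌋₊ + 1) = f 0 + ∑ k ∈ Finset.Icc 1 ⌊t⌋₊, f k := by
    intro t
    rw [vecSum, dotProduct_sum, Finset.sum_range_succ', add_comm, Finset.range_eq_Ico,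
      Finset.sum_Ico_add' (fun n => e ⬝ᵥ v n) 0 ⌊t⌋₊ 1]
    rfl
  have hI2 : IntegrableOn (fun t : ℝ => (∑ k ∈ Finset.Icc 1 ⌊t⌋₊, f k) * (t : ℂ) ^ (-(s + 1)))
      (Ioi 1) := by
    have hOt : (Ioi (1 : ℝ)).indicator (fun t : ℝ => ∑ k ∈ Finset.Icc 1 ⌊t⌋₊, f k) =O[atTop]
        fun t : ℝ => t ^ (- -r) := by
      obtain ⟨K, hK⟩ := (hO.comp_tendsto (tendsto_nat_floor_atTop (α := ℝ))).bound
      refine IsBigO.of_bound |K| ?_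
      filter_upwards [hK, eventually_gt_atTop 1] with t ht ht1
      rw [indicator_of_mem (show t ∈ Ioi (1 : ℝ) from ht1), neg_neg]
      simp only [Function.comp_apply] at ht
      rw [Real.norm_of_nonneg (Finset.sum_nonneg fun _ _ => norm_nonneg _),
        Real.norm_of_nonneg (by positivity)] at ht
      rw [Real.norm_of_nonneg (by positivity)]
      calc _ ≤ _ := norm_sum_le _ _
        _ ≤ _ := ht
        _ ≤ |K| * (⌊t⌋₊ : ℝ) ^ r := by gcongr; exact le_abs_self K
        _ ≤ |K| * t ^ r := by gcongr; exact Nat.floor_le (by linarith)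
    have hm := mellinConvergent_of_isBigO_rpow (s := -s)
      ((locallyIntegrableOn_floor fun n => ∑ k ∈ Finset.Icc 1 n, f k).indicator_set
        measurableSet_Ioi) hOt (by rw [Complex.neg_re]; linarith)
      (isBigO_zero_of_indicator one_pos Ioi_subset_Ici_self ((-s).re - 1)) (by linarith)
    refine (IntegrableOn.mono_set hm (Ioi_subset_Ioi zero_le_one)).congr_fun (fun t ht => ?_)
      measurableSet_Ioi
    simp only [indicator_of_mem ht, smul_eq_mul, neg_add']
    ring
  have hmell : mellin ((Ioi (1 : ℝ)).indicator fun t => e ⬝ᵥ vecSum v (⌊t⌋₊ + 1)) (-s) =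
      f 0 * (1 / s) + ∫ t in Ioi (1 : ℝ), (∑ k ∈ Finset.Icc 1 ⌊t⌋₊, f k) * (t : ℂ) ^ (-(s + 1)) := by
    rw [← hI1v, ← integral_const_mul, ← integral_add (hI1.const_mul _) hI2, mellin]
    have : ∀ t : ℝ, (t : ℂ) ^ (-s - 1) • (Ioi (1 : ℝ)).indicator
        (fun t => e ⬝ᵥ vecSum v (⌊t⌋₊ + 1)) t =
        (Ioi (1 : ℝ)).indicator (fun t : ℝ => f 0 * (t : ℂ) ^ (-(s + 1)) +
          (∑ k ∈ Finset.Icc 1 ⌊t⌋₊, f k) * (t : ℂ) ^ (-(s + 1))) t := by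
      intro t
      by_cases ht : t ∈ Ioi (1 : ℝ)
      · rw [indicator_of_mem ht, indicator_of_mem ht, hpt, smul_eq_mul, neg_add']
        ring
      · rw [indicator_of_notMem ht, indicator_of_notMem ht, smul_zero]
    simp_rw [this]
    rw [setIntegral_indicator measurableSet_Ioi, inter_eq_right.2 (Ioi_subset_Ioi zero_le_one)]
  rw [hser, hL, hmell, mul_add, mul_left_comm, mul_one_div_cancel hs0, mul_one]

end BlockRegular

end QRegular

namespace QRegular

open MeasureTheory Set

/-! ### Poles of the continuation -/

lemma polePoint_re (q : ℕ) (μ : ℂ) (l : ℤ) : (polePoint q μ l).re = Real.logb q ‖μ‖ := by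
  have : 2 * l * Real.pi * Complex.I / (Real.log q : ℂ) =
      ((2 * l * Real.pi / Real.log q : ℝ) : ℂ) * Complex.I := by push_cast; ring
  rw [polePoint, Complex.add_re, clogb_re, this, Complex.re_ofReal_mul, Complex.I_re, mul_zero,
    add_zero]

lemma hasMellin_sum {ι : Type*} (T : Finset ι) {f : ι → ℝ → ℂ} {z : ℂ}
    (hf : ∀ i ∈ T, MellinConvergent (f i) z) :
    HasMellin (fun t => ∑ i ∈ T, f i t) z (∑ i ∈ T, mellin (f i) z) := by
  classical
  induction T using Finset.induction_on with
  | empty =>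
    simp only [Finset.sum_empty]
    exact ⟨by simp [MellinConvergent], by simp [mellin]⟩
  | insert i T hi ih =>
    have ih' := ih fun j hj => hf j (Finset.mem_insert_of_mem hj)
    simp only [Finset.sum_insert hi]
    have := hasMellin_add (hf i (Finset.mem_insert_self _ _)) ih'.1
    rw [ih'.2] at this
    exact this

/-- The functions `Φ μ k` describe the summatory function of `e ⬝ᵥ v` up to an error of the order
`t ^ (log_q R)` times a power of `log t`. -/
structure IsExpansion {d : ℕ} (q : ℕ) (C : Matrix (Fin d) (Fin d) ℂ) (v : ℕ → Fin d → ℂ) (R : ℝ)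
    (e : Fin d → ℂ) (Φ : ℂ → ℕ → ℝ → ℂ) : Prop where
  fluctuation : ∀ μ ∈ eigenvalues C, R < ‖μ‖ → ∀ k, IsFluctuation q R μ (Φ μ k)
  bound : ∃ K : ℝ, 0 ≤ K ∧ ∀ (L : ℕ) (t : ℝ), 0 < t → t < (q : ℝ) ^ L →
    ‖e ⬝ᵥ vecSum v ⌊t⌋₊ - mainTerm q C R Φ t‖ ≤ K * R ^ L * (L + 1) ^ criticalExponent C R

namespace IsExpansion

variable {q d : ℕ} {C : Matrix (Fin d) (Fin d) ℂ} {v : ℕ → Fin d → ℂ} {c R : ℝ} {e : Fin d → ℂ}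
  {Φ : ℂ → ℕ → ℝ → ℂ}

lemma isBigO_truncRemainder (hE : IsExpansion q C v R e Φ) (h : BlockRegular q C v c R) {a : ℝ}
    (ha : a < -Real.logb q R) :
    truncRemainder q C v R e Φ =O[atTop] fun t : ℝ => t ^ (-a) := by
  obtain ⟨K, hK, hb⟩ := hE.bound
  have h1 := isBigO_of_digits_bound h.two_le h.one_le hK hb
  have h2 : (fun t : ℝ => t ^ Real.logb q R * Real.log t ^ criticalExponent C R) =O[atTop]
      fun t : ℝ => t ^ (-a) := by
    have h3 := (isLittleO_log_rpow_rpow_atTop (criticalExponent C R : ℝ)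
      (s := -a - Real.logb q R) (by linarith)).isBigO
    have h4 := (isBigO_refl (fun t : ℝ => t ^ Real.logb q R) atTop).mul h3
    refine h4.congr' (Eventually.of_forall fun t => by simp only [Real.rpow_natCast]) ?_
    filter_upwards [eventually_gt_atTop 0] with t ht
    rw [← Real.rpow_add ht]; congr 1; ring
  have h5 : (fun t : ℝ => e ⬝ᵥ v ⌊t⌋₊) =O[atTop] fun t : ℝ => t ^ (-a) := by
    refine IsBigO.of_bound (d * ‖e‖ * (c * R)) ?_
    filter_upwards [eventually_ge_atTop 1] with t ht
    have ht0 : 0 < t := by linarith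
    have hR := h.one_le
    have hc := h.c_nonneg
    have hl := h.logb_nonneg
    refine (h.norm_dotProduct_le_rpow e (Nat.one_le_floor_iff t |>.2 ht)).trans ?_
    rw [Real.norm_of_nonneg (by positivity)]
    refine mul_le_mul_of_nonneg_left ?_ (by positivity)
    calc _ ≤ t ^ Real.logb q R := by gcongr; exact Nat.floor_le ht0.le
      _ ≤ _ := Real.rpow_le_rpow_of_exponent_le ht (by linarith)
  refine ((h1.trans h2).add h5).congr' ?_ EventuallyEq.rfl
  filter_upwards [eventually_gt_atTop 1] with t ht
  rw [truncRemainder, indicator_of_mem (show t ∈ Ioi (1 : ℝ) from ht), vecSum, vecSum,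
    Finset.sum_range_succ, dotProduct_add]
  ring

lemma locallyIntegrableOn_truncRemainder (hE : IsExpansion q C v R e Φ) :
    LocallyIntegrableOn (truncRemainder q C v R e Φ) (Ioi 0) := by
  refine LocallyIntegrableOn.indicator_set ?_ measurableSet_Ioi
  refine (locallyIntegrableOn_floor fun n => e ⬝ᵥ vecSum v (n + 1)).sub ?_
  refine ContinuousOn.locallyIntegrableOn ?_ measurableSet_Ioi
  rw [show mainTerm q C R Φ = _ from funext fun t => mainTerm_eq Φ t]
  refine continuousOn_finsetSum _ fun μ hμ => continuousOn_finsetSum _ fun k _ => ?_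
  rw [Finset.mem_filter] at hμ
  exact continuousOn_wave (hE.fluctuation μ hμ.1 hμ.2 k).continuous k

lemma mellin_truncRemainder (hE : IsExpansion q C v R e Φ) (h : BlockRegular q C v c R) {s : ℂ}
    (hs : Real.logb q R < s.re) :
    MellinConvergent (truncRemainder q C v R e Φ) (-s) ∧
    DifferentiableAt ℂ (mellin (truncRemainder q C v R e Φ)) (-s) := by
  obtain ⟨a, h1, h2⟩ := exists_between (neg_lt_neg hs)
  have hO := hE.isBigO_truncRemainder h h2
  have h0 : truncRemainder q C v R e Φ =O[𝓝[>] 0] (fun t : ℝ => t ^ (-((-s).re - 1))) :=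
    isBigO_zero_of_indicator one_pos Ioi_subset_Ici_self _
  have hs1 : (-s).re < a := by rw [Complex.neg_re]; exact h1
  exact ⟨mellinConvergent_of_isBigO_rpow hE.locallyIntegrableOn_truncRemainder hO hs1 h0
    (by linarith), (mellin_hasDerivAt_of_isBigO_rpow hE.locallyIntegrableOn_truncRemainder hO hs1 h0
    (by linarith)).2.differentiableAt⟩

lemma analyticAt_mellin_truncRemainder (hE : IsExpansion q C v R e Φ) (h : BlockRegular q C v c R)
    {s : ℂ} (hs : Real.logb q R < s.re) :
    AnalyticAt ℂ (fun s => mellin (truncRemainder q C v R e Φ) (-s)) s := by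
  have ho : IsOpen {s : ℂ | Real.logb q R < s.re} := isOpen_lt continuous_const Complex.continuous_re
  refine DifferentiableOn.analyticAt (s := {s : ℂ | Real.logb q R < s.re}) (fun z hz => ?_)
    (ho.mem_nhds hs)
  exact ((hE.mellin_truncRemainder h hz).2.comp z differentiable_neg.differentiableAt)
    |>.differentiableWithinAt

/-- In the half plane of convergence, `summatoryMellin` is the Mellin transform of the summatory
function. -/
lemma dirichlet_eq (hE : IsExpansion q C v R e Φ) (h : BlockRegular q C v c R)
    (hspec : ∀ μ ∈ eigenvalues C, ‖μ‖ ≤ q * R) {s : ℂ} (hs : Real.logb q R + 1 < s.re) :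
    e ⬝ᵥ v 0 + ∑' n : ℕ, ((n + 1 : ℕ) : ℂ) ^ (-s) * e ⬝ᵥ v (n + 1) =
      s * summatoryMellin q C v R e Φ s := by
  have hq1 : (1 : ℝ) < q := by exact_mod_cast (by have := h.two_le; omega : 1 < q)
  have hR := h.one_le
  rw [h.dirichlet_eq_integral e hs, summatoryMellin]
  congr 1
  have hre : ∀ μ ∈ (eigenvalues C).filter (fun μ => R < ‖μ‖), (clogb q μ).re < s.re := by
    intro μ hμ
    rw [Finset.mem_filter] at hμ
    rw [clogb_re]
    refine lt_of_le_of_lt ?_ hs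
    calc Real.logb q ‖μ‖ ≤ Real.logb q (q * R) :=
          Real.logb_le_logb_of_le hq1 (by linarith) (hspec μ hμ.1)
      _ = _ := by
          rw [Real.logb_mul (by linarith) (by linarith), Real.logb_self_eq_one hq1, add_comm]
  have hfun : ((Ioi (1 : ℝ)).indicator fun t => e ⬝ᵥ vecSum v (⌊t⌋₊ + 1)) = fun t =>
      (∑ μ ∈ (eigenvalues C).filter (fun μ => R < ‖μ‖), ∑ k ∈ Finset.range (maxJordanBlock C μ),
        truncWave q (clogb q μ) (Φ μ k) k t) + truncRemainder q C v R e Φ t := by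
    funext t
    by_cases ht : t ∈ Ioi (1 : ℝ)
    · simp only [truncWave, truncRemainder, indicator_of_mem ht, mainTerm_eq]
      ring
    · simp [truncWave, truncRemainder, indicator_of_notMem ht]
  have hw : ∀ μ ∈ (eigenvalues C).filter (fun μ => R < ‖μ‖), ∀ k,
      MellinConvergent (truncWave q (clogb q μ) (Φ μ k) k) (-s) ∧
      waveMellin q (clogb q μ) (Φ μ k) k s =
        mellin (truncWave q (clogb q μ) (Φ μ k) k) (-s) := by
    intro μ hμ k
    have hf := hE.fluctuation μ (Finset.mem_filter.1 hμ).1 (Finset.mem_filter.1 hμ).2 k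
    exact ⟨(hasDerivAt_mellin_truncWave hf.continuous hf.periodic k (hre μ hμ)).1,
      waveMellin_eq h.two_le hf.continuous hf.periodic k s (hre μ hμ)⟩
  have hs1 := fun μ hμ => hasMellin_sum (Finset.range (maxJordanBlock C μ))
    (f := fun k => truncWave q (clogb q μ) (Φ μ k) k) (z := -s) fun k _ => (hw μ hμ k).1
  have hs2 := hasMellin_sum ((eigenvalues C).filter (fun μ => R < ‖μ‖))
    (f := fun μ t => ∑ k ∈ Finset.range (maxJordanBlock C μ),
        truncWave q (clogb q μ) (Φ μ k) k t) (z := -s) fun μ hμ => (hs1 μ hμ).1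
  rw [hfun, (hasMellin_add hs2.1 (hE.mellin_truncRemainder h (by linarith)).1).2, hs2.2]
  congr 1
  refine Finset.sum_congr rfl fun μ hμ => ?_
  rw [(hs1 μ hμ).2]
  exact Finset.sum_congr rfl fun k _ => (hw μ hμ k).2.symm

lemma ne_zero_of_mem_filter (hR : 0 ≤ R) {μ : ℂ}
    (hμ : μ ∈ (eigenvalues C).filter (fun μ => R < ‖μ‖)) : μ ≠ 0 :=
  norm_pos_iff.1 (hR.trans_lt (Finset.mem_filter.1 hμ).2)

lemma analyticAt_summatoryMellin (hE : IsExpansion q C v R e Φ) (h : BlockRegular q C v c R)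
    {s : ℂ} (hs : Real.logb q R < s.re) (hsC : (q : ℂ) ^ s ∉ spectrum ℂ C) :
    AnalyticAt ℂ (summatoryMellin q C v R e Φ) s := by
  refine AnalyticAt.add ?_ (hE.analyticAt_mellin_truncRemainder h hs)
  refine Finset.analyticAt_fun_sum _ fun μ hμ => Finset.analyticAt_fun_sum _ fun k _ => ?_
  have hμ' := Finset.mem_filter.1 hμ
  refine analyticAt_waveMellin h.two_le (hE.fluctuation μ hμ'.1 hμ'.2 k).continuous k s ?_
  rw [cpow_clogb_self h.two_le (ne_zero_of_mem_filter (by linarith [h.one_le]) hμ)]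
  rintro rfl
  exact hsC (mem_eigenvalues.1 hμ'.1)

/-- A solution of `q ^ s = q ^ κ` differs from `κ` by a multiple of `2 π i / log q`. -/
lemma exists_eq_add_of_cpow_eq (hq : 2 ≤ q) {s κ : ℂ} (h : (q : ℂ) ^ s = (q : ℂ) ^ κ) :
    ∃ l : ℤ, s = κ + 2 * l * Real.pi * Complex.I / (Real.log q : ℂ) := by
  have hq1 : (1 : ℝ) < q := by exact_mod_cast (by omega : 1 < q)
  have hlog : (Real.log q : ℂ) ≠ 0 := by exact_mod_cast (Real.log_pos hq1).ne'
  have hq0 := natCast_ne_zero_of_two_le hq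
  rw [Complex.cpow_def_of_ne_zero hq0, Complex.cpow_def_of_ne_zero hq0, Complex.exp_eq_exp_iff_exists_int,
    ← Complex.natCast_log] at h
  obtain ⟨l, hl⟩ := h
  refine ⟨l, ?_⟩
  field_simp
  linear_combination hl

lemma meromorphicAt_summatoryMellin (hE : IsExpansion q C v R e Φ) (h : BlockRegular q C v c R)
    {s : ℂ} (hs : Real.logb q R < s.re) : MeromorphicAt (summatoryMellin q C v R e Φ) s := by
  refine MeromorphicAt.add ?_ (hE.analyticAt_mellin_truncRemainder h hs).meromorphicAt
  refine MeromorphicAt.fun_sum fun μ hμ => MeromorphicAt.fun_sum fun k _ => ?_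
  have hμ' := Finset.mem_filter.1 hμ
  have hf := hE.fluctuation μ hμ'.1 hμ'.2 k
  by_cases hsμ : (q : ℂ) ^ s = (q : ℂ) ^ clogb q μ
  · obtain ⟨l, rfl⟩ := exists_eq_add_of_cpow_eq h.two_le hsμ
    exact (hasPolarTerm_waveMellin h.two_le hf.continuous hf.periodic l k).meromorphicAt
  · exact (analyticAt_waveMellin h.two_le hf.continuous k s hsμ).meromorphicAt

/-- At `log_q μ + 2 π i l / log q` only the main terms for `μ` are singular. -/
lemma exists_polar_part (hE : IsExpansion q C v R e Φ) (h : BlockRegular q C v c R)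
    {μ : ℂ} (hμC : μ ∈ eigenvalues C) (hμ : R < ‖μ‖) (l : ℤ) :
    ∃ H : ℂ → ℂ, AnalyticAt ℂ H (polePoint q μ l) ∧
      summatoryMellin q C v R e Φ =ᶠ[𝓝[≠] polePoint q μ l] fun s =>
        ∑ k ∈ Finset.range (maxJordanBlock C μ), ((k.factorial : ℂ) / (Real.log q : ℂ) ^ k *
          ∫ u in (0 : ℝ)..1, Φ μ k u * Complex.exp (-(2 * l * Real.pi * Complex.I * u))) /
            (s - polePoint q μ l) ^ (k + 1) + H s := by
  classical
  have hq := h.two_le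
  have hR := h.one_le
  have hq1 : (1 : ℝ) < q := by exact_mod_cast (by omega : 1 < q)
  have hre : Real.logb q R < (polePoint q μ l).re := by
    rw [polePoint_re]
    exact Real.logb_lt_logb hq1 (by linarith) hμ
  have hf := fun k => hE.fluctuation μ hμC hμ k
  have hpol := fun k => hasPolarTerm_waveMellin (κ := clogb q μ) hq (hf k).continuous
    (hf k).periodic l k
  choose g hg hgeq using hpol
  have hmem : μ ∈ (eigenvalues C).filter (fun μ => R < ‖μ‖) := Finset.mem_filter.2 ⟨hμC, hμ⟩
  refine ⟨fun s => ∑ k ∈ Finset.range (maxJordanBlock C μ), g k s +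
    ∑ ν ∈ ((eigenvalues C).filter (fun μ => R < ‖μ‖)).erase μ,
      ∑ k ∈ Finset.range (maxJordanBlock C ν), waveMellin q (clogb q ν) (Φ ν k) k s +
    mellin (truncRemainder q C v R e Φ) (-s), ?_, ?_⟩
  · refine AnalyticAt.add (AnalyticAt.add (Finset.analyticAt_fun_sum _ fun k _ => hg k)
      (Finset.analyticAt_fun_sum _ fun ν hν => Finset.analyticAt_fun_sum _ fun k _ => ?_))
      (hE.analyticAt_mellin_truncRemainder h hre)
    have hν' := Finset.mem_filter.1 (Finset.mem_of_mem_erase hν)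
    refine analyticAt_waveMellin hq (hE.fluctuation ν hν'.1 hν'.2 k).continuous k _ ?_
    rw [polePoint, cpow_add_pole hq, cpow_clogb_self hq (ne_zero_of_mem_filter (by linarith) hmem),
      cpow_clogb_self hq (ne_zero_of_mem_filter (by linarith) (Finset.mem_of_mem_erase hν))]
    exact (Finset.ne_of_mem_erase hν).symm
  · have hall := (Finset.eventually_all (Finset.range (maxJordanBlock C μ))).2
      fun k _ => hgeq k
    filter_upwards [hall] with s hs
    rw [summatoryMellin, ← Finset.add_sum_erase _ _ hmem, Finset.sum_congr rfl hs,
      Finset.sum_add_distrib]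
    simp only [polePoint]
    ring

end IsExpansion

end QRegular

namespace QRegular

open Set

/-! ### Binomial coefficients with complex upper argument -/

lemma choose_succ_mul (s : ℂ) (k : ℕ) :
    Ring.choose s (k + 1) * (k + 1) = Ring.choose s k * (s - k) := by
  rw [Ring.choose_eq_smul, Ring.choose_eq_smul, descPochhammer_succ_right, Polynomial.smeval_mul,
    Polynomial.smeval_sub, Polynomial.smeval_X, Polynomial.smeval_natCast, Nat.factorial_succ]
  have h1 : (k.factorial : ℂ) ≠ 0 := by exact_mod_cast k.factorial_ne_zero
  have h2 : (k + 1 : ℂ) ≠ 0 := by exact_mod_cast k.succ_ne_zero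
  simp only [smul_eq_mul, pow_one, pow_zero, nsmul_eq_mul, mul_one]
  push_cast
  field_simp

lemma choose_succ_eq (s : ℂ) (k : ℕ) :
    Ring.choose s (k + 1) = Ring.choose s k * (s - k) / (k + 1) := by
  have h2 : (k + 1 : ℂ) ≠ 0 := by exact_mod_cast k.succ_ne_zero
  rw [eq_div_iff h2, choose_succ_mul]

lemma differentiable_choose (k : ℕ) : Differentiable ℂ fun s : ℂ => Ring.choose s k := by
  induction k with
  | zero => simp
  | succ k ih =>
    simp_rw [choose_succ_eq]
    exact (ih.mul (differentiable_id.sub_const _)).div_const _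

/-- The bound `∏_{j < k} (S + j) / (j + 1)` for `|binom(-s, k)|` on the disk `|s| ≤ S`. -/
noncomputable def chooseBound (S : ℝ) (k : ℕ) : ℝ := ∏ j ∈ Finset.range k, (S + j) / (j + 1)

lemma chooseBound_nonneg {S : ℝ} (hS : 0 ≤ S) (k : ℕ) : 0 ≤ chooseBound S k :=
  Finset.prod_nonneg fun _ _ => by positivity

lemma norm_choose_neg_le {s : ℂ} {S : ℝ} (hs : ‖s‖ ≤ S) (k : ℕ) :
    ‖Ring.choose (-s) k‖ ≤ chooseBound S k := by
  induction k with
  | zero => simp [chooseBound]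
  | succ k ih =>
    rw [choose_succ_eq, norm_div, norm_mul, chooseBound, Finset.prod_range_succ, mul_div_assoc]
    have h1 : ‖(k + 1 : ℂ)‖ = k + 1 := by
      rw [← Nat.cast_add_one, Complex.norm_natCast]; push_cast; rfl
    rw [h1]
    refine mul_le_mul ih ?_ (by positivity) (chooseBound_nonneg ((norm_nonneg _).trans hs) k)
    gcongr
    calc ‖-s - k‖ ≤ ‖-s‖ + ‖(k : ℂ)‖ := norm_sub_le _ _
      _ ≤ S + k := by rw [norm_neg, Complex.norm_natCast]; gcongr

lemma summable_chooseBound {S : ℝ} (hS : 0 ≤ S) {τ : ℝ} (hτ0 : 0 ≤ τ) (hτ : τ < 1) :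
    Summable fun k => chooseBound S k * τ ^ k := by
  obtain ⟨r, h1, h2⟩ := exists_between hτ
  refine summable_of_ratio_norm_eventually_le h2 ?_
  filter_upwards [eventually_ge_atTop ⌈S * τ / (r - τ)⌉₊] with k hk
  have hk' : S * τ / (r - τ) ≤ k := Nat.ceil_le.1 hk
  rw [div_le_iff₀ (by linarith)] at hk'
  have hc := chooseBound_nonneg hS
  rw [Real.norm_of_nonneg (mul_nonneg (hc _) (by positivity)),
    Real.norm_of_nonneg (mul_nonneg (hc _) (by positivity)),
    show chooseBound S (k + 1) * τ ^ (k + 1) =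
      ((S + k) / (k + 1) * τ) * (chooseBound S k * τ ^ k) by
      rw [chooseBound, Finset.prod_range_succ, ← chooseBound]; ring]
  refine mul_le_mul_of_nonneg_right ?_ (mul_nonneg (hc _) (by positivity))
  rw [div_mul_eq_mul_div, div_le_iff₀ (by positivity)]
  nlinarith

lemma hasSum_choose_mul_pow (a : ℂ) {z : ℂ} (hz : ‖z‖ < 1) :
    HasSum (fun k => Ring.choose a k * z ^ k) ((1 + z) ^ a) := by
  have := (Complex.one_add_cpow_hasFPowerSeriesOnBall_zero (a := a)).hasSum (y := z) (by
    rw [Metric.mem_eball, edist_zero_right]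
    rw [← ofReal_norm]
    exact ENNReal.ofReal_lt_one.2 hz)
  simpa [binomialSeries, mul_comm] using this

/-! ### Series of functions on a right half plane -/

/-- The series `∑ f n` has a convergent majorant on every set
`{s | a + δ ≤ Re s, |s| ≤ S}` with `δ > 0`. -/
def HasLocalMajorants {E : Type*} [NormedAddCommGroup E] (f : ℕ → ℂ → E) (a : ℝ) : Prop :=
  ∀ δ > 0, ∀ S : ℝ, ∃ u : ℕ → ℝ, Summable u ∧ ∀ n s, a + δ ≤ s.re → ‖s‖ ≤ S → ‖f n s‖ ≤ u n

namespace HasLocalMajorants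

variable {E : Type*} [NormedAddCommGroup E] {f : ℕ → ℂ → E} {a : ℝ}

lemma summable_norm (hf : HasLocalMajorants f a) {s : ℂ} (hs : a < s.re) :
    Summable fun n => ‖f n s‖ := by
  obtain ⟨u, hu, h⟩ := hf (s.re - a) (by linarith) ‖s‖
  exact Summable.of_nonneg_of_le (fun _ => norm_nonneg _) (fun n => h n s (by linarith) le_rfl) hu

lemma convergesAbsUnifOnCompacts (hf : HasLocalMajorants f a) :
    ConvergesAbsUnifOnCompacts f {s : ℂ | a < s.re} := by
  refine ⟨fun s hs => hf.summable_norm hs, fun K hK hKc => ?_⟩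
  rcases K.eq_empty_or_nonempty with rfl | hne
  · exact tendstoUniformlyOn_empty
  obtain ⟨z, hz, hzmin⟩ := hKc.exists_isMinOn hne Complex.continuous_re.continuousOn
  obtain ⟨S, hS⟩ := hKc.isBounded.exists_norm_le
  have hza : a < z.re := hK hz
  obtain ⟨u, hu, h⟩ := hf (z.re - a) (by linarith) S
  refine tendstoUniformlyOn_tsum_nat hu fun n s hs => ?_
  rw [norm_norm]
  have : z.re ≤ s.re := hzmin hs
  exact h n s (by linarith) (hS s hs)

lemma differentiableAt_tsum [NormedSpace ℂ E] [CompleteSpace E] (hf : HasLocalMajorants f a)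
    (hd : ∀ n, DifferentiableOn ℂ (f n) {s : ℂ | a < s.re}) {s : ℂ} (hs : a < s.re) :
    DifferentiableAt ℂ (fun s => ∑' n, f n s) s := by
  obtain ⟨b, h1, h2⟩ := exists_between hs
  obtain ⟨u, hu, h⟩ := hf (b - a) (by linarith) (‖s‖ + 1)
  have ho : IsOpen {z : ℂ | b < z.re ∧ ‖z‖ < ‖s‖ + 1} :=
    (isOpen_lt continuous_const Complex.continuous_re).inter
      (isOpen_lt continuous_norm continuous_const)
  refine (Complex.differentiableOn_tsum_of_summable_norm hu (fun n => (hd n).mono fun z hz => ?_) ho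
    fun n z hz => h n z (by linarith [hz.1]) hz.2.le).differentiableAt
    (ho.mem_nhds ⟨h2, by linarith⟩)
  exact h1.trans hz.1

end HasLocalMajorants

/-! ### The Dirichlet series in its half plane of convergence -/

/-- The Dirichlet series `∑_{n ≥ 1} n ^ (-s) v n`. -/
noncomputable def dirichletSum {d : ℕ} (v : ℕ → Fin d → ℂ) (s : ℂ) : Fin d → ℂ :=
  ∑' n, dirichletTerm v n s

section Dirichlet

variable {q d : ℕ} {v : ℕ → Fin d → ℂ} {B ρ : ℝ}

lemma norm_dirichletTerm_le (hB : 0 ≤ B) (hv : ∀ n : ℕ, 1 ≤ n → ‖v n‖ ≤ B * (n : ℝ) ^ ρ)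
    {δ : ℝ} {s : ℂ} (hs : ρ + 1 + δ ≤ s.re) (n : ℕ) :
    ‖dirichletTerm v n s‖ ≤ B * ((n + 1 : ℕ) : ℝ) ^ (-(1 + δ)) := by
  have hn : (1 : ℝ) ≤ ((n + 1 : ℕ) : ℝ) := by exact_mod_cast Nat.succ_pos n
  rw [dirichletTerm, norm_smul, Complex.norm_natCast_cpow_of_pos (Nat.succ_pos n), Complex.neg_re]
  calc _ ≤ ((n + 1 : ℕ) : ℝ) ^ (-s.re) * (B * ((n + 1 : ℕ) : ℝ) ^ ρ) := by
        gcongr; exact hv _ (Nat.succ_pos n)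
    _ = B * ((n + 1 : ℕ) : ℝ) ^ (-s.re + ρ) := by
        rw [Real.rpow_add (by linarith)]; ring
    _ ≤ _ := by
        gcongr
        linarith

lemma summable_majorant (B : ℝ) {δ : ℝ} (hδ : 0 < δ) :
    Summable fun n : ℕ => B * ((n + 1 : ℕ) : ℝ) ^ (-(1 + δ)) := by
  refine Summable.mul_left _ ?_
  exact (summable_nat_add_iff (f := fun n : ℕ => (n : ℝ) ^ (-(1 + δ))) 1).2
    (Real.summable_nat_rpow.2 (by linarith))

lemma hasLocalMajorants_dirichletTerm (hB : 0 ≤ B)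
    (hv : ∀ n : ℕ, 1 ≤ n → ‖v n‖ ≤ B * (n : ℝ) ^ ρ) :
    HasLocalMajorants (dirichletTerm v) (ρ + 1) := fun _ hδ _ =>
  ⟨_, summable_majorant B hδ, fun n _ hs _ => norm_dirichletTerm_le hB hv hs n⟩

lemma differentiable_dirichletTerm (n : ℕ) : Differentiable ℂ (dirichletTerm v n) := by
  have hn : ((n + 1 : ℕ) : ℂ) ≠ 0 := by exact_mod_cast n.succ_ne_zero
  exact fun s => (differentiableAt_id.neg.const_cpow (Or.inl hn)).smul_const _

lemma differentiableAt_dirichletSum (hB : 0 ≤ B)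
    (hv : ∀ n : ℕ, 1 ≤ n → ‖v n‖ ≤ B * (n : ℝ) ^ ρ) {s : ℂ} (hs : ρ + 1 < s.re) :
    DifferentiableAt ℂ (dirichletSum v) s :=
  (hasLocalMajorants_dirichletTerm hB hv).differentiableAt_tsum
    (fun n => (differentiable_dirichletTerm n).differentiableOn) hs

lemma exists_norm_dirichletSum_le (hB : 0 ≤ B)
    (hv : ∀ n : ℕ, 1 ≤ n → ‖v n‖ ≤ B * (n : ℝ) ^ ρ) {δ : ℝ} (hδ : 0 < δ) :
    ∃ K : ℝ, 0 ≤ K ∧ ∀ s : ℂ, ρ + 1 + δ ≤ s.re → ‖dirichletSum v s‖ ≤ K := by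
  refine ⟨∑' n : ℕ, B * ((n + 1 : ℕ) : ℝ) ^ (-(1 + δ)), tsum_nonneg fun n => by positivity,
    fun s hs => ?_⟩
  exact tsum_of_norm_bounded (summable_majorant B hδ).hasSum
    fun n => norm_dirichletTerm_le hB hv hs n

lemma hasLocalMajorants_shiftTerm (hB : 0 ≤ B)
    (hv : ∀ n : ℕ, 1 ≤ n → ‖v n‖ ≤ B * (n : ℝ) ^ ρ) {t : ℂ} (ht : ‖t‖ < 1) :
    HasLocalMajorants (shiftTerm (dirichletSum v) t) ρ := by
  intro δ hδ S
  obtain ⟨K, hK, hb⟩ := exists_norm_dirichletSum_le hB hv hδ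
  refine ⟨fun k => chooseBound (max S 0) (k + 1) * ‖t‖ ^ (k + 1) * K, ?_, fun k s hs hsS => ?_⟩
  · exact ((summable_nat_add_iff 1).2
      (summable_chooseBound (le_max_right S 0) (norm_nonneg t) ht)).mul_right K
  · rw [shiftTerm, norm_smul, norm_mul, norm_pow]
    refine mul_le_mul (mul_le_mul_of_nonneg_right
      (norm_choose_neg_le (hsS.trans (le_max_left _ _)) _) (by positivity)) (hb _ ?_)
      (norm_nonneg _) (mul_nonneg (chooseBound_nonneg (le_max_right _ _) _) (by positivity))
    rw [Complex.add_re, Complex.natCast_re]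
    push_cast
    have : (0 : ℝ) ≤ k := k.cast_nonneg
    linarith

lemma differentiableAt_tsum_shiftTerm (hB : 0 ≤ B)
    (hv : ∀ n : ℕ, 1 ≤ n → ‖v n‖ ≤ B * (n : ℝ) ^ ρ) {t : ℂ} (ht : ‖t‖ < 1) {s : ℂ}
    (hs : ρ < s.re) :
    DifferentiableAt ℂ (fun s => ∑' k, shiftTerm (dirichletSum v) t k s) s := by
  refine (hasLocalMajorants_shiftTerm hB hv ht).differentiableAt_tsum (fun k z hz => ?_) hs
  have hz' : ρ + 1 < (z + ((k + 1 : ℕ) : ℂ)).re := by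
    have hz1 : ρ < z.re := hz
    have : (0 : ℝ) ≤ k := k.cast_nonneg
    rw [Complex.add_re, Complex.natCast_re]
    push_cast
    linarith
  refine DifferentiableAt.differentiableWithinAt (DifferentiableAt.fun_smul ?_ ?_)
  · exact (((differentiable_choose (k + 1)).comp differentiable_neg) z).mul_const _
  · exact DifferentiableAt.comp z (differentiableAt_dirichletSum hB hv hz')
      (differentiableAt_id.add_const _)

lemma cpow_mul_add (hq : 2 ≤ q) (n r : ℕ) (s : ℂ) :
    ((q * (n + 1) + r : ℕ) : ℂ) ^ (-s) = (q : ℂ) ^ (-s) * (((n + 1 : ℕ) : ℂ) ^ (-s) *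
      (1 + (r : ℂ) / (q : ℂ) / ((n + 1 : ℕ) : ℂ)) ^ (-s)) := by
  have hq0 := natCast_ne_zero_of_two_le hq
  have hn : ((n + 1 : ℕ) : ℂ) ≠ 0 := by exact_mod_cast n.succ_ne_zero
  have e : (1 + (r : ℂ) / (q : ℂ) / ((n + 1 : ℕ) : ℂ)) =
      ((1 + (r : ℝ) / q / ((n + 1 : ℕ) : ℝ) : ℝ) : ℂ) := by push_cast; rfl
  rw [e, ← Complex.ofReal_natCast (n + 1), ← Complex.mul_cpow_ofReal_nonneg (by positivity)
    (by positivity), ← Complex.ofReal_mul, ← Complex.ofReal_natCast q,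
    ← Complex.mul_cpow_ofReal_nonneg (by positivity) (by positivity)]
  congr 1
  push_cast at hn ⊢
  field_simp

/-- Expanding `(1 + r / (q n)) ^ (-s)` into its binomial series and interchanging the sums. -/
lemma hasSum_residue_class (hq : 2 ≤ q) (hB : 0 ≤ B)
    (hv : ∀ n : ℕ, 1 ≤ n → ‖v n‖ ≤ B * (n : ℝ) ^ ρ) {r : ℕ} (hr : r < q) {s : ℂ}
    (hs : ρ + 1 < s.re) :
    HasSum (fun n : ℕ => (((n + 1 : ℕ) : ℂ) ^ (-s) *
        (1 + (r : ℂ) / (q : ℂ) / ((n + 1 : ℕ) : ℂ)) ^ (-s)) • v (n + 1))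
      (dirichletSum v s + ∑' k, shiftTerm (dirichletSum v) ((r : ℂ) / (q : ℂ)) k s) := by
  have hq0 : (0 : ℝ) < q := by positivity
  set t : ℂ := (r : ℂ) / (q : ℂ) with ht
  have htn : ‖t‖ < 1 := by
    rw [ht, norm_div, Complex.norm_natCast, Complex.norm_natCast, div_lt_one hq0]
    exact_mod_cast hr
  set δ := s.re - (ρ + 1) with hδ
  have hδ0 : 0 < δ := by linarith
  set F : ℕ → ℕ → Fin d → ℂ := fun n k =>
    (Ring.choose (-s) (k + 1) * t ^ (k + 1)) • dirichletTerm v n (s + ((k + 1 : ℕ) : ℂ)) with hF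
  have hterm : ∀ n k : ℕ, ‖dirichletTerm v n (s + ((k + 1 : ℕ) : ℂ))‖ ≤
      B * ((n + 1 : ℕ) : ℝ) ^ (-(1 + δ)) := fun n k => by
    refine norm_dirichletTerm_le hB hv ?_ n
    rw [Complex.add_re, Complex.natCast_re]
    have : (0 : ℝ) ≤ ((k + 1 : ℕ) : ℝ) := Nat.cast_nonneg _
    linarith
  have hsumF : Summable (Function.uncurry F) := by
    have h1 := (summable_nat_add_iff 1).2 (summable_chooseBound (norm_nonneg s) (norm_nonneg t) htn)
    have h2 := summable_majorant B hδ0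
    refine Summable.of_norm_bounded (h2.mul_of_nonneg h1 (fun n => by positivity)
      (fun k => mul_nonneg (chooseBound_nonneg (norm_nonneg _) _) (by positivity))) ?_
    rintro ⟨n, k⟩
    simp only [Function.uncurry, hF]
    rw [norm_smul, norm_mul, norm_pow, mul_comm]
    exact mul_le_mul (hterm n k) (mul_le_mul_of_nonneg_right (norm_choose_neg_le le_rfl _)
      (by positivity)) (by positivity) (by positivity)
  have hrow : ∀ n : ℕ, HasSum (F n) ((((n + 1 : ℕ) : ℂ) ^ (-s) *
      (1 + t / ((n + 1 : ℕ) : ℂ)) ^ (-s)) • v (n + 1) - dirichletTerm v n s) := by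
    intro n
    have hn : ((n + 1 : ℕ) : ℂ) ≠ 0 := by exact_mod_cast n.succ_ne_zero
    have hn1 : (1 : ℝ) ≤ ((n + 1 : ℕ) : ℝ) := by exact_mod_cast Nat.succ_pos n
    have hz : ‖t / ((n + 1 : ℕ) : ℂ)‖ < 1 := by
      rw [norm_div, Complex.norm_natCast]
      exact (div_le_self (norm_nonneg _) hn1).trans_lt htn
    have h1 := (hasSum_nat_add_iff' 1).2 (hasSum_choose_mul_pow (-s) hz)
    have h2 := (h1.mul_left (((n + 1 : ℕ) : ℂ) ^ (-s))).smul_const (v (n + 1))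
    convert h2 using 1
    · funext k
      simp only [hF, dirichletTerm]
      rw [smul_smul, neg_add, Complex.cpow_add _ _ hn, Complex.cpow_neg _ ((k + 1 : ℕ) : ℂ),
        Complex.cpow_natCast, div_pow]
      congr 1
      ring
    · rw [Finset.sum_range_one, Ring.choose_zero_right, pow_zero, mul_one, mul_sub, mul_one, sub_smul,
        dirichletTerm]
  have hcol : ∀ k, ∑' n, F n k = shiftTerm (dirichletSum v) t k s := by
    intro k
    simp only [hF, shiftTerm, dirichletSum]
    refine Summable.tsum_const_smul _ ?_
    exact Summable.of_norm_bounded (summable_majorant B hδ0) fun n => hterm n k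
  have hD : HasSum (fun n => dirichletTerm v n s) (dirichletSum v s) :=
    ((hasLocalMajorants_dirichletTerm hB hv).summable_norm hs).of_norm.hasSum
  have hF1 : HasSum (fun n => ∑' k, F n k) (∑' k, shiftTerm (dirichletSum v) t k s) := by
    rw [← tsum_congr hcol, hsumF.tsum_comm]
    exact hsumF.prod.hasSum
  convert hD.add hF1 using 1
  funext n
  rw [(hrow n).tsum_eq, add_sub_cancel]

end Dirichlet

end QRegular

namespace QRegular

open Set

/-! ### The functional equation -/

section FunctionalEquation

variable {q d : ℕ} {v : ℕ → Fin d → ℂ} {B ρ : ℝ} {A : Fin q → Matrix (Fin d) (Fin d) ℂ}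

/-- Splitting the Dirichlet series into residue classes modulo `q`. -/
lemma dirichletSum_eq (hq : 2 ≤ q) (hρ : 0 ≤ ρ) (hB : 0 ≤ B)
    (hv : ∀ n : ℕ, 1 ≤ n → ‖v n‖ ≤ B * (n : ℝ) ^ ρ)
    (hrec : ∀ (n : ℕ) (r : Fin q), v (q * n + r) = A r *ᵥ v n) {s : ℂ} (hs : ρ + 1 < s.re) :
    dirichletSum v s = ∑ n ∈ Finset.Ico 1 q, (n : ℂ) ^ (-s) • v n +
      (q : ℂ) ^ (-s) • ∑ r : Fin q, A r *ᵥ (dirichletSum v s +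
        ∑' k, shiftTerm (dirichletSum v) (((r : ℕ) : ℂ) / (q : ℂ)) k s) := by
  have : NeZero q := ⟨by omega⟩
  have hs0 : s ≠ 0 := Complex.ne_zero_of_re_pos (by linarith)
  set g : ℕ → Fin d → ℂ := fun n => (n : ℂ) ^ (-s) • v n with hg
  have hg0 : g 0 = 0 := by
    simp only [hg]
    rw [Nat.cast_zero, Complex.zero_cpow (neg_ne_zero.2 hs0), zero_smul]
  have hsum1 : Summable fun n => g (n + 1) :=
    ((hasLocalMajorants_dirichletTerm hB hv).summable_norm hs).of_norm
  have hsum : Summable g := (summable_nat_add_iff 1).1 hsum1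
  have hD : dirichletSum v s = ∑' n, g n := by
    rw [hsum.tsum_eq_zero_add, hg0, zero_add]; rfl
  have hr : ∀ r : Fin q, HasSum (fun n => g (q * (n + 1) + r)) ((q : ℂ) ^ (-s) • A r *ᵥ
      (dirichletSum v s + ∑' k, shiftTerm (dirichletSum v) (((r : ℕ) : ℂ) / (q : ℂ)) k s)) := by
    intro r
    have h1 := (ContinuousLinearMap.hasSum (Matrix.mulVecLin (A r)).toContinuousLinearMap
      (hasSum_residue_class hq hB hv r.2 hs)).const_smul ((q : ℂ) ^ (-s))
    refine HasSum.congr_fun h1 fun n => ?_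
    simp only [hg]
    rw [cpow_mul_add hq, hrec, mul_smul, LinearMap.coe_toContinuousLinearMap', Matrix.mulVecLin_apply,
      Matrix.mulVec_smul]
  have hprod : Summable fun p : ℕ × Fin q => g (q * p.1 + p.2) := by
    have := (Nat.divModEquiv q).symm.summable_iff.2 hsum
    refine this.congr fun p => ?_
    simp [mul_comm]
  have hall : ∑' n, g n = ∑' n, ∑ r : Fin q, g (q * n + r) := by
    rw [← (Nat.divModEquiv q).symm.tsum_eq g]
    simp only [Nat.divModEquiv_symm_apply, mul_comm _ q]
    rw [hprod.tsum_prod]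
    exact tsum_congr fun n => tsum_fintype _
  have hrows : Summable fun n => ∑ r : Fin q, g (q * n + r) := by
    refine hprod.prod.congr fun n => ?_
    exact tsum_fintype _
  have hsplit : dirichletSum v s = ∑ r : Fin q, g (q * 0 + r) +
      ∑' n, ∑ r : Fin q, g (q * (n + 1) + r) := by
    rw [hD, hall, hrows.tsum_eq_zero_add]
  refine hsplit.trans ?_
  rw [Finset.smul_sum]
  congr 1
  · simp only [mul_zero, zero_add]
    rw [Fin.sum_univ_eq_sum_range g q, Finset.range_eq_Ico, Finset.sum_eq_sum_Ico_succ_bot (by omega),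
      hg0, zero_add]
  · exact (hasSum_sum fun r _ => hr r).tsum_eq

lemma meromorphicAt_clm_comp {E F : Type*} [NormedAddCommGroup E] [NormedSpace ℂ E]
    [NormedAddCommGroup F] [NormedSpace ℂ F] (L : E →L[ℂ] F) {f : ℂ → E} {x : ℂ}
    (hf : MeromorphicAt f x) : MeromorphicAt (fun z => L (f z)) x := by
  obtain ⟨n, hn⟩ := hf
  refine ⟨n, ?_⟩
  simpa only [Function.comp_def, map_smul] using (L.analyticAt _).comp hn

/-- The identity theorem for meromorphic functions. -/
lemma eq_zero_of_eventuallyEq_zero {E : Type*} [NormedAddCommGroup E] [NormedSpace ℂ E] {F : ℂ → E}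
    {U : Set ℂ} (hF : MeromorphicOn F U) (hU : IsPreconnected U) {x : ℂ} (hx : x ∈ U)
    (h0 : ∀ᶠ z in 𝓝 x, F z = 0) {s : ℂ} (hs : s ∈ U) (ha : AnalyticAt ℂ F s) : F s = 0 := by
  have hx' : meromorphicOrderAt F x = ⊤ :=
    meromorphicOrderAt_eq_top_iff.2 (h0.filter_mono nhdsWithin_le_nhds)
  have hs' : meromorphicOrderAt F s = ⊤ := by
    by_contra hne
    exact hF.meromorphicOrderAt_ne_top_of_isPreconnected hU hs hx hne hx'
  have h1 := meromorphicOrderAt_eq_top_iff.1 hs'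
  exact (ha.frequently_zero_iff_eventually_zero.1 h1.frequently).self_of_nhds

/-- The functional equation persists on the half plane of meromorphic continuation, by the identity
theorem. The shifted arguments `s + k` lie in the half plane of convergence. -/
lemma functional_equation (hq : 2 ≤ q) (hρ : 0 ≤ ρ) (hB : 0 ≤ B)
    (hv : ∀ n : ℕ, 1 ≤ n → ‖v n‖ ≤ B * (n : ℝ) ^ ρ)
    (hrec : ∀ (n : ℕ) (r : Fin q), v (q * n + r) = A r *ᵥ v n) {V : ℂ → Fin d → ℂ}
    (hV : MeromorphicOn V {s : ℂ | ρ < s.re})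
    (hVD : ∀ s : ℂ, ρ + 1 < s.re → V s = dirichletSum v s) {s : ℂ} (hs : ρ < s.re)
    (ha : AnalyticAt ℂ V s) :
    (1 - (q : ℂ) ^ (-s) • ∑ r, A r) *ᵥ V s = ∑ n ∈ Finset.Ico 1 q, (n : ℂ) ^ (-s) • v n +
      (q : ℂ) ^ (-s) • ∑ r : Fin q,
        A r *ᵥ ∑' k, shiftTerm (dirichletSum v) (((r : ℕ) : ℂ) / (q : ℂ)) k s := by
  have hq0 := natCast_ne_zero_of_two_le hq
  have ho : IsOpen {s : ℂ | ρ < s.re} := isOpen_lt continuous_const Complex.continuous_re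
  set G : ℂ → Fin d → ℂ := fun s => ∑ n ∈ Finset.Ico 1 q, (n : ℂ) ^ (-s) • v n +
      (q : ℂ) ^ (-s) • ∑ r : Fin q,
        A r *ᵥ ∑' k, shiftTerm (dirichletSum v) (((r : ℕ) : ℂ) / (q : ℂ)) k s with hG
  have hmul : ∀ (M : Matrix (Fin d) (Fin d) ℂ) {f : ℂ → Fin d → ℂ} {s : ℂ}, AnalyticAt ℂ f s →
      AnalyticAt ℂ (fun s => M *ᵥ f s) s := fun M f s hf =>
    (Matrix.mulVecLin M).toContinuousLinearMap.analyticAt _ |>.comp hf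
  have hcpow : ∀ {n : ℕ}, (n : ℂ) ≠ 0 → ∀ s, AnalyticAt ℂ (fun s : ℂ => (n : ℂ) ^ (-s)) s := by
    intro n hn s
    have : Differentiable ℂ fun s : ℂ => (n : ℂ) ^ (-s) := fun s =>
      differentiableAt_id.neg.const_cpow (Or.inl hn)
    exact this.analyticAt s
  have hGa : ∀ s : ℂ, ρ < s.re → AnalyticAt ℂ G s := by
    intro s hs
    refine AnalyticAt.add (Finset.analyticAt_fun_sum _ fun n hn => ?_) (AnalyticAt.smul
      (hcpow hq0 s) (Finset.analyticAt_fun_sum _ fun r _ => hmul _ ?_))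
    · have hn0 : (n : ℂ) ≠ 0 := by
        have := (Finset.mem_Ico.1 hn).1
        exact_mod_cast (by omega : n ≠ 0)
      exact (hcpow hn0 s).smul analyticAt_const
    · have htr : ‖((r : ℕ) : ℂ) / (q : ℂ)‖ < 1 := by
        rw [norm_div, Complex.norm_natCast, Complex.norm_natCast,
          div_lt_one (by positivity)]
        exact_mod_cast r.2
      exact DifferentiableOn.analyticAt (s := {s : ℂ | ρ < s.re}) (fun z hz =>
        (differentiableAt_tsum_shiftTerm hB hv htr hz).differentiableWithinAt) (ho.mem_nhds hs)
  have hrw : ∀ s : ℂ, (1 - (q : ℂ) ^ (-s) • ∑ r, A r) *ᵥ V s =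
      V s - (q : ℂ) ^ (-s) • ((∑ r, A r) *ᵥ V s) := by
    intro s
    rw [Matrix.sub_mulVec, Matrix.one_mulVec, Matrix.smul_mulVec]
  set F : ℂ → Fin d → ℂ := fun s => V s - (q : ℂ) ^ (-s) • ((∑ r, A r) *ᵥ V s) - G s with hF
  have hFmer : MeromorphicOn F {s : ℂ | ρ < s.re} := by
    intro z hz
    exact MeromorphicAt.sub (MeromorphicAt.sub (hV z hz) (MeromorphicAt.smul
      (hcpow hq0 z).meromorphicAt (meromorphicAt_clm_comp
        (Matrix.mulVecLin (∑ r, A r)).toContinuousLinearMap (hV z hz)))) (hGa z hz).meromorphicAt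
  have hx : ((ρ + 2 : ℝ) : ℂ) ∈ {s : ℂ | ρ < s.re} := by simp
  have hF0 : ∀ᶠ z in 𝓝 ((ρ + 2 : ℝ) : ℂ), F z = 0 := by
    have ho1 : IsOpen {s : ℂ | ρ + 1 < s.re} := isOpen_lt continuous_const Complex.continuous_re
    filter_upwards [ho1.mem_nhds (show ((ρ + 2 : ℝ) : ℂ) ∈ {s : ℂ | ρ + 1 < s.re} by simp)]
      with z hz
    have := dirichletSum_eq hq hρ hB hv hrec hz
    simp only [hF, hG, hVD z hz]
    simp only [Matrix.mulVec_add, Finset.sum_add_distrib, smul_add, ← Matrix.sum_mulVec] at this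
    rw [sub_sub, sub_eq_zero]
    exact this.trans (by abel)
  have hpre : IsPreconnected {s : ℂ | ρ < s.re} := (convex_halfSpace_re_gt ρ).isPreconnected
  have := eq_zero_of_eventuallyEq_zero hFmer hpre hx hF0 hs
    ((ha.sub ((hcpow hq0 s).smul (hmul _ ha))).sub (hGa s hs))
  rw [hrw]
  exact sub_eq_zero.1 this

end FunctionalEquation

end QRegular

namespace QRegular

open Set

variable {q d : ℕ} {C : Matrix (Fin d) (Fin d) ℂ} {v : ℕ → Fin d → ℂ} {c R : ℝ}

/-! ### The meromorphic continuation of the Dirichlet series -/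

/-- The components `s * Y i s - v 0 i`, where `Y i` continues the Mellin transform of the summatory
function of the `i`-th component. -/
noncomputable def continuation (q : ℕ) (C : Matrix (Fin d) (Fin d) ℂ) (v : ℕ → Fin d → ℂ) (R : ℝ)
    (Φ : Fin d → ℂ → ℕ → ℝ → ℂ) (s : ℂ) : Fin d → ℂ :=
  fun i => s * summatoryMellin q C v R (Pi.single i 1) (Φ i) s - v 0 i

section Continuation

variable {Φ : Fin d → ℂ → ℕ → ℝ → ℂ}

lemma meromorphicOn_continuation (h : BlockRegular q C v c R)
    (hE : ∀ i, IsExpansion q C v R (Pi.single i 1) (Φ i)) :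
    MeromorphicOn (continuation q C v R Φ) {s : ℂ | Real.logb q R < s.re} := by
  intro s hs
  have e : continuation q C v R Φ = fun s => ∑ i, ContinuousLinearMap.single ℂ (fun _ : Fin d => ℂ) i
      (continuation q C v R Φ s i) := by
    funext s
    exact (Finset.univ_sum_single _).symm
  rw [e]
  refine MeromorphicAt.fun_sum fun i _ => meromorphicAt_clm_comp _ ?_
  exact (analyticAt_id.meromorphicAt.mul ((hE i).meromorphicAt_summatoryMellin h hs)).sub
    (MeromorphicAt.const _ _)

lemma analyticAt_continuation (h : BlockRegular q C v c R)
    (hE : ∀ i, IsExpansion q C v R (Pi.single i 1) (Φ i)) {s : ℂ} (hs : Real.logb q R < s.re)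
    (hsC : (q : ℂ) ^ s ∉ spectrum ℂ C) : AnalyticAt ℂ (continuation q C v R Φ) s := by
  rw [analyticAt_pi_iff]
  exact fun i => (analyticAt_id.mul ((hE i).analyticAt_summatoryMellin h hs hsC)).sub
    analyticAt_const

lemma continuation_eq_dirichletSum (h : BlockRegular q C v c R)
    (hspec : ∀ μ ∈ eigenvalues C, ‖μ‖ ≤ q * R)
    (hE : ∀ i, IsExpansion q C v R (Pi.single i 1) (Φ i)) {s : ℂ} (hs : Real.logb q R + 1 < s.re) :
    continuation q C v R Φ s = dirichletSum v s := by
  have hsum : Summable fun n => dirichletTerm v n s :=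
    ((hasLocalMajorants_dirichletTerm (mul_nonneg h.c_nonneg (by linarith [h.one_le]))
      fun n hn => h.norm_le_rpow hn).summable_norm hs).of_norm
  funext i
  have h1 := (hE i).dirichlet_eq h hspec hs
  simp only [single_one_dotProduct] at h1
  rw [continuation, ← h1, add_sub_cancel_left, dirichletSum, tsum_apply hsum]
  exact tsum_congr fun n => by simp [dirichletTerm]

lemma toMeromorphicNFOn_eq_of_analyticAt {E : Type*} [NormedAddCommGroup E] [NormedSpace ℂ E]
    {f : ℂ → E} {U : Set ℂ} (hf : MeromorphicOn f U) {s : ℂ} (hs : s ∈ U) (ha : AnalyticAt ℂ f s) :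
    toMeromorphicNFOn f U =ᶠ[𝓝 s] f := by
  have := toMeromorphicNFOn_eq_toMeromorphicNFAt_on_nhds hf hs
  rwa [toMeromorphicNFAt_eq_self.2 ha.meromorphicNFAt] at this

lemma hasResidueAt_continuation (h : BlockRegular q C v c R) [NeZero d]
    (hE : ∀ i, IsExpansion q C v R (Pi.single i 1) (Φ i)) {V : ℂ → Fin d → ℂ} {μ : ℂ} (l : ℤ)
    (hV : V =ᶠ[𝓝[≠] polePoint q μ l] continuation q C v R Φ) (hμC : μ ∈ eigenvalues C)
    (hμ : R < ‖μ‖) {k : ℕ} (hk : k < maxJordanBlock C μ) :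
    HasResidueAt (fun s => (v 0 0 + V s 0) * (s - polePoint q μ l) ^ k / s) (polePoint q μ l)
      ((k.factorial : ℂ) / (Real.log q : ℂ) ^ k *
        ∫ u in (0 : ℝ)..1, Φ 0 μ k u * Complex.exp (-(2 * l * Real.pi * Complex.I * u))) := by
  obtain ⟨H, hH, heq⟩ := (hE 0).exists_polar_part h hμC hμ l
  refine hasResidueAt_of_eventuallyEq (c := fun k => (k.factorial : ℂ) / (Real.log q : ℂ) ^ k *
    ∫ u in (0 : ℝ)..1, Φ 0 μ k u * Complex.exp (-(2 * l * Real.pi * Complex.I * u))) hH heq hk ?_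
  have hne : ∀ᶠ s : ℂ in 𝓝[≠] polePoint q μ l, s ≠ 0 := by
    rcases eq_or_ne (polePoint q μ l) 0 with h0 | h0
    · rw [h0]; exact self_mem_nhdsWithin
    · exact (eventually_ne_nhds h0).filter_mono nhdsWithin_le_nhds
  filter_upwards [hV, hne] with s hs hs0
  rw [hs, continuation]
  field_simp
  ring

end Continuation

lemma fluctuationSum_eq_mainTerm {Φ : ℂ → ℕ → ℝ → ℂ}
    (hΦ : ∀ μ ∈ eigenvalues C, R < ‖μ‖ → ∀ k, Function.Periodic (Φ μ k) 1) (N : ℕ) :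
    fluctuationSum q C R Φ N = mainTerm q C R Φ N := by
  refine Finset.sum_congr rfl fun μ hμ => ?_
  rw [Complex.ofReal_natCast]
  congr 1
  refine Finset.sum_congr rfl fun k _ => ?_
  have hμ' := Finset.mem_filter.1 hμ
  have := (hΦ μ hμ'.1 hμ'.2 k).sub_int_mul_eq (x := Real.logb q N) ⌊Real.logb q N⌋
  rw [mul_one] at this
  rw [← this, Int.self_sub_floor]

lemma hasResidueAt_zero (a : ℂ) : HasResidueAt (fun _ => 0) a 0 := by
  refine ⟨MeromorphicAt.const _ _, Eventually.of_forall fun r => ?_⟩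
  simp [circleIntegral]

end QRegular

theorem theorem1 (q d : ℕ) (hq : 2 ≤ q) [NeZero d]
    (A : Fin q → Matrix (Fin d) (Fin d) ℂ) (v : ℕ → Fin d → ℂ) (x : ℕ → ℂ)
    (hrep : QRegular.IsLinearRepresentation q d A v x)
    (C : Matrix (Fin d) (Fin d) ℂ) (hC : C = ∑ r, A r)
    (nrm : Seminorm ℂ (Fin d → ℂ)) (hnrm : ∀ y, nrm y = 0 → y = 0)
    (R : ℝ) (hR : 0 < R) (hAR : QRegular.ProductsBounded nrm A R) :
    ∃ (Φ : ℂ → ℕ → ℝ → ℂ) (V : ℂ → Fin d → ℂ),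
      -- The asymptotic expansion of the summatory function
      ((fun N : ℕ => QRegular.summatory x N - QRegular.fluctuationSum q C R Φ N)
        =O[atTop] fun N : ℕ =>
          (N : ℝ) ^ Real.logb q R * Real.log N ^ QRegular.criticalExponent C R) ∧
      ((∀ μ ∈ spectrum ℂ C, R < ‖μ‖) →
        ∀ N : ℕ, 1 ≤ N → QRegular.summatory x N = QRegular.fluctuationSum q C R Φ N) ∧
      -- Periodicity, continuity and Hölder continuity of the fluctuations
      (∀ μ ∈ spectrum ℂ C, R < ‖μ‖ → ∀ k < QRegular.maxJordanBlock C μ,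
        Function.Periodic (Φ μ k) 1 ∧ Continuous (Φ μ k) ∧
        ∀ α : ℝ≥0, 0 < α → (α : ℝ) < Real.logb q (‖μ‖ / R) →
          ∃ K : ℝ≥0, HolderWith K α (Φ μ k)) ∧
      -- The Dirichlet series and its meromorphic continuation `V`
      QRegular.ConvergesAbsUnifOnCompacts (QRegular.dirichletTerm v)
        {s : ℂ | Real.logb q R + 1 < s.re} ∧
      (∀ s : ℂ, Real.logb q R + 1 < s.re → V s = ∑' n, QRegular.dirichletTerm v n s) ∧
      MeromorphicNFOn V {s : ℂ | Real.logb q R < s.re} ∧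
      -- The functional equation, at all points that are not poles of `V`
      (∀ r : Fin q, QRegular.ConvergesAbsUnifOnCompacts
        (QRegular.shiftTerm V (((r : ℕ) : ℂ) / (q : ℂ))) {s : ℂ | Real.logb q R < s.re}) ∧
      (∀ s : ℂ, Real.logb q R < s.re → AnalyticAt ℂ V s →
        (1 - (q : ℂ) ^ (-s) • C) *ᵥ V s =
          ∑ n ∈ Finset.Ico 1 q, (n : ℂ) ^ (-s) • v n +
            (q : ℂ) ^ (-s) • ∑ r : Fin q,
              A r *ᵥ ∑' k, QRegular.shiftTerm V (((r : ℕ) : ℂ) / (q : ℂ)) k s) ∧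
      (∀ s : ℂ, Real.logb q R < s.re → ¬ AnalyticAt ℂ V s → (q : ℂ) ^ s ∈ spectrum ℂ C) ∧
      -- The Fourier series of the fluctuations
      (∀ μ ∈ spectrum ℂ C, max R (1 / q) < ‖μ‖ → ∀ k < QRegular.maxJordanBlock C μ,
        ∃ φ res : ℤ → ℂ,
          (∀ l : ℤ, QRegular.HasResidueAt
            (fun s => (x 0 + V s 0) * (s - QRegular.polePoint q μ l) ^ k / s)
            (QRegular.polePoint q μ l) (res l)) ∧
          (∀ l : ℤ, φ l = (Real.log q : ℂ) ^ k / (k.factorial : ℂ) * res l) ∧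
          (∀ l : ℤ, φ l =
            ∫ u in (0 : ℝ)..1, Φ μ k u * Complex.exp (-(2 * l * Real.pi * Complex.I * u))) ∧
          ∀ u : ℝ, Tendsto
            (fun p : ℕ × ℕ => ∑ l ∈ Finset.Icc (-(p.1 : ℤ)) (p.2 : ℤ),
              φ l * Complex.exp (2 * l * Real.pi * Complex.I * u))
            (atTop ×ˢ atTop) (𝓝 (Φ μ k u))) := by
  obtain ⟨c, hc0, hc⟩ := hAR.exists_sup_norm_bound hnrm hR
  have hq1 : (1 : ℝ) < q := by exact_mod_cast (by omega : 1 < q)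
  have hx : ∀ n, x n = v n 0 := fun n => (hrep.first_component n).symm
  rcases lt_or_ge R 1 with hR1 | hR1
  -- In this case `v = 0`, and all fluctuations vanish.
  · have hv : ∀ n, v n = 0 := QRegular.eq_zero_of_lt_one hq hrep.recurrence hR hR1 hc
    have hx0 : ∀ n, x n = 0 := fun n => by rw [hx, hv]; rfl
    have hsum : ∀ N, QRegular.summatory x N = 0 := fun N => Finset.sum_eq_zero fun n _ => hx0 n
    have hfl : ∀ N, QRegular.fluctuationSum q C R (fun _ _ _ => 0) N = 0 := fun N => by
      simp [QRegular.fluctuationSum]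
    have hdir : ∀ n s, QRegular.dirichletTerm v n s = 0 := fun n s => by
      rw [QRegular.dirichletTerm, hv, smul_zero]
    have hshift : ∀ t k s, QRegular.shiftTerm (fun _ => (0 : Fin d → ℂ)) t k s = 0 := fun t k s => by
      rw [QRegular.shiftTerm, smul_zero]
    have hzero : ∀ {f : ℕ → ℂ → Fin d → ℂ} (a : ℝ), (∀ n s, f n s = 0) →
        QRegular.ConvergesAbsUnifOnCompacts f {s : ℂ | a < s.re} := fun a hf =>
      QRegular.HasLocalMajorants.convergesAbsUnifOnCompacts fun _ _ _ =>
        ⟨fun _ => 0, summable_zero, fun n s _ _ => by rw [hf, norm_zero]⟩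
    refine ⟨fun _ _ _ => 0, fun _ => 0, ?_, fun _ N _ => by rw [hsum, hfl], fun _ _ _ _ _ => ?_,
      hzero _ hdir, fun s _ => by simp [hdir], analyticOnNhd_const.meromorphicNFOn,
      fun r => hzero _ (hshift _), fun s _ _ => ?_, fun s _ hs => absurd analyticAt_const hs,
      fun _ _ _ k _ => ⟨fun _ => 0, fun _ => 0, fun l => ?_, fun l => by simp, fun l => by simp,
        fun u => by simp⟩⟩
    · simp only [hsum, hfl, sub_zero]
      exact isBigO_zero _ _
    · exact ⟨fun _ => rfl, continuous_const, fun α _ _ => ⟨0, fun _ _ => by simp⟩⟩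
    · simp [hv, hshift]
    · simp only [hx0, Pi.zero_apply, add_zero, zero_mul, zero_div]
      exact QRegular.hasResidueAt_zero _
  · have h := QRegular.exists_blockRegular hq hrep.recurrence hC hR1 hc
    have hspec : ∀ μ ∈ QRegular.eigenvalues C, ‖μ‖ ≤ q * R := fun μ hμ =>
      QRegular.norm_le_of_mem_spectrum hC hR hq hc (QRegular.mem_eigenvalues.1 hμ)
    choose Φ hΦ hexact hbound using fun i : Fin d => h.exists_expansion hspec (Pi.single i 1)
    have hE : ∀ i, QRegular.IsExpansion q C v R (Pi.single i 1) (Φ i) := fun i =>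
      ⟨hΦ i, hbound i⟩
    have hmain : ∀ N : ℕ, QRegular.fluctuationSum q C R (Φ 0) N =
        QRegular.mainTerm q C R (Φ 0) N :=
      QRegular.fluctuationSum_eq_mainTerm fun μ hμ hμR k => (hΦ 0 μ hμ hμR k).periodic
    have hsum : ∀ N : ℕ, QRegular.summatory x N =
        Pi.single (0 : Fin d) (1 : ℂ) ⬝ᵥ QRegular.vecSum v N := fun N => by
      rw [single_one_dotProduct, QRegular.vecSum, Finset.sum_apply]
      exact Finset.sum_congr rfl fun n _ => hx n
    set ρ := Real.logb q R with hρ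
    have hρ0 : 0 ≤ ρ := h.logb_nonneg
    set B := c * ‖v 0‖ * R with hB
    have hB0 : 0 ≤ B := by positivity
    have hv : ∀ n : ℕ, 1 ≤ n → ‖v n‖ ≤ B * (n : ℝ) ^ ρ := fun n hn => h.norm_le_rpow hn
    set Ω : Set ℂ := {s : ℂ | ρ < s.re} with hΩ
    set V := toMeromorphicNFOn (QRegular.continuation q C v R Φ) Ω with hV
    have hmer := QRegular.meromorphicOn_continuation h hE
    have hVN : MeromorphicNFOn V Ω := meromorphicNFOn_toMeromorphicNFOn _ _
    have hVD : ∀ s : ℂ, ρ + 1 < s.re → V s = QRegular.dirichletSum v s := by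
      intro s hs
      have hsΩ : s ∈ Ω := show ρ < s.re by linarith
      have hopen : IsOpen {s : ℂ | ρ + 1 < s.re} := isOpen_lt continuous_const Complex.continuous_re
      have ha : AnalyticAt ℂ (QRegular.dirichletSum v) s :=
        DifferentiableOn.analyticAt (s := {s : ℂ | ρ + 1 < s.re}) (fun z hz =>
          (QRegular.differentiableAt_dirichletSum hB0 hv hz).differentiableWithinAt)
          (hopen.mem_nhds hs)
      have heq : QRegular.continuation q C v R Φ =ᶠ[𝓝 s] QRegular.dirichletSum v := by
        filter_upwards [hopen.mem_nhds hs] with z hz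
        exact QRegular.continuation_eq_dirichletSum h hspec hE hz
      exact ((QRegular.toMeromorphicNFOn_eq_of_analyticAt hmer hsΩ (ha.congr heq.symm)).trans
        heq).self_of_nhds
    have hshift : ∀ (t : ℂ) (k : ℕ) (s : ℂ), ρ < s.re →
        QRegular.shiftTerm V t k s = QRegular.shiftTerm (QRegular.dirichletSum v) t k s := by
      intro t k s hs
      rw [QRegular.shiftTerm, QRegular.shiftTerm, hVD]
      rw [Complex.add_re, Complex.natCast_re]
      push_cast
      have : (0 : ℝ) ≤ k := k.cast_nonneg
      linarith
    refine ⟨Φ 0, V, ?_, fun hall N hN => ?_, fun μ hμ hμR k _ => ?_,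
      (QRegular.hasLocalMajorants_dirichletTerm hB0 hv).convergesAbsUnifOnCompacts, hVD, hVN,
      fun r => ?_, fun s hs ha => ?_, fun s hs hna => ?_, fun μ hμ hμR k hk => ?_⟩
    · obtain ⟨K, hK, hb⟩ := hbound 0
      have := (QRegular.isBigO_of_digits_bound hq hR1 hK hb).comp_tendsto
        tendsto_natCast_atTop_atTop
      simpa only [Function.comp_def, Nat.floor_natCast, hsum, hmain] using this
    · rw [hsum, hmain]
      exact hexact 0 (fun μ hμ => hall μ (QRegular.mem_eigenvalues.1 hμ)) N hN
    · have hf := hΦ 0 μ (QRegular.mem_eigenvalues.2 hμ) hμR k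
      exact ⟨hf.periodic, hf.continuous, hf.holder⟩
    · have htr : ‖((r : ℕ) : ℂ) / (q : ℂ)‖ < 1 := by
        rw [norm_div, Complex.norm_natCast, Complex.norm_natCast, div_lt_one (by linarith)]
        exact_mod_cast r.2
      refine QRegular.HasLocalMajorants.convergesAbsUnifOnCompacts fun δ hδ S => ?_
      obtain ⟨u, hu, hle⟩ := QRegular.hasLocalMajorants_shiftTerm hB0 hv htr δ hδ S
      exact ⟨u, hu, fun k s hs hsS => by rw [hshift _ _ _ (by linarith)]; exact hle k s hs hsS⟩
    · have := QRegular.functional_equation hq hρ0 hB0 hv hrep.recurrence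
        hVN.meromorphicOn hVD hs ha
      rw [← hC] at this
      simp only [hshift _ _ _ hs]
      exact this
    · by_contra hsC
      have ha := QRegular.analyticAt_continuation h hE hs hsC
      exact hna (ha.congr (QRegular.toMeromorphicNFOn_eq_of_analyticAt hmer hs ha).symm)
    · have hμR' : R < ‖μ‖ := (le_max_left _ _).trans_lt hμR
      have hμC := QRegular.mem_eigenvalues.2 hμ
      have hf := hΦ 0 μ hμC hμR' k
      have hlog : (Real.log q : ℂ) ≠ 0 := by exact_mod_cast (Real.log_pos hq1).ne'
      have hfac : (k.factorial : ℂ) ≠ 0 := by exact_mod_cast k.factorial_ne_zero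
      refine ⟨fun l => ∫ u in (0 : ℝ)..1,
          Φ 0 μ k u * Complex.exp (-(2 * l * Real.pi * Complex.I * u)),
        fun l => (k.factorial : ℂ) / (Real.log q : ℂ) ^ k * ∫ u in (0 : ℝ)..1,
          Φ 0 μ k u * Complex.exp (-(2 * l * Real.pi * Complex.I * u)),
        fun l => ?_, fun l => ?_, fun l => rfl, fun u => ?_⟩
      · have hlΩ : QRegular.polePoint q μ l ∈ Ω := by
          show ρ < (QRegular.polePoint q μ l).re
          rw [QRegular.polePoint_re]
          exact Real.logb_lt_logb hq1 hR hμR'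
        rw [hx]
        exact QRegular.hasResidueAt_continuation h hE l
          (hmer.toMeromorphicNFOn_eq_self_on_nhdsNE hlΩ) hμC hμR' hk
      · field_simp
      · have hpos : 0 < Real.logb q (‖μ‖ / R) :=
          Real.logb_pos hq1 ((one_lt_div hR).2 hμR')
        obtain ⟨α, hα0, hα⟩ := exists_between hpos
        lift α to ℝ≥0 using hα0.le
        have hα0' : 0 < α := by exact_mod_cast hα0
        obtain ⟨K, hK⟩ := hf.holder α hα0' hα
        exact QRegular.tendsto_fourier_partial_sums hf.periodic hf.continuous hα0' hK u
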